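/- Let $N=\mathbb Z^n$ with $n\ge 2$. Let $(\Gamma,h)$ be a tropical curve in $N_{\mathbb R}$: $\Gamma$ is a connected finite weighted graph with bounded and unbounded edges, all of whose vertices are 2- or 3-valent, $h$ maps vertices to points with rational coordinates, contracts each bounded edge to a point or embeds it as a segment with primitive integral direction, embeds each unbounded edge as a half line with primitive integral direction, and satisfies the balancing condition at every vertex (contracted edges contributing $0$). Assume that $h$ contracts no loop of $\Gamma$. Let $g=\dim H_1(\Gamma;\mathbb Q)$ be its genus. Let $\mathscr P$ be a finite rational polyhedral decomposition of $N_{\mathbb R}$ into polyhedra with vertices, such that $h$ maps the vertices of $\Gamma$ to vertices of $\mathscr P$ and each non-contracted edge onto a 1-dimensional cell of $\mathscr P$ (2-valent vertices are added to $\Gamma$ where needed). Let $t\colon\mathfrak X\to\mathbb C$ be the associated toric degeneration: $\mathfrak X$ is the toric variety of the fan in $N_{\mathbb R}\times\mathbb R$ formed by the faces of the closed cones $C(\Xi)$ over $\Xi\times\{1\}$, $\Xi\in\mathscr P$, and $t$ is given by the projection $N\times\mathbb Z\to\mathbb Z$. Let $X_0=t^{-1}(0)=\bigcup_v X_v$ be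 its central fibre, with components $X_v$ indexed by the vertices $v$ of $\mathscr P$, and let $\Theta_{\mathfrak X/\mathbb C}$ be the logarithmic tangent sheaf of $\mathfrak X$ (with its toric log structure) relative to $\mathbb C$ (with the log structure given by $0\in\mathbb C$). Let $\varphi_0\colon C_0\to X_0$ be a pre-log curve of type $(\Gamma,h)$. That is, $\varphi_0$ is a stable map from a connected nodal curve such that: over each $X_v$ it is torically transverse (generically mapped to the open orbit of $X_v$, and avoiding the toric strata of $X_v$ of codimension $\ge 2$); every point mapped to the singular locus of $X_0$ is a node, whose two branches are mapped to different components of $X_0$ with equal intersection multiplicities with the double locus; the components of $C_0$ are copies of $\mathbb P^1$ which correspond to the connected components of the fibres of $h$ over the vertices of $h(\Gamma)$, the component of a connected component of $h^{-1}(v)$ being mapped non-constantly to $X_v$; the nodes correspond to the non-contracted bounded edges, compatibly with incidence; and the points of a component which are mapped to the toric boundary of $X_v$ correspond bijectively to the flags of non-contracted edges $E$ at the vertices of the corresponding connected component of $h^{-1}(v)$, the point of such a flag being mapped to the toric divisor of $h(E)$ with intersection multiplicity the weight of $E$. Then $$\dim_{\mathbb C} H^1(C_0,\varphi_0^*\Theta_{\mathfrak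 X/\mathbb C})=ng .$$ Moreover, the dualizing sheaf $\omega_{C_0}$ of $C_0$ satisfies $\dim_{\mathbb C}H^0(C_0,\omega_{C_0})=g$. -/

import Mathlib

noncomputable section

open Filter Topology TopologicalSpace CategoryTheory
open scoped TensorProduct

namespace TropDeg

/-! ## Reduced complex varieties as spaces with functions

A reduced scheme of finite type over `ℂ` is encoded by its set of closed points with the Zariski
topology, together with the local rings of germs of regular functions. -/

instance germAlgebra {α : Type} (l : Filter α) : Algebra ℂ (l.Germ ℂ) :=
  Algebra.ofModule
    (by intro c f g
        induction f using Filter.Germ.inductionOn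
        induction g using Filter.Germ.inductionOn
        exact congrArg _ (funext fun _ => mul_assoc _ _ _))
    (by intro c f g
        induction f using Filter.Germ.inductionOn
        induction g using Filter.Germ.inductionOn
        exact congrArg _ (funext fun _ => mul_left_comm _ _ _))

/-- A space with functions: to each point `x` the local `ℂ`-algebra of germs at `x` of regular
functions. -/
class HasRegularGerms (X : Type) [TopologicalSpace X] where
  stalk : (x : X) → Subalgebra ℂ ((𝓝 x).Germ ℂ)

/-- The local ring `𝒪_{X,x}`. -/
abbrev Stalk {X : Type} [TopologicalSpace X] [HasRegularGerms X] (x : X) :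
    Subalgebra ℂ ((𝓝 x).Germ ℂ) := HasRegularGerms.stalk x

/-- `f` is a regular function on `U` (its values outside `U` are irrelevant for open `U`). -/
def IsRegularOn {X : Type} [TopologicalSpace X] [HasRegularGerms X] (f : X → ℂ) (U : Set X) :
    Prop :=
  ∀ x ∈ U, (f : (𝓝 x).Germ ℂ) ∈ Stalk x

/-- Morphisms: continuous maps which pull back regular germs to regular germs. -/
structure Mor (X Y : Type) [TopologicalSpace X] [TopologicalSpace Y] [HasRegularGerms X]
    [HasRegularGerms Y] where
  toFun : X → Y
  cont : Continuous toFun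
  regular : ∀ x, ∀ g ∈ Stalk (toFun x), g.compTendsto toFun (cont.tendsto x) ∈ Stalk x

/-- The ring homomorphism `𝒪_{Y,φ(x)} → 𝒪_{X,x}` of a morphism `φ`. -/
def Mor.comap {X Y : Type} [TopologicalSpace X] [TopologicalSpace Y] [HasRegularGerms X]
    [HasRegularGerms Y] (φ : Mor X Y) (x : X) : Stalk (φ.toFun x) →+* Stalk x where
  toFun g := ⟨g.1.compTendsto φ.toFun (φ.cont.tendsto x), φ.regular x g.1 g.2⟩
  map_one' := rfl
  map_zero' := rfl
  map_mul' := by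
    rintro ⟨f, hf⟩ ⟨g, hg⟩
    apply Subtype.ext
    induction f using Filter.Germ.inductionOn
    induction g using Filter.Germ.inductionOn
    rfl
  map_add' := by
    rintro ⟨f, hf⟩ ⟨g, hg⟩
    apply Subtype.ext
    induction f using Filter.Germ.inductionOn
    induction g using Filter.Germ.inductionOn
    rfl

/-! ## Nodal curves with rational components -/

/-- The complex projective line with its Zariski topology. -/
abbrev P1 : Type := CofiniteTopology (OnePoint ℂ)

/-- The standard local coordinate of `ℙ¹` centred at `p`: `s ↦ a + s` if `p = a ∈ ℂ`, and
`s ↦ 1 / s` if `p = ∞`. -/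
def coord (p : P1) (s : ℂ) : P1 :=
  CofiniteTopology.of <|
    (CofiniteTopology.of.symm p).elim
      (if s = 0 then OnePoint.infty else ((s⁻¹ : ℂ) : OnePoint ℂ))
      (fun a => ((a + s : ℂ) : OnePoint ℂ))

/-- `f` is regular at `p`: near `p` it is a quotient of polynomials in the coordinate at `p`. -/
def IsRegularAt (f : P1 → ℂ) (p : P1) : Prop :=
  ∃ A B : Polynomial ℂ, B.eval 0 ≠ 0 ∧ f p = A.eval 0 / B.eval 0 ∧
    ∀ᶠ s in cofinite, f (coord p s) = A.eval s / B.eval s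

/-- `f` is regular at `p` and vanishes there to order exactly `w`. -/
def HasOrderAt (f : P1 → ℂ) (p : P1) (w : ℕ) : Prop :=
  ∃ A B : Polynomial ℂ, A.eval 0 ≠ 0 ∧ B.eval 0 ≠ 0 ∧ f p = 0 ^ w * A.eval 0 / B.eval 0 ∧
    ∀ᶠ s in cofinite, f (coord p s) = s ^ w * A.eval s / B.eval s

lemma eventually_eval_ne {B : Polynomial ℂ} (hB : B.eval 0 ≠ 0) :
    ∀ᶠ s in cofinite, B.eval s ≠ 0 := by
  have hB0 : B ≠ 0 := by rintro rfl; simp at hB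
  have := Polynomial.finite_setOfPred_isRoot hB0
  rw [Filter.eventually_cofinite]
  simpa [Polynomial.IsRoot] using this

lemma IsRegularAt.add {f g : P1 → ℂ} {p : P1} (hf : IsRegularAt f p) (hg : IsRegularAt g p) :
    IsRegularAt (f + g) p := by
  obtain ⟨A, B, hB, h0, h⟩ := hf
  obtain ⟨A', B', hB', h0', h'⟩ := hg
  refine ⟨A * B' + B * A', B * B', by simp [hB, hB'], ?_, ?_⟩
  · simp [h0, h0', div_add_div _ _ hB hB']
  · filter_upwards [h, h', eventually_eval_ne hB, eventually_eval_ne hB'] with s h1 h2 h3 h4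
    simp [h1, h2, div_add_div _ _ h3 h4]

lemma IsRegularAt.mul {f g : P1 → ℂ} {p : P1} (hf : IsRegularAt f p) (hg : IsRegularAt g p) :
    IsRegularAt (f * g) p := by
  obtain ⟨A, B, hB, h0, h⟩ := hf
  obtain ⟨A', B', hB', h0', h'⟩ := hg
  refine ⟨A * A', B * B', by simp [hB, hB'], ?_, ?_⟩
  · simp [h0, h0', div_mul_div_comm]
  · filter_upwards [h, h'] with s h1 h2
    simp [h1, h2, div_mul_div_comm]

/-- A connected projective nodal curve whose components have normalization `ℙ¹`: finitely many
copies of `ℙ¹`, glued transversally along finitely many pairs of points. The two branches of the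
node `ν` are `branch ν false` and `branch ν true`. -/
structure NodalCurve where
  Comp : Type
  Node : Type
  [finComp : Fintype Comp]
  [finNode : Fintype Node]
  branch : Node → Bool → (Σ _ : Comp, P1)
  branch_injective : Function.Injective fun x : Node × Bool => branch x.1 x.2
  nonempty : Nonempty Comp
  connected : ∀ i j : Comp,
    Relation.EqvGen (fun a b => ∃ ν, (branch ν false).1 = a ∧ (branch ν true).1 = b) i j

attribute [instance] NodalCurve.finComp NodalCurve.finNode

namespace NodalCurve

variable (C : NodalCurve)

/-- The points of the nodal curve. -/
def Point : Type :=
  Quot fun a b : (Σ _ : C.Comp, P1) => ∃ ν, a = C.branch ν false ∧ b = C.branch ν true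

/-- The Zariski topology (the quotient topology). -/
instance : TopologicalSpace C.Point := inferInstanceAs (TopologicalSpace (Quot _))

/-- The map `ℙ¹ → C` which normalizes the component `i`. -/
def pt (i : C.Comp) (p : P1) : C.Point := Quot.mk _ ⟨i, p⟩

/-- The regular germs are the functions on `C` whose pull back to the normalization is regular;
at a node this is `{(f', f'') | f' (P) = f'' (P)}`. -/
instance : HasRegularGerms C.Point where
  stalk c :=
    { carrier := {g | ∃ f : C.Point → ℂ, (f : (𝓝 c).Germ ℂ) = g ∧
        ∀ i p, C.pt i p = c → IsRegularAt (fun q => f (C.pt i q)) p}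
      mul_mem' := by
        rintro _ _ ⟨f, rfl, hf⟩ ⟨g, rfl, hg⟩
        exact ⟨f * g, rfl, fun i p h => (hf i p h).mul (hg i p h)⟩
      add_mem' := by
        rintro _ _ ⟨f, rfl, hf⟩ ⟨g, rfl, hg⟩
        exact ⟨f + g, rfl, fun i p h => (hf i p h).add (hg i p h)⟩
      algebraMap_mem' := fun r =>
        ⟨fun _ => r, by
          rw [Algebra.algebraMap_eq_smul_one]
          exact congrArg _ (funext fun _ => (mul_one r).symm),
          fun i p _ => ⟨Polynomial.C r, 1, by simp, by simp, by simp⟩⟩ }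

/-! ### The dualizing sheaf

A section of the dualizing sheaf consists of rational 1-forms on the components which are regular
away from the nodes and have at most simple poles with opposite residues at the two branches of
each node. -/

/-- The coefficient of the rational 1-form `η dz` in the coordinate `s` at `p`: it is `η (a + s)`
at `p = a`, and `- η (1 / s) / s ^ 2` at `p = ∞`. -/
def formCoeff (η : RatFunc ℂ) (p : P1) (s : ℂ) : ℂ :=
  (CofiniteTopology.of.symm p).elim
    (-(η.eval (RingHom.id ℂ) s⁻¹) / s ^ 2) (fun a => η.eval (RingHom.id ℂ) (a + s))

/-- `η dz` has at most a simple pole at `p`, with residue `r`. -/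
def HasResidue (η : RatFunc ℂ) (p : P1) (r : ℂ) : Prop :=
  ∃ A B : Polynomial ℂ, B.eval 0 ≠ 0 ∧ A.eval 0 / B.eval 0 = r ∧
    ∀ᶠ s in cofinite, s * formCoeff η p s = A.eval s / B.eval s

lemma eventually_denom (η : RatFunc ℂ) :
    ∀ᶠ z in cofinite, Polynomial.eval₂ (RingHom.id ℂ) z η.denom ≠ 0 := by
  have := Polynomial.finite_setOfPred_isRoot (RatFunc.denom_ne_zero η)
  rw [Filter.eventually_cofinite]
  simpa [Polynomial.IsRoot, Polynomial.eval₂_id] using this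

lemma formCoeff_add (η θ : RatFunc ℂ) (p : P1) :
    ∀ᶠ s in cofinite, formCoeff (η + θ) p s = formCoeff η p s + formCoeff θ p s := by
  have key : ∀ᶠ z in cofinite, (η + θ).eval (RingHom.id ℂ) z
      = η.eval (RingHom.id ℂ) z + θ.eval (RingHom.id ℂ) z := by
    filter_upwards [eventually_denom η, eventually_denom θ] with z h1 h2
    exact RatFunc.eval_add _ _ h1 h2
  unfold formCoeff
  induction CofiniteTopology.of.symm p using OnePoint.rec with
  | infty =>
    have h := (inv_injective (G := ℂ)).tendsto_cofinite.eventually key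
    filter_upwards [h] with s hs
    simp only [OnePoint.elim_infty, hs]
    ring
  | coe a =>
    exact (add_right_injective a).tendsto_cofinite.eventually key

lemma formCoeff_smul (c : ℂ) (η : RatFunc ℂ) (p : P1) :
    ∀ᶠ s in cofinite, formCoeff (c • η) p s = c * formCoeff η p s := by
  have key : ∀ᶠ z in cofinite, (c • η).eval (RingHom.id ℂ) z
      = c * η.eval (RingHom.id ℂ) z := by
    filter_upwards [eventually_denom η] with z h1
    rw [RatFunc.smul_eq_C_mul, RatFunc.eval_mul _ _ (by simp) h1]
    simp
  unfold formCoeff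
  induction CofiniteTopology.of.symm p using OnePoint.rec with
  | infty =>
    have h := (inv_injective (G := ℂ)).tendsto_cofinite.eventually key
    filter_upwards [h] with s hs
    simp only [OnePoint.elim_infty, hs]
    ring
  | coe a =>
    exact (add_right_injective a).tendsto_cofinite.eventually key

lemma HasResidue.add {η θ : RatFunc ℂ} {p : P1} {r t : ℂ} (hη : HasResidue η p r)
    (hθ : HasResidue θ p t) : HasResidue (η + θ) p (r + t) := by
  obtain ⟨A, B, hB, h0, h⟩ := hη
  obtain ⟨A', B', hB', h0', h'⟩ := hθ
  refine ⟨A * B' + B * A', B * B', by simp [hB, hB'], ?_, ?_⟩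
  · simp [← h0, ← h0', div_add_div _ _ hB hB']
  · filter_upwards [h, h', eventually_eval_ne hB, eventually_eval_ne hB', formCoeff_add η θ p]
      with s h1 h2 h3 h4 h5
    rw [h5, mul_add, h1, h2, div_add_div _ _ h3 h4]
    simp

lemma HasResidue.smul {η : RatFunc ℂ} {p : P1} {r : ℂ} (c : ℂ) (hη : HasResidue η p r) :
    HasResidue (c • η) p (c * r) := by
  obtain ⟨A, B, hB, h0, h⟩ := hη
  refine ⟨Polynomial.C c * A, B, hB, ?_, ?_⟩
  · simp [← h0, mul_div_assoc]
  · filter_upwards [h, formCoeff_smul c η p] with s h1 h2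
    rw [h2, mul_left_comm, h1]
    simp [mul_div_assoc]

lemma hasResidue_zero (p : P1) : HasResidue 0 p 0 := by
  refine ⟨0, 1, by simp, by simp, ?_⟩
  refine Eventually.of_forall fun s => ?_
  unfold formCoeff
  induction CofiniteTopology.of.symm p using OnePoint.rec <;> simp

/-- `H⁰(C, ω_C)`. A rational 1-form with at most a simple pole and residue `0` at a point is regular
there. -/
def dualizingSections : Submodule ℂ (C.Comp → RatFunc ℂ) where
  carrier := {η |
    (∀ i p, (∀ ν b, C.branch ν b ≠ ⟨i, p⟩) → HasResidue (η i) p 0) ∧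
    ∀ ν, ∃ r, HasResidue (η (C.branch ν false).1) (C.branch ν false).2 r ∧
      HasResidue (η (C.branch ν true).1) (C.branch ν true).2 (-r)}
  add_mem' := by
    rintro η θ ⟨h1, h2⟩ ⟨h1', h2'⟩
    refine ⟨fun i p h => by simpa using (h1 i p h).add (h1' i p h), fun ν => ?_⟩
    obtain ⟨r, hr, hr'⟩ := h2 ν
    obtain ⟨t, ht, ht'⟩ := h2' ν
    refine ⟨r + t, hr.add ht, ?_⟩
    rw [neg_add]
    exact hr'.add ht'
  zero_mem' := ⟨fun i p _ => hasResidue_zero p,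
    fun ν => ⟨0, hasResidue_zero _, by simpa using hasResidue_zero _⟩⟩
  smul_mem' := by
    rintro c η ⟨h1, h2⟩
    refine ⟨fun i p h => by simpa using (h1 i p h).smul c, fun ν => ?_⟩
    obtain ⟨r, hr, hr'⟩ := h2 ν
    refine ⟨c * r, hr.smul c, ?_⟩
    rw [← mul_neg]
    exact hr'.smul c

end NodalCurve

/-! ## Tropical curves in `N_ℝ`, `N = ℤⁿ` -/

/-- A connected weighted finite graph with bounded edges `E` (edge `e` joins `ends e false` and
`ends e true`) and unbounded edges `L`. -/
structure WGraph where
  V : Type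
  E : Type
  L : Type
  [finV : Fintype V]
  [finE : Fintype E]
  [finL : Fintype L]
  ends : E → Bool → V
  base : L → V
  wE : E → ℕ
  wL : L → ℕ
  wE_pos : ∀ e, 0 < wE e
  wL_pos : ∀ l, 0 < wL l
  nonempty : Nonempty V
  connected : ∀ a b : V,
    Relation.EqvGen (fun a b => ∃ e, ends e false = a ∧ ends e true = b) a b

attribute [instance] WGraph.finV WGraph.finE WGraph.finL

namespace WGraph

variable (Γ : WGraph)

/-- Flags; `Sum.inl (e, b)` is the bounded edge `e` with its end `b`. -/
abbrev Flag : Type := (Γ.E × Bool) ⊕ Γ.L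

/-- The vertex of a flag. -/
def vertex : Γ.Flag → Γ.V := Sum.elim (fun x => Γ.ends x.1 x.2) Γ.base

/-- The weight of the edge of a flag. -/
def weight : Γ.Flag → ℕ := Sum.elim (fun x => Γ.wE x.1) Γ.wL

/-- The number of flags at a vertex. -/
def valence (v : Γ.V) : ℕ := Nat.card {f : Γ.Flag // Γ.vertex f = v}

open Classical in
/-- The boundary map `C₁(Γ; ℚ) → C₀(Γ; ℚ)`; unbounded edges do not contribute to the homology. -/
def boundary : (Γ.E → ℚ) →ₗ[ℚ] (Γ.V → ℚ) where
  toFun c v := ∑ e, c e * ((if Γ.ends e true = v then 1 else 0) -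
    (if Γ.ends e false = v then 1 else 0))
  map_add' c d := by
    funext v
    simp only [Pi.add_apply, add_mul, Finset.sum_add_distrib]
  map_smul' r c := by
    funext v
    simp only [Pi.smul_apply, smul_eq_mul, mul_assoc, Finset.mul_sum, RingHom.id_apply]

/-- The genus, that is the first Betti number `dim H₁(Γ; ℚ)`. -/
def genus : ℕ := Module.finrank ℚ (LinearMap.ker Γ.boundary)

end WGraph

/-- Primitive integral vectors. -/
def IsPrimitive {n : ℕ} (u : Fin n → ℤ) : Prop :=
  ∀ (k : ℤ) (u' : Fin n → ℤ), u = k • u' → IsUnit k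

/-- The image in `N_ℝ` of a lattice vector. -/
def toReal {n : ℕ} (u : Fin n → ℤ) : Fin n → ℝ := fun i => (u i : ℝ)

/-- A (parametrized) tropical curve `h : Γ → N_ℝ`, given by the positions `pos` of the vertices and
the directions of the edges: a bounded edge is either contracted (and then has direction zero) or
embedded as a segment with primitive direction `dirE e` from `ends e false` to `ends e true`, and
an unbounded edge is embedded as a half line with primitive direction `dirL l`. -/
structure TropicalCurve (n : ℕ) extends WGraph where
  pos : V → Fin n → ℝ
  dirE : E → Fin n → ℤ
  dirL : L → Fin n → ℤ
  pos_rational : ∀ v i, ∃ q : ℚ, pos v i = (q : ℝ)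
  dirE_spec : ∀ e, (pos (ends e false) = pos (ends e true) ∧ dirE e = 0) ∨
    (IsPrimitive (dirE e) ∧ ∃ r : ℝ, 0 < r ∧
      pos (ends e true) = pos (ends e false) + r • toReal (dirE e))
  dirL_primitive : ∀ l, IsPrimitive (dirL l)
  balanced : open Classical in ∀ v,
    ∑ f : toWGraph.Flag, (if toWGraph.vertex f = v then
      (toWGraph.weight f : ℤ) • Sum.elim (fun x => if x.2 then -dirE x.1 else dirE x.1) dirL f
      else 0) = 0

namespace TropicalCurve

variable {n : ℕ} (T : TropicalCurve n)

/-- The bounded edge `e` is contracted by `h`. -/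
def Contracted (e : T.E) : Prop := T.pos (T.ends e false) = T.pos (T.ends e true)

/-- The bounded edges which are not contracted. -/
abbrev EdgeNC : Type := {e : T.E // ¬ T.Contracted e}

/-- `Γ` is 3-valent, 2-valent vertices being allowed (1-valent vertices are the removed points at
infinity), and `h` contracts no loop of `Γ`: no nonzero cycle is supported on contracted edges. -/
structure Admissible : Prop where
  threeValent : ∀ v, T.valence v = 2 ∨ T.valence v = 3
  noContractedLoop : ∀ c ∈ LinearMap.ker T.boundary, (∀ e, c e ≠ 0 → T.Contracted e) → c = 0

/-- The vertices of the graph obtained from `Γ` by contracting the contracted edges, that is the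
connected components of the sets `h⁻¹(v)`, `v` a vertex of `h(Γ)`. -/
def Cluster : Type :=
  Quot fun a b : T.V => ∃ e, T.Contracted e ∧ T.ends e false = a ∧ T.ends e true = b

/-- The cluster of a vertex. -/
def cluster (v : T.V) : T.Cluster := Quot.mk _ v

/-- Flags of edges which are not contracted. -/
abbrev FlagNC : Type := (T.EdgeNC × Bool) ⊕ T.L

/-- The vertex of a flag. -/
def vertexNC : T.FlagNC → T.V := Sum.elim (fun x => T.ends x.1.1 x.2) T.base

/-- The weight of a flag. -/
def weightNC : T.FlagNC → ℕ := Sum.elim (fun x => T.wE x.1.1) T.wL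

/-- The image `h(E)` of the edge of a flag. -/
def image : T.FlagNC → Set (Fin n → ℝ) :=
  Sum.elim (fun x => segment ℝ (T.pos (T.ends x.1.1 false)) (T.pos (T.ends x.1.1 true)))
    (fun l => {x | ∃ t : ℝ, 0 ≤ t ∧ x = T.pos (T.base l) + t • toReal (T.dirL l)})

end TropicalCurve

/-! ## Polyhedral decompositions and the associated toric degenerations -/

/-- A rational polyhedral decomposition of `N_ℝ`: a finite set of nonempty rational polyhedra
having at least one vertex, closed under passage to (nonempty) faces, meeting along common faces,
and covering `N_ℝ`. -/
structure PolyDecomp (n : ℕ) where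
  cells : Set (Set (Fin n → ℝ))
  finite : cells.Finite
  polyhedral : ∀ Ξ ∈ cells, ∃ A B : Finset (Fin n → ℚ), A.Nonempty ∧
    Ξ = {x | ∃ a ∈ convexHull ℝ ((fun q : Fin n → ℚ => fun i => (q i : ℝ)) '' (A : Set (Fin n → ℚ))),
      ∃ b : (Fin n → ℚ) → ℝ, (∀ q, 0 ≤ b q) ∧ x = a + ∑ q ∈ B, b q • fun i => (q i : ℝ)}
  vertex : ∀ Ξ ∈ cells, ∃ v, IsExposed ℝ Ξ {v}
  face : ∀ Ξ ∈ cells, ∀ F : Set (Fin n → ℝ), F.Nonempty → IsExposed ℝ Ξ F → F ∈ cells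
  inter : ∀ Ξ ∈ cells, ∀ Ξ' ∈ cells, IsExposed ℝ Ξ (Ξ ∩ Ξ') ∧ IsExposed ℝ Ξ' (Ξ ∩ Ξ')
  cover : ⋃₀ cells = Set.univ

/-- The character lattice `M × ℤ` of the degeneration, dual to `N × ℤ`. -/
abbrev Char (n : ℕ) : Type := (Fin n → ℤ) × ℤ

/-- The pairing of `M × ℤ` with `N_ℝ × ℝ`. -/
def pairing {n : ℕ} (m : Char n) (x : (Fin n → ℝ) × ℝ) : ℝ := ∑ i, (m.1 i : ℝ) * x.1 i + m.2 * x.2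

lemma pairing_add {n : ℕ} (m m' : Char n) (x : (Fin n → ℝ) × ℝ) :
    pairing (m + m') x = pairing m x + pairing m' x := by
  simp only [pairing, Prod.fst_add, Prod.snd_add, Pi.add_apply, Int.cast_add, add_mul,
    Finset.sum_add_distrib]
  ring

lemma pairing_zero {n : ℕ} (x : (Fin n → ℝ) × ℝ) : pairing (0 : Char n) x = 0 := by
  simp [pairing]

lemma pairing_neg {n : ℕ} (m : Char n) (x : (Fin n → ℝ) × ℝ) :
    pairing (-m) x = -pairing m x := by
  have := pairing_add m (-m) x
  rw [add_neg_cancel, pairing_zero] at this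
  linarith

/-- The monoid `σ^∨ ∩ (M × ℤ)`. -/
def dualMonoid {n : ℕ} (σ : Set ((Fin n → ℝ) × ℝ)) : AddSubmonoid (Char n) where
  carrier := {m | ∀ x ∈ σ, 0 ≤ pairing m x}
  add_mem' ha hb x hx := by rw [pairing_add]; exact add_nonneg (ha x hx) (hb x hx)
  zero_mem' x _ := by rw [pairing_zero]

/-- The group `σ^⊥ ∩ (M × ℤ)`. -/
def perp {n : ℕ} (σ : Set ((Fin n → ℝ) × ℝ)) : AddSubgroup (Char n) where
  carrier := {m | ∀ x ∈ σ, pairing m x = 0}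
  add_mem' ha hb x hx := by rw [pairing_add, ha x hx, hb x hx, add_zero]
  zero_mem' x _ := pairing_zero x
  neg_mem' ha x hx := by rw [pairing_neg, ha x hx, neg_zero]

/-- The cone `C(Ξ)`, the closure of the cone over `Ξ × {1}`. -/
def coneOver {n : ℕ} (Ξ : Set (Fin n → ℝ)) : Set ((Fin n → ℝ) × ℝ) :=
  closure {y | ∃ a : ℝ, 0 ≤ a ∧ ∃ x ∈ Ξ, y = (a • x, a)}

namespace PolyDecomp

variable {n : ℕ} (P : PolyDecomp n)

/-- The fan in `N_ℝ × ℝ` of the degeneration: all faces of the cones `C(Ξ)`. -/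
def fan : Set (Set ((Fin n → ℝ) × ℝ)) :=
  {τ | ∃ Ξ ∈ P.cells, τ.Nonempty ∧ IsExposed ℝ (coneOver Ξ) τ}

/-- The closed points of the toric variety `𝔛` of the fan, as the disjoint union of the torus orbits
`Hom(τ^⊥ ∩ (M × ℤ), ℂˣ)`. -/
structure Total where
  cone : Set ((Fin n → ℝ) × ℝ)
  mem : cone ∈ P.fan
  char : Multiplicative (perp cone) →* ℂˣ

namespace Total

variable {P}

open Classical in
/-- The value at `x` of the monomial `χ^m` (for `m ∈ σ^∨`, where `x` lies in the chart of `σ`). -/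
def monomial (m : Char n) (x : P.Total) : ℂ :=
  if h : m ∈ perp x.cone then (x.char (Multiplicative.ofAdd ⟨m, h⟩) : ℂ) else 0

lemma monomial_zero (x : P.Total) : monomial 0 x = 1 := by
  rw [monomial, dif_pos (perp x.cone).zero_mem]
  exact congrArg Units.val (map_one x.char)

lemma monomial_add {x : P.Total} {m m' : Char n} (hm : m ∈ dualMonoid x.cone)
    (hm' : m' ∈ dualMonoid x.cone) : monomial (m + m') x = monomial m x * monomial m' x := by
  by_cases h : m ∈ perp x.cone
  · by_cases h' : m' ∈ perp x.cone
    · rw [monomial, monomial, monomial, dif_pos h, dif_pos h', dif_pos (add_mem h h'),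
        ← Units.val_mul, ← map_mul]
      rfl
    · rw [monomial, monomial, monomial, dif_neg h', dif_neg, mul_zero]
      intro h2
      exact h' (by simpa using sub_mem h2 h)
  · rw [monomial, monomial, dif_neg h, dif_neg, zero_mul]
    intro h2
    apply h
    intro y hy
    have h1 := h2 y hy
    rw [pairing_add] at h1
    have := hm y hy
    have := hm' y hy
    linarith

/-- The affine chart `U_σ`: the union of the orbits of the faces of `σ`. -/
def chart (σ : Set ((Fin n → ℝ) × ℝ)) : Set P.Total := {x | IsExposed ℝ σ x.cone}

lemma cone_subset {σ : Set ((Fin n → ℝ) × ℝ)} {x : P.Total} (hx : x ∈ chart σ) : x.cone ⊆ σ :=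
  IsExposed.subset hx

/-- Evaluation at a point of `U_σ`, as a homomorphism on the coordinate ring
`ℂ[σ^∨ ∩ (M × ℤ)]`. -/
def evalHom {σ : Set ((Fin n → ℝ) × ℝ)} {x : P.Total} (hx : x ∈ chart σ) :
    AddMonoidAlgebra ℂ (dualMonoid σ) →ₐ[ℂ] ℂ :=
  AddMonoidAlgebra.lift ℂ ℂ (dualMonoid σ)
    { toFun := fun m => monomial (m.toAdd : Char n) x
      map_one' := monomial_zero x
      map_mul' := fun m m' => monomial_add
        (fun y hy => m.toAdd.2 y (cone_subset hx hy))
        (fun y hy => m'.toAdd.2 y (cone_subset hx hy)) }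

open Classical in
/-- The function on `U_σ` given by an element of its coordinate ring (extended by zero). -/
def evalFun {σ : Set ((Fin n → ℝ) × ℝ)} (f : AddMonoidAlgebra ℂ (dualMonoid σ)) (x : P.Total) : ℂ :=
  if hx : x ∈ chart σ then evalHom hx f else 0

/-- The Zariski topology, generated by the principal open subsets of the affine charts. -/
instance : TopologicalSpace P.Total :=
  generateFrom {U | ∃ σ ∈ P.fan, ∃ f : AddMonoidAlgebra ℂ (dualMonoid σ),
    U = {x | x ∈ chart σ ∧ evalFun f x ≠ 0}}

lemma mem_chart_self (x : P.Total) : x ∈ chart x.cone := IsExposed.refl x.cone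

lemma nhds_principal {x : P.Total} {f : AddMonoidAlgebra ℂ (dualMonoid x.cone)}
    (hf : evalFun f x ≠ 0) : ∀ᶠ y in 𝓝 x, y ∈ chart x.cone ∧ evalFun f y ≠ 0 :=
  IsOpen.mem_nhds (isOpen_generateFrom_of_mem ⟨x.cone, x.mem, f, rfl⟩) ⟨mem_chart_self x, hf⟩

lemma evalFun_mul {σ : Set ((Fin n → ℝ) × ℝ)} {y : P.Total} (hy : y ∈ chart σ)
    (f g : AddMonoidAlgebra ℂ (dualMonoid σ)) :
    evalFun (f * g) y = evalFun f y * evalFun g y := by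
  simp [evalFun, hy]

lemma evalFun_add {σ : Set ((Fin n → ℝ) × ℝ)} {y : P.Total} (hy : y ∈ chart σ)
    (f g : AddMonoidAlgebra ℂ (dualMonoid σ)) :
    evalFun (f + g) y = evalFun f y + evalFun g y := by
  simp [evalFun, hy]

/-- The local ring at `x`: quotients of elements of the coordinate ring of the smallest chart
around `x` whose denominator does not vanish at `x`. -/
instance : HasRegularGerms P.Total where
  stalk x :=
    { carrier := {g | ∃ f h : AddMonoidAlgebra ℂ (dualMonoid x.cone), evalFun h x ≠ 0 ∧
        g = ((fun y => evalFun f y / evalFun h y : P.Total → ℂ) : (𝓝 x).Germ ℂ)}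
      mul_mem' := by
        rintro _ _ ⟨f, h, hh, rfl⟩ ⟨f', h', hh', rfl⟩
        refine ⟨f * f', h * h', ?_, ?_⟩
        · rw [evalFun_mul (mem_chart_self x)]
          exact mul_ne_zero hh hh'
        · apply Filter.Germ.coe_eq.mpr
          filter_upwards [nhds_principal hh] with y hy
          simp only [evalFun_mul hy.1, div_mul_div_comm]
      add_mem' := by
        rintro _ _ ⟨f, h, hh, rfl⟩ ⟨f', h', hh', rfl⟩
        refine ⟨f * h' + h * f', h * h', ?_, ?_⟩
        · rw [evalFun_mul (mem_chart_self x)]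
          exact mul_ne_zero hh hh'
        · apply Filter.Germ.coe_eq.mpr
          filter_upwards [nhds_principal hh, nhds_principal hh'] with y hy hy'
          simp only [evalFun_mul hy.1, evalFun_add hy.1, div_add_div _ _ hy.2 hy'.2]
      algebraMap_mem' := by
        intro r
        refine ⟨algebraMap ℂ _ r, 1, ?_, ?_⟩
        · simp [evalFun, mem_chart_self x]
        · rw [Algebra.algebraMap_eq_smul_one]
          apply Filter.Germ.coe_eq.mpr
          have h1 : evalFun (1 : AddMonoidAlgebra ℂ (dualMonoid x.cone)) x ≠ 0 := by
            simp [evalFun, mem_chart_self x]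
          filter_upwards [nhds_principal h1] with y hy
          simp only [evalFun, hy.1, dite_true, AlgHom.commutes, map_one]
          simp }

/-- The function `t : 𝔛 → ℂ`, the monomial of the projection `N × ℤ → ℤ`. -/
def t : P.Total → ℂ := monomial (0, 1)

/-! ### The logarithmic tangent sheaf of `𝔛` relative to `ℂ` -/

/-- The stalk at `x` of the toric log structure of `𝔛`: products of monomials and units. -/
def logStructure (x : P.Total) : Set (Stalk x) :=
  {f | ∃ m ∈ dualMonoid x.cone, ∃ u : (Stalk x)ˣ,
    (f : (𝓝 x).Germ ℂ) = ((monomial m : P.Total → ℂ) : (𝓝 x).Germ ℂ) * ((u : Stalk x) : (𝓝 x).Germ ℂ)}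

/-- The stalk at `x` of the sheaf of logarithmic derivations of `𝔛` relative to the base `ℂ` with the
log structure defined by `t`. A logarithmic derivation is a derivation `D` with a map
`δ` from the log structure to the structure sheaf such that `D f = f * δ f`; here `δ` is determined
by `D` because the elements of the log structure are not zero divisors. Being relative to the base
means `D t = 0`. -/
def logTangentStalk (x : P.Total) : Submodule (Stalk x) (Derivation ℂ (Stalk x) (Stalk x)) where
  carrier := {D | (∀ f ∈ logStructure x, f ∣ D f) ∧
    ∀ f : Stalk x, (f : (𝓝 x).Germ ℂ) = ((t : P.Total → ℂ) : (𝓝 x).Germ ℂ) → D f = 0}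
  add_mem' := by
    rintro D D' ⟨h1, h2⟩ ⟨h1', h2'⟩
    exact ⟨fun f hf => dvd_add (h1 f hf) (h1' f hf), fun f hf => by simp [h2 f hf, h2' f hf]⟩
  zero_mem' := ⟨fun f _ => dvd_zero f, fun _ _ => rfl⟩
  smul_mem' := by
    rintro r D ⟨h1, h2⟩
    exact ⟨fun f hf => Dvd.dvd.mul_left (h1 f hf) r, fun f hf => by simp [h2 f hf]⟩

/-- `θ` is a section over `U` of the relative logarithmic tangent sheaf `Θ_{𝔛/ℂ}`, that is a
logarithmic derivation of the structure sheaf restricted to `U`. -/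
def IsLogField (U : Opens P.Total) (θ : (x : U) → logTangentStalk x.1) : Prop :=
  ∀ (V : Opens P.Total) (hV : V ≤ U) (f : P.Total → ℂ) (hf : IsRegularOn f (V : Set P.Total)),
    ∃ g : P.Total → ℂ, IsRegularOn g (V : Set P.Total) ∧
      ∀ (x : P.Total) (hx : x ∈ V),
        (((θ ⟨x, hV hx⟩).1 ⟨(f : (𝓝 x).Germ ℂ), hf x hx⟩ : Stalk x) : (𝓝 x).Germ ℂ) = g

/-! ### Strata of the central fibre -/

/-- The closure of the orbit of the cone `τ`. -/
def orbitClosure (τ : Set ((Fin n → ℝ) × ℝ)) : Set P.Total := {x | τ ⊆ x.cone}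

/-- The component `X_v` of the central fibre. -/
def component (v : Fin n → ℝ) : Set P.Total := orbitClosure (coneOver {v})

/-- The open orbit of `X_v`. -/
def interiorComponent (v : Fin n → ℝ) : Set P.Total := {x | x.cone = coneOver {v}}

end Total

/-- The vertices of the decomposition. -/
def vertices : Set (Fin n → ℝ) := {v | {v} ∈ P.cells}

/-- `h(Γ)` lies in the 1-skeleton of `P`, and the vertices of `Γ` are exactly the points (up to
contracted edges) which are mapped to vertices of `P`: vertices are mapped to vertices, and the
edges which are not contracted are mapped to 1-dimensional cells. -/
structure Respects (T : TropicalCurve n) : Prop where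
  vertex : ∀ v, T.pos v ∈ P.vertices
  edge : ∀ f, T.image f ∈ P.cells

end PolyDecomp

/-! ## Pull back of the logarithmic tangent sheaf and its cohomology -/

section Pullback

variable {n : ℕ} {P : PolyDecomp n} {C : NodalCurve} (φ : Mor C.Point P.Total)

/-- The local ring `𝒪_{C,c}`, viewed as an algebra over `𝒪_{𝔛,φ(c)}`. -/
def StalkAlong (_ : Mor C.Point P.Total) (c : C.Point) : Type := Stalk c

instance (c : C.Point) : CommRing (StalkAlong φ c) := inferInstanceAs (CommRing (Stalk c))

instance (c : C.Point) : Algebra (Stalk (φ.toFun c)) (StalkAlong φ c) :=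
  RingHom.toAlgebra (S := StalkAlong φ c) (φ.comap c)

/-- The stalk `𝒪_{C,c} ⊗ (Θ_{𝔛/ℂ})_{φ(c)}` over `𝒪_{𝔛,φ(c)}` of `φ^*Θ_{𝔛/ℂ}`. -/
def PullStalk (c : C.Point) : Type :=
  StalkAlong φ c ⊗[Stalk (φ.toFun c)] PolyDecomp.Total.logTangentStalk (φ.toFun c)

instance (c : C.Point) : AddCommGroup (PullStalk φ c) :=
  inferInstanceAs (AddCommGroup
    (StalkAlong φ c ⊗[Stalk (φ.toFun c)] PolyDecomp.Total.logTangentStalk (φ.toFun c)))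

instance (c : C.Point) : Module (StalkAlong φ c) (PullStalk φ c) :=
  inferInstanceAs (Module (StalkAlong φ c)
    (StalkAlong φ c ⊗[Stalk (φ.toFun c)] PolyDecomp.Total.logTangentStalk (φ.toFun c)))

/-- The pure tensor `f ⊗ θ`. -/
def tensor (c : C.Point) (f : StalkAlong φ c)
    (θ : PolyDecomp.Total.logTangentStalk (φ.toFun c)) : PullStalk φ c :=
  f ⊗ₜ[Stalk (φ.toFun c)] θ

/-- The germ at `c` of the function `f` on `C`. -/
def germAlong (W : Opens C.Point) (f : C.Point → ℂ) (hf : IsRegularOn f (W : Set C.Point)) (c : W) :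
    StalkAlong φ c.1 :=
  (⟨(f : (𝓝 c.1).Germ ℂ), hf c.1 c.2⟩ : Stalk c.1)

/-- The constant function `a` in `𝒪_{C,c}`. -/
def constAlong (a : ℂ) (c : C.Point) : StalkAlong φ c := algebraMap ℂ (Stalk c) a

/-- `s` is on `W` a finite sum of tensors `f ⊗ φ^{-1}θ` with regular functions `f` on `W` and
sections `θ` of `Θ_{𝔛/ℂ}` over a neighbourhood of `φ(W)`. -/
def IsPreSection (W : Opens C.Point) (s : (c : W) → PullStalk φ c.1) : Prop :=
  ∃ (U : Opens P.Total) (hU : ∀ c ∈ W, φ.toFun c ∈ U) (ι : Type) (_ : Fintype ι)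
    (f : ι → C.Point → ℂ) (hf : ∀ j, IsRegularOn (f j) (W : Set C.Point))
    (θ : ι → (x : U) → PolyDecomp.Total.logTangentStalk x.1),
    (∀ j, PolyDecomp.Total.IsLogField U (θ j)) ∧
    ∀ c : W, s c = ∑ j, tensor φ c.1 (germAlong φ W (f j) (hf j) c)
      (θ j ⟨φ.toFun c.1, hU c.1 c.2⟩)

/-- The sections of the sheaf `φ^*Θ_{𝔛/ℂ}`, the sheaf associated to the presheaf
`𝒪_C ⊗ φ^{-1}Θ_{𝔛/ℂ}`. -/
def IsSection (W : Opens C.Point) (s : (c : W) → PullStalk φ c.1) : Prop :=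
  ∀ c : W, ∃ (W' : Opens C.Point) (hW' : W' ≤ W), c.1 ∈ W' ∧
    IsPreSection φ W' fun x => s ⟨x.1, hW' x.2⟩

lemma IsPreSection.restrict {W W' : Opens C.Point} (h : W' ≤ W) {s : (c : W) → PullStalk φ c.1}
    (hs : IsPreSection φ W s) : IsPreSection φ W' fun x => s ⟨x.1, h x.2⟩ := by
  obtain ⟨U, hU, ι, hι, f, hf, θ, hθ, e⟩ := hs
  exact ⟨U, fun c hc => hU c (h hc), ι, hι, f, fun j x hx => hf j x (h hx), θ, hθ,
    fun c => e ⟨c.1, h c.2⟩⟩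

lemma IsPreSection.add {W : Opens C.Point} {s s' : (c : W) → PullStalk φ c.1}
    (hs : IsPreSection φ W s) (hs' : IsPreSection φ W s') : IsPreSection φ W (s + s') := by
  obtain ⟨U, hU, ι, hι, f, hf, θ, hθ, e⟩ := hs
  obtain ⟨U', hU', ι', hι', f', hf', θ', hθ', e'⟩ := hs'
  refine ⟨U ⊓ U', fun c hc => ⟨hU c hc, hU' c hc⟩, ι ⊕ ι', inferInstance, Sum.elim f f',
    fun j => by cases j with
      | inl j => exact hf j
      | inr j => exact hf' j,
    fun j x => Sum.elim (fun j => θ j ⟨x.1, x.2.1⟩) (fun j => θ' j ⟨x.1, x.2.2⟩) j, ?_, ?_⟩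
  · rintro (j | j) V hV g hg
    · exact hθ j V (hV.trans inf_le_left) g hg
    · exact hθ' j V (hV.trans inf_le_right) g hg
  · intro c
    rw [Fintype.sum_sum_type, Pi.add_apply, e c, e' c]
    rfl

lemma isRegularOn_const_mul {W : Opens C.Point} {f : C.Point → ℂ} (a : ℂ)
    (hf : IsRegularOn f (W : Set C.Point)) :
    IsRegularOn (fun x => a * f x) (W : Set C.Point) := fun x hx =>
  (Stalk x).smul_mem (hf x hx) a

lemma IsPreSection.smul {W : Opens C.Point} {s : (c : W) → PullStalk φ c.1} (a : ℂ)
    (hs : IsPreSection φ W s) : IsPreSection φ W fun c => constAlong φ a c.1 • s c := by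
  obtain ⟨U, hU, ι, hι, f, hf, θ, hθ, e⟩ := hs
  refine ⟨U, hU, ι, hι, fun j x => a * f j x, fun j => isRegularOn_const_mul a (hf j), θ, hθ, ?_⟩
  intro c
  change constAlong φ a c.1 • s c = _
  rw [e c, Finset.smul_sum]
  refine Finset.sum_congr rfl fun j _ => ?_
  refine (TensorProduct.smul_tmul' _ _ _).trans ?_
  change tensor φ c.1 _ _ = tensor φ c.1 _ _
  congr 1
  apply Subtype.ext
  change (algebraMap ℂ ((𝓝 c.1).Germ ℂ) a) * ((f j : (𝓝 c.1).Germ ℂ)) = _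
  rw [← Algebra.smul_def]
  rfl

lemma constAlong_add (a b : ℂ) (c : C.Point) :
    constAlong φ (a + b) c = constAlong φ a c + constAlong φ b c :=
  map_add (algebraMap ℂ (Stalk c)) a b

lemma constAlong_mul (a b : ℂ) (c : C.Point) :
    constAlong φ (a * b) c = constAlong φ a c * constAlong φ b c :=
  map_mul (algebraMap ℂ (Stalk c)) a b

lemma constAlong_one (c : C.Point) : constAlong φ 1 c = 1 := map_one (algebraMap ℂ (Stalk c))

lemma IsSection.smul {W : Opens C.Point} {s : (c : W) → PullStalk φ c.1} (a : ℂ)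
    (hs : IsSection φ W s) : IsSection φ W fun c => constAlong φ a c.1 • s c := fun c => by
  obtain ⟨W', h, hc, h'⟩ := hs c
  exact ⟨W', h, hc, h'.smul φ a⟩

/-- The group of sections of `φ^*Θ_{𝔛/ℂ}` over `W`. -/
def sections (W : Opens C.Point) : AddSubgroup ((c : W) → PullStalk φ c.1) where
  carrier := {s | IsSection φ W s}
  add_mem' := by
    intro s s' hs hs' c
    obtain ⟨W₁, h₁, hc₁, e₁⟩ := hs c
    obtain ⟨W₂, h₂, hc₂, e₂⟩ := hs' c
    exact ⟨W₁ ⊓ W₂, inf_le_left.trans h₁, ⟨hc₁, hc₂⟩,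
      (e₁.restrict φ inf_le_left).add φ (e₂.restrict φ inf_le_right)⟩
  zero_mem' := fun c => ⟨W, le_rfl, c.2, ⊤, fun _ _ => trivial, Empty, inferInstance,
    fun j => j.elim, fun j => j.elim, fun j => j.elim, fun j => j.elim, fun _ => by simp⟩
  neg_mem' := by
    intro s hs
    have h := IsSection.smul φ (-1) hs
    have e : (fun c : W => constAlong φ (-1) c.1 • s c) = -s := by
      funext c
      have h1 : constAlong φ (-1) c.1 = -1 := by
        rw [← constAlong_one φ c.1]
        exact map_neg (algebraMap ℂ (Stalk c.1)) 1
      rw [h1, neg_one_smul, Pi.neg_apply]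
    rw [e] at h
    exact h

/-- The locality of the condition `IsSection`. -/
def sectionPredicate : TopCat.LocalPredicate (X := TopCat.of C.Point) (fun c => PullStalk φ c) where
  pred {W} s := IsSection φ W s
  res {W W'} i s hs c := by
    obtain ⟨W₁, h₁, hc₁, e₁⟩ := hs ⟨c.1, i.le c.2⟩
    exact ⟨W ⊓ W₁, inf_le_left, ⟨c.2, hc₁⟩, e₁.restrict φ inf_le_right⟩
  locality {W} s hs c := by
    obtain ⟨W₁, hc₁, i, e₁⟩ := hs c
    obtain ⟨W₂, h₂, hc₂, e₂⟩ := e₁ ⟨c.1, hc₁⟩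
    exact ⟨W₂, h₂.trans i.le, hc₂, e₂⟩

/-- The presheaf of sections of `φ^*Θ_{𝔛/ℂ}`. -/
def pullbackPresheaf : TopCat.Presheaf AddCommGrpCat.{0} (TopCat.of C.Point) where
  obj W := AddCommGrpCat.of (sections φ W.unop)
  map i := AddCommGrpCat.ofHom
    { toFun := fun s => ⟨fun c => s.1 ⟨c.1, i.unop.le c.2⟩, (sectionPredicate φ).res i.unop s.1 s.2⟩
      map_zero' := rfl
      map_add' := fun _ _ => rfl }
  map_id _ := rfl
  map_comp _ _ := rfl

lemma pullbackPresheaf_isSheaf : (pullbackPresheaf φ).IsSheaf := by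
  rw [TopCat.Presheaf.isSheaf_iff_isSheaf_comp (forget AddCommGrpCat.{0})]
  exact TopCat.subpresheafToTypes.isSheaf (sectionPredicate φ)

/-- The sheaf `φ^*Θ_{𝔛/ℂ}` on `C`. -/
def pullbackSheaf : Sheaf (Opens.grothendieckTopology C.Point) AddCommGrpCat.{0} :=
  ⟨pullbackPresheaf φ, pullbackPresheaf_isSheaf φ⟩

/-- Multiplication by the complex number `a` on the sheaf `φ^*Θ_{𝔛/ℂ}`. -/
def scalar (a : ℂ) : pullbackSheaf φ ⟶ pullbackSheaf φ :=
  ⟨{ app := fun _ => AddCommGrpCat.ofHom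
      { toFun := fun s => ⟨fun c => constAlong φ a c.1 • s.1 c, IsSection.smul φ a s.2⟩
        map_zero' := Subtype.ext (funext fun _ => smul_zero _)
        map_add' := fun _ _ => Subtype.ext (funext fun _ => smul_add _ _ _) }
     naturality := fun _ _ _ => rfl }⟩

/-- `H^1(C, φ^*Θ_{𝔛/ℂ})`. -/
def PullbackH1 : Type := Sheaf.H (pullbackSheaf φ) 1

instance : AddCommGroup (PullbackH1 φ) := inferInstanceAs (AddCommGroup (Sheaf.H (pullbackSheaf φ) 1))

lemma scalar_add (a b : ℂ) : scalar φ (a + b) = scalar φ a + scalar φ b := by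
  apply Sheaf.hom_ext
  ext W s
  apply Subtype.ext
  funext c
  change constAlong φ (a + b) c.1 • s.1 c = constAlong φ a c.1 • s.1 c + constAlong φ b c.1 • s.1 c
  rw [constAlong_add, add_smul]

lemma scalar_mul (a b : ℂ) : scalar φ (a * b) = scalar φ b ≫ scalar φ a := by
  apply Sheaf.hom_ext
  ext W s
  apply Subtype.ext
  funext c
  change constAlong φ (a * b) c.1 • s.1 c = constAlong φ a c.1 • constAlong φ b c.1 • s.1 c
  rw [constAlong_mul, mul_smul]

lemma scalar_one : scalar φ 1 = 𝟙 _ := by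
  apply Sheaf.hom_ext
  ext W s
  apply Subtype.ext
  funext c
  change constAlong φ 1 c.1 • s.1 c = s.1 c
  rw [constAlong_one, one_smul]

/-- The complex vector space structure of `H^1(C, φ^*Θ_{𝔛/ℂ})`, induced by functoriality from the
one of the sheaf. -/
instance : Module ℂ (PullbackH1 φ) where
  smul a x := Sheaf.H.map (scalar φ a) 1 x
  smul_add a x y := map_add (Sheaf.H.map (scalar φ a) 1) x y
  smul_zero a := map_zero (Sheaf.H.map (scalar φ a) 1)
  add_smul a b x := by
    change Sheaf.H.map (scalar φ (a + b)) 1 x = _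
    rw [scalar_add]
    exact Sheaf.H.map_add_apply _ _ x
  zero_smul x := by
    have h : Sheaf.H.map (scalar φ (0 + 0)) 1 x
        = Sheaf.H.map (scalar φ 0) 1 x + Sheaf.H.map (scalar φ 0) 1 x := by
      rw [scalar_add]
      exact Sheaf.H.map_add_apply _ _ x
    rw [add_zero] at h
    exact left_eq_add.mp h
  mul_smul a b x := by
    change Sheaf.H.map (scalar φ (a * b)) 1 x = _
    rw [scalar_mul]
    exact Sheaf.H.map_comp_apply _ _ x
  one_smul x := by
    change Sheaf.H.map (scalar φ 1) 1 x = _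
    rw [scalar_one]
    exact Sheaf.H.map_id_apply x

end Pullback

/-! ## Pre-log curves -/

section PreLog

open PolyDecomp Total

variable {n : ℕ} {P : PolyDecomp n} {C : NodalCurve} (φ : Mor C.Point P.Total)

/-- `χ^m` is a local equation, in `X_v`, of the toric divisor which is the closure of the orbit of the
2-dimensional cone `τ ⊇ C({v})`: the element `m` generates the monoid `τ^∨ ∩ C({v})^⊥` modulo its
units `τ^⊥`. -/
def IsLocalEquation (v : Fin n → ℝ) (τ : Set ((Fin n → ℝ) × ℝ)) (m : Char n) : Prop :=
  m ∈ dualMonoid τ ∧ m ∈ perp (coneOver {v}) ∧ m ∉ perp τ ∧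
    ∀ m' ∈ dualMonoid τ, m' ∈ perp (coneOver {v}) → ∃ k : ℕ, m' - k • m ∈ perp τ

/-- At the point `p`, the restriction of `φ` to the component `i` (which is mapped to `X_v`) has
intersection multiplicity `w` with the toric divisor of `X_v` given by the cone `τ`. -/
def HasContact (i : C.Comp) (p : P1) (v : Fin n → ℝ) (τ : Set ((Fin n → ℝ) × ℝ)) (w : ℕ) : Prop :=
  ∃ m, IsLocalEquation v τ m ∧ HasOrderAt (fun q => monomial m (φ.toFun (C.pt i q))) p w

/-- The component `i` is mapped to `X_v`. -/
def MapsTo (i : C.Comp) (v : Fin n → ℝ) : Prop := ∀ p, φ.toFun (C.pt i p) ∈ component v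

/-- The map `φ` is constant on the component `i`. -/
def ConstantOn (i : C.Comp) : Prop := ∀ p q, φ.toFun (C.pt i p) = φ.toFun (C.pt i q)

/-- Pre-log curves `φ : C → X_0`. -/
structure IsPreLog : Prop where
  /-- The image lies in the central fibre. -/
  central : ∀ c, t (φ.toFun c) = 0
  /-- The map is stable: components on which it is constant have at least three branches of
  nodes. -/
  stable : ∀ i, ConstantOn φ i → 3 ≤ Nat.card {x : C.Node × Bool // (C.branch x.1 x.2).1 = i}
  /-- The restriction over `X_v` is generically mapped to the open orbit. -/
  dense : ∀ v ∈ P.vertices, φ.toFun ⁻¹' component v ⊆ closure (φ.toFun ⁻¹' interiorComponent v)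
  /-- The restriction over `X_v` avoids the toric strata of `X_v` of codimension at least two. -/
  transverse : ∀ v ∈ P.vertices, ∀ c, φ.toFun c ∈ component v →
    Module.finrank ℝ (Submodule.span ℝ (φ.toFun c).cone) ≤ 2
  /-- A point which is mapped to the singular locus of `X_0` (the points on at least two
  components) is a node; its branches are mapped to different components of `X_0`, with equal
  intersection multiplicities with the double locus. -/
  node : ∀ c, (∃ v ∈ P.vertices, ∃ v' ∈ P.vertices, v ≠ v' ∧ φ.toFun c ∈ component v ∧
      φ.toFun c ∈ component v') →
    ∃ ν, C.pt (C.branch ν false).1 (C.branch ν false).2 = c ∧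
      ∃ v ∈ P.vertices, ∃ v' ∈ P.vertices, v ≠ v' ∧
        MapsTo φ (C.branch ν false).1 v ∧ MapsTo φ (C.branch ν true).1 v' ∧
        ∃ w, HasContact φ (C.branch ν false).1 (C.branch ν false).2 v (φ.toFun c).cone w ∧
          HasContact φ (C.branch ν true).1 (C.branch ν true).2 v' (φ.toFun c).cone w

/-- The pre-log curve `φ` is of type `(Γ, h)`. The components of `C` correspond to the connected
components of the fibres of `h` over the vertices of `h(Γ)`, the nodes correspond to the bounded
edges which are not contracted, and `mark` gives the points of intersection with the toric divisors
of the components of `X_0`, which are indexed by the flags of edges which are not contracted. -/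
def IsOfType (T : TropicalCurve n) : Prop :=
  ∃ (comp : T.Cluster ≃ C.Comp) (node : T.EdgeNC ≃ C.Node) (swap : T.EdgeNC → Bool)
    (mark : T.FlagNC → P1),
    (∀ (e : T.EdgeNC) (b : Bool), C.branch (node e) (xor (swap e) b) =
      ⟨comp (T.cluster (T.ends e.1 b)), mark (Sum.inl (e, b))⟩) ∧
    (Function.Injective fun f : T.FlagNC => (comp (T.cluster (T.vertexNC f)), mark f)) ∧
    (∀ v : T.V, MapsTo φ (comp (T.cluster v)) (T.pos v) ∧
      ¬ ConstantOn φ (comp (T.cluster v)) ∧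
      ∀ p, φ.toFun (C.pt (comp (T.cluster v)) p) ∉ interiorComponent (T.pos v) →
        ∃ f, T.cluster (T.vertexNC f) = T.cluster v ∧ mark f = p) ∧
    ∀ f : T.FlagNC,
      φ.toFun (C.pt (comp (T.cluster (T.vertexNC f))) (mark f)) ∈
        orbitClosure (coneOver (T.image f)) ∧
      HasContact φ (comp (T.cluster (T.vertexNC f))) (mark f) (T.pos (T.vertexNC f))
        (coneOver (T.image f)) (T.weightNC f)

end PreLog

end TropDeg
end

/-
In coordinates, the logarithmic tangent sheaf of a toric degeneration is trivial of rank `n`: the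
vector fields acting on the monomials by `χ^m ↦ m_j χ^m` form a basis of every stalk, because the
dual monoids of the pointed cones generate the character lattice. Hence `φ^*Θ` is the sheaf of
vectors of `n` regular functions on `C`, and normalization gives a short exact sequence `0 → φ^*Θ →
ν_* 𝒪^n → ⨁ ℂ^n → 0` with one summand for each node. As `H¹(ℙ¹, 𝒪) = 0`, the space `H¹(C, φ^*Θ)` is
the cokernel of the map sending constants on the components to their differences at the nodes: it
is the first cohomology of the dual graph with coefficients in `ℂ^n`. Dually, a section of `ω_C` is
determined by its residues at the nodes, which may form any cycle of the dual graph, by the residue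
theorem and partial fractions. Finally, the dual graph arises from `Γ` by contracting edges which
form a forest, and therefore has the same first Betti number.
-/

noncomputable section

open Filter Topology TopologicalSpace CategoryTheory
open scoped TensorProduct

namespace TropDeg

/-! ## Sheaf cohomology in degree one -/

section Sheaves

open Opposite TopCat.Presheaf
open scoped AlgebraicGeometry

universe u

variable {X : TopCat.{u}} {S : ShortComplex (TopCat.Sheaf AddCommGrpCat.{u} X)}

lemma app_injective_of_mono {F G : Sheaf (Opens.grothendieckTopology X) AddCommGrpCat.{u}}
    (f : F ⟶ G) [hf : Mono f] (U : Opens X) : Function.Injective (f.hom.app (op U)) := by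
  have : Mono f.hom := (sheafToPresheaf _ _).map_mono f
  exact (AddCommGrpCat.mono_iff_injective _).mp ((NatTrans.mono_iff_mono_app f.hom).mp this _)

lemma shortExact_of_sections
    (hinj : ∀ U : Opens X, Function.Injective (S.f.hom.app (op U)))
    (hker : ∀ (U : Opens X) (s : S.X₂.obj.obj (op U)), S.g.hom.app (op U) s = 0 →
      ∃ r, S.f.hom.app (op U) r = s)
    (hsurj : IsLocallySurjective S.g.hom) : S.ShortExact where
  exact := by
    rw [ShortComplex.exact_iff_epi_kernel_lift, ← TopCat.Sheaf.isLocallySurjective_iff_epi,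
      isLocallySurjective_iff]
    intro U s x hx
    have hs : S.g.hom.app (op U) ((Limits.kernel.ι S.g).hom.app (op U) s) = 0 :=
      congrArg (fun α : Limits.kernel S.g ⟶ S.X₃ => α.hom.app (op U) s)
        (Limits.kernel.condition S.g)
    obtain ⟨r, hr⟩ := hker U _ hs
    have hlift : (Limits.kernel.ι S.g).hom.app (op U)
        ((Limits.kernel.lift S.g S.f S.zero).hom.app (op U) r) = S.f.hom.app (op U) r :=
      congrArg (fun α : S.X₁ ⟶ S.X₂ => α.hom.app (op U) r) (Limits.kernel.lift_ι S.g S.f S.zero)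
    have hι := app_injective_of_mono (Limits.kernel.ι S.g) (hf := Limits.equalizer.ι_mono) U
    refine ⟨U, le_rfl, ⟨r, hι ((hlift.trans hr).trans ?_)⟩, hx⟩
    exact congrArg _ (restrict_self s).symm
  mono_f := by
    have (U : (Opens X)ᵒᵖ) : Mono (S.f.hom.app U) :=
      (AddCommGrpCat.mono_iff_injective _).mpr (hinj U.unop)
    exact (sheafToPresheaf _ _).mono_of_mono_map (NatTrans.mono_of_mono_app S.f.hom)
  epi_g := (TopCat.Sheaf.isLocallySurjective_iff_epi S.g).mp hsurj

/-- The Čech cohomology of `F` vanishes for every cover by two open sets: a section over an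
overlap is a difference of sections over the two open sets. -/
def SplitsOverlaps (F : TopCat.Sheaf AddCommGrpCat.{u} X) : Prop :=
  ∀ (U V : Opens X) (s : F.obj.obj (op (U ⊓ V))),
    ∃ (a : F.obj.obj (op U)) (b : F.obj.obj (op V)), s = a |_ (U ⊓ V) - b |_ (U ⊓ V)

lemma exists_glue_sup (F : TopCat.Sheaf AddCommGrpCat.{u} X) {U V : Opens X}
    (a : F.obj.obj (op U)) (b : F.obj.obj (op V)) (hab : a |_ (U ⊓ V) = b |_ (U ⊓ V)) :
    ∃ c : F.obj.obj (op (U ⊔ V)), c |_ U = a ∧ c |_ V = b := by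
  let W : Fin 2 → Opens X := ![U, V]
  let s : (i : Fin 2) → F.obj.obj (op (W i))
    | 0 => a
    | 1 => b
  have hcomp : IsCompatible F.obj W s := by
    simp only [IsCompatible, Fin.forall_fin_two]
    refine ⟨⟨rfl, hab⟩, ?_, rfl⟩
    have := congrArg (fun t => restrictOpen t (V ⊓ U) (inf_comm V U).le) hab
    simp only [restrict_restrict] at this
    exact this.symm
  obtain ⟨c, hc, -⟩ := F.existsUnique_gluing' W (U ⊔ V)
    (fun i => homOfLE (by fin_cases i; exacts [le_sup_left, le_sup_right]))
    (sup_le (le_iSup W 0) (le_iSup W 1)) s hcomp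
  exact ⟨c, hc 0, hc 1⟩

lemma exists_lifts_eq_on_inf (hS : S.ShortExact) (hF : SplitsOverlaps S.X₁) {U V : Opens X}
    (r : S.X₂.obj.obj (op U)) (q : S.X₂.obj.obj (op V))
    (h : S.g.hom.app (op U) r |_ (U ⊓ V) = S.g.hom.app (op V) q |_ (U ⊓ V)) :
    ∃ (r' : S.X₂.obj.obj (op U)) (q' : S.X₂.obj.obj (op V)),
      S.g.hom.app (op U) r' = S.g.hom.app (op U) r ∧
      S.g.hom.app (op V) q' = S.g.hom.app (op V) q ∧ r' |_ (U ⊓ V) = q' |_ (U ⊓ V) := by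
  have hgf (W : Opens X) (x : S.X₁.obj.obj (op W)) :
      S.g.hom.app (op W) (S.f.hom.app (op W) x) = 0 :=
    congrArg (fun α : S.X₁ ⟶ S.X₃ => α.hom.app (op W) x) S.zero
  have hker : S.g.hom.app (op (U ⊓ V)) (r |_ (U ⊓ V) - q |_ (U ⊓ V)) = 0 := by
    rw [map_sub, map_restrict, map_restrict, h, sub_self]
  obtain ⟨d, hd⟩ := TopCat.Sheaf.sections_exact_of_left_exact hS.exact hS.mono_f _ hker
  obtain ⟨a, b, rfl⟩ := hF U V d
  refine ⟨r - S.f.hom.app (op U) a, q - S.f.hom.app (op V) b, ?_, ?_, ?_⟩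
  · rw [map_sub, hgf, sub_zero]
  · rw [map_sub, hgf, sub_zero]
  · rw [map_sub, map_restrict, map_restrict] at hd
    change S.X₂.obj.map _ _ = S.X₂.obj.map _ _
    rw [map_sub, map_sub, sub_eq_sub_iff_sub_eq_sub]
    exact hd.symm

lemma exists_lift_sup (hS : S.ShortExact) (hF : SplitsOverlaps S.X₁) (s : S.X₃.obj.obj (op ⊤))
    {U V : Opens X} (hU : ∃ r, S.g.hom.app (op U) r = s |_ U)
    (hV : ∃ r, S.g.hom.app (op V) r = s |_ V) :
    ∃ r, S.g.hom.app (op (U ⊔ V)) r = s |_ (U ⊔ V) := by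
  obtain ⟨r, hr⟩ := hU
  obtain ⟨q, hq⟩ := hV
  obtain ⟨r', q', hr', hq', hrq⟩ := exists_lifts_eq_on_inf hS hF r q (by
    rw [hr, hq, restrict_restrict, restrict_restrict])
  obtain ⟨c, hcU, hcV⟩ := exists_glue_sup S.X₂ r' q' hrq
  refine ⟨c, S.X₃.eq_of_locally_eq₂ (homOfLE (le_sup_left : U ≤ U ⊔ V))
    (homOfLE (le_sup_right : V ≤ U ⊔ V)) le_rfl _ _ ?_ ?_⟩
  · change _ |_ U = _ |_ U
    rw [← map_restrict, hcU, hr', hr, restrict_restrict]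
  · change _ |_ V = _ |_ V
    rw [← map_restrict, hcV, hq', hq, restrict_restrict]

/-- A Mayer–Vietoris induction: lifts over finitely many open sets can be glued one by one. -/
lemma surjective_of_splitsOverlaps [CompactSpace X] (hS : S.ShortExact)
    (hF : SplitsOverlaps S.X₁) : Function.Surjective (S.g.hom.app (op ⊤)) := by
  intro s
  have hloc := (isLocallySurjective_iff S.g.hom).mp
    ((TopCat.Sheaf.isLocallySurjective_iff_epi S.g).mpr hS.epi_g) ⊤ s
  obtain ⟨U, hU, r, hr⟩ := (isCompact_univ (X := X)).induction_on
    (p := fun A => ∃ U : Opens X, A ⊆ U ∧ ∃ r, S.g.hom.app (op U) r = s |_ U)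
    ⟨⊥, Set.empty_subset _, 0, S.X₃.eq_of_locally_eq' (fun i : Empty => i.elim) ⊥ (fun i => i.elim)
      bot_le _ _ (fun i => i.elim)⟩
    (fun A B hAB ⟨U, hU, h⟩ => ⟨U, hAB.trans hU, h⟩)
    (fun A B ⟨U, hU, h⟩ ⟨V, hV, h'⟩ =>
      ⟨U ⊔ V, Set.union_subset_union hU hV, exists_lift_sup hS hF s h h'⟩)
    (fun x _ => by
      obtain ⟨V, hV, ⟨r, hr⟩, hx⟩ := hloc x trivial
      exact ⟨V, mem_nhdsWithin_of_mem_nhds (V.isOpen.mem_nhds hx), V, le_rfl, r, hr⟩)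
  obtain rfl : U = ⊤ := top_unique fun x _ => hU trivial
  exact ⟨r, hr.trans (restrict_self s)⟩

end Sheaves

section Cohomology

open Opposite Abelian

variable {X : TopCat.{0}}
  {S : ShortComplex (Sheaf (Opens.grothendieckTopology X) AddCommGrpCat.{0})}

/-- The connecting homomorphism `S.X₃(⊤) → H¹(S.X₁)` of a short exact sequence of sheaves,
as the product with the class of the extension. -/
def connecting (hS : S.ShortExact) : S.X₃.obj.obj (op ⊤) →+ Sheaf.H S.X₁ 1 where
  toFun s :=
    ((Sheaf.H.equiv₀ S.X₃ (T := (⊤ : Opens X)) Limits.isTerminalTop).symm s).comp hS.extClass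
      (zero_add 1)
  map_zero' := by rw [map_zero, Ext.zero_comp]
  map_add' s s' := by rw [map_add, Ext.add_comp]

lemma connecting_apply (hS : S.ShortExact) (s : S.X₃.obj.obj (op ⊤)) :
    connecting hS s = ((Sheaf.H.equiv₀ S.X₃ (T := (⊤ : Opens X)) Limits.isTerminalTop).symm s).comp
      hS.extClass (zero_add 1) := rfl

lemma connecting_eq_zero_iff (hS : S.ShortExact) (s : S.X₃.obj.obj (op ⊤)) :
    connecting hS s = 0 ↔ ∃ r, S.g.hom.app (op ⊤) r = s := by
  constructor
  · intro h
    obtain ⟨x, hx⟩ := Ext.covariant_sequence_exact₃ _ hS _ (zero_add 1) h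
    refine ⟨Sheaf.H.equiv₀ S.X₂ Limits.isTerminalTop x, ?_⟩
    rw [Sheaf.H.equiv₀_naturality, Sheaf.H.map_apply]
    exact (congrArg (Sheaf.H.equiv₀ S.X₃ Limits.isTerminalTop) hx).trans
      (AddEquiv.apply_symm_apply _ s)
  · rintro ⟨r, rfl⟩
    rw [connecting_apply, ← Sheaf.H.equiv₀_symm_naturality, Sheaf.H.map_apply,
      Ext.comp_assoc_of_second_deg_zero, hS.comp_extClass, Ext.comp_zero]

lemma connecting_surjective (hS : S.ShortExact) [Subsingleton (Sheaf.H S.X₂ 1)] :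
    Function.Surjective (connecting hS) := by
  intro x
  obtain ⟨y, hy⟩ := Ext.covariant_sequence_exact₁ _ hS x
    (Subsingleton.elim (α := Sheaf.H S.X₂ 1) _ _) (zero_add 1)
  refine ⟨Sheaf.H.equiv₀ S.X₃ Limits.isTerminalTop y, ?_⟩
  rw [connecting_apply, AddEquiv.symm_apply_apply, hy]

lemma connecting_naturality
    {S' : ShortComplex (Sheaf (Opens.grothendieckTopology X) AddCommGrpCat.{0})}
    (hS : S.ShortExact) (hS' : S'.ShortExact) (α : S ⟶ S') (s : S.X₃.obj.obj (op ⊤)) :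
    connecting hS' (α.τ₃.hom.app (op ⊤) s) = Sheaf.H.map α.τ₁ 1 (connecting hS s) := by
  rw [connecting_apply, connecting_apply, ← Sheaf.H.equiv₀_symm_naturality, Sheaf.H.map_apply,
    Sheaf.H.map_apply, Ext.comp_assoc_of_second_deg_zero, Ext.comp_assoc_of_third_deg_zero,
    hS.extClass_naturality hS' α]

lemma subsingleton_H_one_of_splitsOverlaps [CompactSpace X]
    {F : Sheaf (Opens.grothendieckTopology X) AddCommGrpCat.{0}}
    (hF : SplitsOverlaps (X := X) F) : Subsingleton (Sheaf.H F 1) := by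
  let S : ShortComplex (Sheaf (Opens.grothendieckTopology X) AddCommGrpCat.{0}) :=
    ShortComplex.mk (Injective.ι F) (Limits.cokernel.π (Injective.ι F)) (by simp)
  have hS : S.ShortExact := { exact := ShortComplex.exact_cokernel _ }
  have : Subsingleton (Sheaf.H S.X₂ 1) :=
    inferInstanceAs (Subsingleton (Sheaf.H (Injective.under F) (0 + 1)))
  refine subsingleton_of_forall_eq 0 fun x => ?_
  obtain ⟨s, rfl⟩ := connecting_surjective hS x
  exact (connecting_eq_zero_iff hS s).mpr (surjective_of_splitsOverlaps (X := X) hS hF s)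

end Cohomology

/-! ## Rational functions on the projective line -/

section Polynomials

open Polynomial

variable {K : Type*} [Field K]

lemma eventually_eval_ne_zero {B : K[X]} (hB : B ≠ 0) : ∀ᶠ s in cofinite, B.eval s ≠ 0 := by
  rw [Filter.eventually_cofinite]
  simpa [Polynomial.IsRoot] using Polynomial.finite_setOfPred_isRoot hB

lemma eventually_ne_zero : ∀ᶠ s : K in cofinite, s ≠ 0 := by
  simp [Filter.eventually_cofinite]

lemma eval_reflect_eq {A : K[X]} {N : ℕ} (hN : A.natDegree ≤ N) {s : K} (hs : s ≠ 0) :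
    (A.reflect N).eval s = s ^ N * A.eval s⁻¹ := by
  have : Invertible s⁻¹ := invertibleOfNonzero (inv_ne_zero hs)
  have h := Polynomial.eval₂_reflect_mul_pow (RingHom.id K) s⁻¹ N A hN
  rw [invOf_eq_inv, inv_inv] at h
  simp only [Polynomial.eval₂_id] at h
  rw [← h, mul_left_comm, ← mul_pow, mul_inv_cancel₀ hs, one_pow, mul_one]

lemma eval_zero_reflect (A : K[X]) (N : ℕ) : (A.reflect N).eval 0 = A.coeff N := by
  rw [← Polynomial.coeff_zero_eq_eval_zero, Polynomial.coeff_reflect, Polynomial.revAt_zero]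

lemma exists_isCoprime_eventually_div_eq (A : K[X]) {B : K[X]} (hB : B ≠ 0) :
    ∃ A' B' : K[X], B'.Monic ∧ IsCoprime A' B' ∧
      ∀ᶠ z in cofinite, A.eval z / B.eval z = A'.eval z / B'.eval z := by
  let x : RatFunc K := algebraMap K[X] _ A / algebraMap K[X] _ B
  have hx : x.num * B = A * x.denom := (RatFunc.num_mul_eq_mul_denom_iff hB).mpr rfl
  refine ⟨x.num, x.denom, x.monic_denom, x.isCoprime_num_denom, ?_⟩
  filter_upwards [eventually_eval_ne_zero hB, eventually_eval_ne_zero x.denom_ne_zero]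
    with z hBz hxz
  rw [div_eq_div_iff hBz hxz, ← eval_mul, ← hx, eval_mul]

lemma exists_factorization_of_roots_mem [IsAlgClosed K] {B : K[X]} (hB : B.Monic) (S : Set K) :
    ∃ B₁ B₂ : K[X], B₁.Monic ∧ B₂.Monic ∧ IsCoprime B₁ B₂ ∧ B = B₁ * B₂ ∧
      (∀ z, B₁.eval z = 0 → z ∈ S) ∧ ∀ z, B₂.eval z = 0 → z ∉ S := by
  classical
  have mem_of_eval (m : Multiset K) (z : K) (hz : ((m.map fun a => X - C a).prod).eval z = 0) :
      z ∈ m := by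
    rw [eval_multiset_prod, Multiset.prod_eq_zero_iff, Multiset.map_map] at hz
    obtain ⟨a, ha, h⟩ := Multiset.mem_map.mp hz
    simp only [Function.comp_apply, eval_sub, eval_X, eval_C, sub_eq_zero] at h
    rwa [h]
  have h₁ (z : K) (hz : (((B.roots.filter (· ∈ S)).map fun a => X - C a).prod).eval z = 0) :
      z ∈ S := (Multiset.mem_filter.mp (mem_of_eval _ _ hz)).2
  have h₂ (z : K) (hz : (((B.roots.filter (¬ · ∈ S)).map fun a => X - C a).prod).eval z = 0) :
      z ∉ S := (Multiset.mem_filter.mp (mem_of_eval _ _ hz)).2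
  refine ⟨_, _, monic_multiset_prod_of_monic _ _ fun a _ => monic_X_sub_C a,
    monic_multiset_prod_of_monic _ _ fun a _ => monic_X_sub_C a, ?_, ?_, h₁, h₂⟩
  · rw [Polynomial.isCoprime_iff_aeval_ne_zero_of_isAlgClosed K K]
    intro z
    by_contra! h
    exact h₂ z h.2 (h₁ z h.1)
  · rw [← Multiset.prod_add, ← Multiset.map_add, Multiset.filter_add_not]
    exact (IsAlgClosed.splits B).eq_prod_roots_of_monic hB

lemma exists_partialFractions (A : K[X]) {B₁ B₂ : K[X]} (hB₁ : B₁.Monic) (hB₂ : B₂.Monic)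
    (hcop : IsCoprime B₁ B₂) :
    ∃ r₁ r₂ : K[X], r₁.degree < B₁.degree ∧ r₂.degree < B₂.degree ∧
      A = (A /ₘ (B₁ * B₂)) * (B₁ * B₂) + r₁ * B₂ + r₂ * B₁ := by
  have hpair : Set.Pairwise (Finset.univ : Finset (Fin 2)) fun i j =>
      IsCoprime (![B₁, B₂] i) (![B₁, B₂] j) := by
    intro i _ j _ hij
    fin_cases i <;> fin_cases j <;> simp_all [hcop.symm]
  obtain ⟨q, r, hr, hA⟩ := eq_quo_mul_prod_add_sum_rem_mul_prod A (s := Finset.univ)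
    (g := ![B₁, B₂]) (by simp [Fin.forall_fin_two, hB₁, hB₂]) hpair
  have h₁ := hr 0 (Finset.mem_univ _)
  have h₂ := hr 1 (Finset.mem_univ _)
  have herase : (Finset.univ.erase (0 : Fin 2)) = {1} ∧ (Finset.univ.erase (1 : Fin 2)) = {0} := by
    decide
  simp only [Fin.prod_univ_two, Fin.sum_univ_two, herase.1, herase.2, Finset.prod_singleton,
    Matrix.cons_val_zero, Matrix.cons_val_one] at hA h₁ h₂
  have hdeg : (r 0 * B₂ + r 1 * B₁).degree < (B₁ * B₂).degree := by
    refine (degree_add_le _ _).trans_lt (max_lt ?_ ?_)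
    · rw [degree_mul, degree_mul]
      exact WithBot.add_lt_add_right (degree_ne_bot.mpr hB₂.ne_zero) h₁
    · rw [mul_comm, degree_mul, degree_mul]
      exact WithBot.add_lt_add_left (degree_ne_bot.mpr hB₁.ne_zero) h₂
  refine ⟨r 0, r 1, h₁, h₂, ?_⟩
  rw [(div_modByMonic_unique q _ (hB₁.mul hB₂) ⟨by rw [hA]; ring, hdeg⟩).1, add_assoc]
  exact hA

lemma exists_polynomial_interpolating (E : Finset K) (y : K → K) (c : K) :
    ∃ A : K[X], A.natDegree ≤ E.card ∧ A.coeff E.card = c ∧ ∀ z ∈ E, A.eval z = y z := by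
  classical
  let M : K[X] := ∏ z ∈ E, (X - C z)
  have hM : M.Monic := monic_prod_of_monic _ _ fun z _ => monic_X_sub_C z
  have hMd : M.natDegree = E.card := by
    rw [natDegree_prod_of_monic _ _ fun z _ => monic_X_sub_C z]
    simp
  have hI : (Lagrange.interpolate E id y).degree < E.card :=
    Lagrange.degree_interpolate_lt _ Function.injective_id.injOn
  refine ⟨C c * M + Lagrange.interpolate E id y, natDegree_add_le_of_degree_le
    ((natDegree_C_mul_le _ _).trans hMd.le) (natDegree_le_of_degree_le hI.le), ?_, fun z hz => ?_⟩
  · rw [coeff_add, coeff_C_mul, coeff_eq_zero_of_degree_lt hI, ← hMd, hM.coeff_natDegree, mul_one,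
      add_zero]
  · have hMz : M.eval z = 0 := by
      rw [eval_prod]
      exact Finset.prod_eq_zero hz (by simp)
    rw [eval_add, eval_mul, hMz, mul_zero, zero_add]
    exact Lagrange.eval_interpolate_at_node _ Function.injective_id.injOn hz

/-- `g` is, up to finitely many values, a rational function which is regular at `0` with value
`v`. -/
def RegularAtZero (g : K → K) (v : K) : Prop :=
  ∃ A B : K[X], B.eval 0 ≠ 0 ∧ v = A.eval 0 / B.eval 0 ∧
    ∀ᶠ s in cofinite, g s = A.eval s / B.eval s

lemma RegularAtZero.congr {g g' : K → K} {v : K} (h : RegularAtZero g v)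
    (e : ∀ᶠ s in cofinite, g s = g' s) : RegularAtZero g' v := by
  obtain ⟨A, B, hB, hv, hg⟩ := h
  refine ⟨A, B, hB, hv, ?_⟩
  filter_upwards [hg, e] with s h1 h2
  rw [← h2, h1]

lemma RegularAtZero.of_div {g : K → K} {N M : K[X]} (hM : M.eval 0 ≠ 0)
    (hg : ∀ᶠ s in cofinite, g s = N.eval s / M.eval s) :
    RegularAtZero g (N.eval 0 / M.eval 0) :=
  ⟨N, M, hM, rfl, hg⟩

variable [Infinite K]

lemma eq_of_eventually_eval_eq {A B : K[X]} (h : ∀ᶠ s in cofinite, A.eval s = B.eval s) :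
    A = B :=
  Polynomial.eq_of_infinite_eval_eq A B (frequently_cofinite_iff_infinite.mp h.frequently)

/-- As `M` may vanish at `0`, this also shows that a pole of `N / M` at `0` is a zero of `N`. -/
lemma RegularAtZero.eval_zero_eq_mul {g : K → K} {v : K} {N M : K[X]} (h : RegularAtZero g v)
    (hM : M ≠ 0) (hg : ∀ᶠ s in cofinite, g s = N.eval s / M.eval s) :
    N.eval 0 = v * M.eval 0 := by
  obtain ⟨A, B, hB, rfl, hg'⟩ := h
  have hB0 : B ≠ 0 := by rintro rfl; simp at hB
  have hNB : N * B = A * M := by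
    apply eq_of_eventually_eval_eq
    filter_upwards [hg, hg', eventually_eval_ne_zero hB0, eventually_eval_ne_zero hM]
      with s h1 h2 h3 h4
    rw [h1, div_eq_div_iff h4 h3] at h2
    simpa only [eval_mul] using h2
  have hval := congrArg (eval 0) hNB
  rw [eval_mul, eval_mul] at hval
  field_simp
  exact hval

lemma RegularAtZero.unique {g : K → K} {v w : K} (h : RegularAtZero g v)
    (h' : RegularAtZero g w) : v = w := by
  obtain ⟨A, B, hB, rfl, hg⟩ := h'
  rw [h.eval_zero_eq_mul (by rintro rfl; simp at hB) hg]
  field_simp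

end Polynomials

section RationalFunctions

open Polynomial

/-- The point `a` of the affine line in the projective line. -/
def P1.fin (a : ℂ) : P1 := CofiniteTopology.of (a : OnePoint ℂ)

/-- The point at infinity of the projective line. -/
def P1.inf : P1 := CofiniteTopology.of OnePoint.infty

lemma P1.eq_inf_or_eq_fin (p : P1) : p = P1.inf ∨ ∃ a, p = P1.fin a := by
  by_cases h : CofiniteTopology.of.symm p = OnePoint.infty
  · exact Or.inl (by rw [P1.inf, ← h]; rfl)
  · obtain ⟨a, ha⟩ := OnePoint.ne_infty_iff_exists.mp h
    exact Or.inr ⟨a, by rw [P1.fin, ha]; rfl⟩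

lemma P1.fin_injective : Function.Injective P1.fin := fun _ _ h =>
  OnePoint.coe_injective (CofiniteTopology.of.injective h)

lemma P1.fin_ne_inf (a : ℂ) : P1.fin a ≠ P1.inf := fun h =>
  OnePoint.coe_ne_infty a (CofiniteTopology.of.injective h)

lemma P1.eventually_cofinite_iff {Q : P1 → Prop} :
    (∀ᶠ q in cofinite, Q q) ↔ ∀ᶠ z in cofinite, Q (P1.fin z) := by
  refine ⟨fun h => P1.fin_injective.tendsto_cofinite.eventually h, fun h => ?_⟩
  rw [Filter.eventually_cofinite] at h ⊢
  refine ((h.image P1.fin).insert P1.inf).subset fun q hq => ?_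
  rcases P1.eq_inf_or_eq_fin q with rfl | ⟨a, rfl⟩
  · exact Or.inl rfl
  · exact Or.inr ⟨a, hq, rfl⟩

lemma coord_fin (a s : ℂ) : coord (P1.fin a) s = P1.fin (a + s) := rfl

lemma coord_inf {s : ℂ} (hs : s ≠ 0) : coord P1.inf s = P1.fin s⁻¹ := by
  unfold coord P1.inf P1.fin
  simp [hs]

lemma coord_inf_zero : coord P1.inf 0 = P1.inf := by
  unfold coord P1.inf
  simp

lemma coord_injective (p : P1) : Function.Injective (coord p) := by
  intro s t h
  rcases P1.eq_inf_or_eq_fin p with rfl | ⟨a, rfl⟩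
  · rcases eq_or_ne s 0 with rfl | hs <;> rcases eq_or_ne t 0 with rfl | ht
    · rfl
    · rw [coord_inf_zero, coord_inf ht] at h
      exact (P1.fin_ne_inf _ h.symm).elim
    · rw [coord_inf_zero, coord_inf hs] at h
      exact (P1.fin_ne_inf _ h).elim
    · rw [coord_inf hs, coord_inf ht] at h
      exact inv_injective (P1.fin_injective h)
  · exact add_right_injective a (P1.fin_injective h)

lemma isRegularAt_iff {f : P1 → ℂ} {p : P1} :
    IsRegularAt f p ↔ RegularAtZero (fun s => f (coord p s)) (f p) := Iff.rfl

lemma IsRegularAt.congr {f g : P1 → ℂ} {p : P1} (hf : IsRegularAt f p) (hp : f p = g p)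
    (h : ∀ᶠ q in cofinite, f q = g q) : IsRegularAt g p := by
  rw [isRegularAt_iff, ← hp]
  exact RegularAtZero.congr hf ((coord_injective p).tendsto_cofinite.eventually h)

lemma IsRegularAt.eq_of_eventually {f g : P1 → ℂ} {p : P1} (hf : IsRegularAt f p)
    (hg : IsRegularAt g p) (h : ∀ᶠ q in cofinite, f q = g q) : f p = g p :=
  (RegularAtZero.congr hf ((coord_injective p).tendsto_cofinite.eventually h)).unique hg

lemma isRegularAt_const (c : ℂ) (p : P1) : IsRegularAt (fun _ => c) p :=
  ⟨C c, 1, by simp, by simp, by simp⟩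

lemma IsRegularAt.neg {f : P1 → ℂ} {p : P1} (hf : IsRegularAt f p) : IsRegularAt (-f) p := by
  convert (isRegularAt_const (-1) p).mul hf using 1
  ext q
  simp

lemma IsRegularAt.sub {f g : P1 → ℂ} {p : P1} (hf : IsRegularAt f p) (hg : IsRegularAt g p) :
    IsRegularAt (f - g) p :=
  sub_eq_add_neg f g ▸ hf.add hg.neg

lemma IsRegularAt.exists_eventually_eq_div {f : P1 → ℂ} {p : P1} (hf : IsRegularAt f p) :
    ∃ A B : ℂ[X], B ≠ 0 ∧ ∀ᶠ z in cofinite, f (P1.fin z) = A.eval z / B.eval z := by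
  obtain ⟨A, B, hB, -, h⟩ := hf
  have hB0 : B ≠ 0 := by rintro rfl; simp at hB
  rcases P1.eq_inf_or_eq_fin p with rfl | ⟨a, rfl⟩
  · refine ⟨A.reflect (max A.natDegree B.natDegree), B.reflect (max A.natDegree B.natDegree),
      by rwa [Ne, reflect_eq_zero_iff], ?_⟩
    filter_upwards [(inv_injective (G := ℂ)).tendsto_cofinite.eventually h, eventually_ne_zero]
      with z hz hz0
    rw [coord_inf (inv_ne_zero hz0), inv_inv] at hz
    rw [hz, eval_reflect_eq (le_max_left _ _) hz0, eval_reflect_eq (le_max_right _ _) hz0]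
    field_simp
  · refine ⟨A.comp (X - C a), B.comp (X - C a), ?_, ?_⟩
    · intro h0
      exact hB (by simpa using congrArg (eval a) h0)
    · filter_upwards [(sub_left_injective (b := a)).tendsto_cofinite.eventually h] with z hz
      rw [coord_fin] at hz
      simpa using hz

lemma IsRegularAt.exists_reduced_fraction {f : P1 → ℂ} {p : P1} (hf : IsRegularAt f p) :
    ∃ A B : ℂ[X], B.Monic ∧ IsCoprime A B ∧
      ∀ᶠ z in cofinite, f (P1.fin z) = A.eval z / B.eval z := by
  obtain ⟨A, B, hB, h⟩ := hf.exists_eventually_eq_div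
  obtain ⟨A', B', hB', hcop, h'⟩ := exists_isCoprime_eventually_div_eq A hB
  exact ⟨A', B', hB', hcop, by filter_upwards [h, h'] with z hz hz' using hz.trans hz'⟩

lemma IsRegularAt.denom_ne_zero {f : P1 → ℂ} {a : ℂ} (hf : IsRegularAt f (P1.fin a)) {A B : ℂ[X]}
    (hB : B ≠ 0) (hcop : IsCoprime A B)
    (h : ∀ᶠ z in cofinite, f (P1.fin z) = A.eval z / B.eval z) : B.eval a ≠ 0 := by
  intro h0
  have hc : B.comp (X + C a) ≠ 0 := by
    intro h1
    obtain ⟨b, hb⟩ := (eventually_eval_ne_zero hB).exists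
    exact hb (by simpa using congrArg (eval (b - a)) h1)
  have hA := RegularAtZero.eval_zero_eq_mul (N := A.comp (X + C a)) hf hc (by
    filter_upwards [(add_right_injective a).tendsto_cofinite.eventually h] with s hs
    rw [coord_fin, hs]
    simp [add_comm])
  simp only [eval_comp, eval_add, eval_X, eval_C, zero_add, h0, mul_zero] at hA
  obtain ⟨u, v, huv⟩ := hcop
  simpa [hA, h0] using congrArg (eval a) huv

lemma IsRegularAt.natDegree_le {f : P1 → ℂ} (hf : IsRegularAt f P1.inf) {A B : ℂ[X]}
    (hB : B ≠ 0) (h : ∀ᶠ z in cofinite, f (P1.fin z) = A.eval z / B.eval z) :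
    A.natDegree ≤ B.natDegree := by
  by_contra! hlt
  have hlead := RegularAtZero.eval_zero_eq_mul (N := A.reflect A.natDegree) hf
    (M := B.reflect A.natDegree) (by rwa [Ne, reflect_eq_zero_iff]) (by
      filter_upwards [(inv_injective (G := ℂ)).tendsto_cofinite.eventually h, eventually_ne_zero]
        with s hs hs0
      rw [coord_inf hs0, hs, eval_reflect_eq le_rfl hs0, eval_reflect_eq hlt.le hs0]
      field_simp)
  rw [eval_zero_reflect, eval_zero_reflect, coeff_eq_zero_of_natDegree_lt hlt, mul_zero] at hlead
  have hA : A = 0 := leadingCoeff_eq_zero.mp hlead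
  simp [hA] at hlt

/-- The function on the projective line given by the quotient `A / B`. Its value at infinity is
the expected one if `B ≠ 0` and `A.natDegree ≤ B.natDegree`. -/
def ratFn (A B : ℂ[X]) (p : P1) : ℂ :=
  (CofiniteTopology.of.symm p).elim (A.coeff B.natDegree / B.leadingCoeff)
    (fun z => A.eval z / B.eval z)

lemma ratFn_fin (A B : ℂ[X]) (z : ℂ) : ratFn A B (P1.fin z) = A.eval z / B.eval z := rfl

lemma ratFn_inf (A B : ℂ[X]) : ratFn A B P1.inf = A.coeff B.natDegree / B.leadingCoeff := rfl

lemma isRegularAt_ratFn {A B : ℂ[X]} {p : P1} (hfin : ∀ a, p = P1.fin a → B.eval a ≠ 0)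
    (hinf : p = P1.inf → B ≠ 0 ∧ A.natDegree ≤ B.natDegree) : IsRegularAt (ratFn A B) p := by
  rcases P1.eq_inf_or_eq_fin p with rfl | ⟨a, rfl⟩
  · obtain ⟨hB, hAB⟩ := hinf rfl
    refine ⟨A.reflect B.natDegree, B.reflect B.natDegree, ?_, ?_, ?_⟩
    · rw [eval_zero_reflect]
      exact leadingCoeff_ne_zero.mpr hB
    · rw [eval_zero_reflect, eval_zero_reflect, ratFn_inf]
      rfl
    · filter_upwards [eventually_ne_zero] with s hs
      rw [coord_inf hs, ratFn_fin, eval_reflect_eq hAB hs, eval_reflect_eq le_rfl hs]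
      field_simp
  · refine ⟨A.comp (X + C a), B.comp (X + C a), by simpa using hfin a rfl, by simp [ratFn_fin],
      Eventually.of_forall fun s => ?_⟩
    rw [coord_fin, ratFn_fin]
    simp [add_comm]

lemma eq_of_isRegularAt {f : P1 → ℂ} (hf : ∀ p, IsRegularAt f p) (p q : P1) : f p = f q := by
  obtain ⟨A, B, hB, hcop, h⟩ := (hf P1.inf).exists_reduced_fraction
  have hB1 : B = 1 := by
    refine eq_one_of_monic_natDegree_zero hB ?_
    by_contra h0
    obtain ⟨a, ha⟩ := IsAlgClosed.exists_root B (fun h1 => h0 (natDegree_eq_of_degree_eq_some h1))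
    exact (hf (P1.fin a)).denom_ne_zero hB.ne_zero hcop h ha
  have hA := (hf P1.inf).natDegree_le hB.ne_zero h
  rw [hB1, natDegree_one, Nat.le_zero] at hA
  have hconst (p : P1) : f p = A.coeff 0 := by
    refine (hf p).eq_of_eventually (isRegularAt_const _ p) (P1.eventually_cofinite_iff.mpr ?_)
    filter_upwards [h] with z hz
    rw [hz, hB1, eq_C_of_natDegree_eq_zero hA]
    simp
  rw [hconst, hconst]

/-- `H¹(ℙ¹, 𝒪) = 0`: the partial fractions of `f` with poles outside `U` go to `a`, those with
poles outside `V` to `b`, and the polynomial part to `a` or `b` according to the position of the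
point at infinity. -/
lemma exists_sub_of_isRegularAt {U V : Set P1} (hne : (U ∩ V).Nonempty) {f : P1 → ℂ}
    (hf : ∀ p ∈ U ∩ V, IsRegularAt f p) :
    ∃ a b : P1 → ℂ, (∀ p ∈ U, IsRegularAt a p) ∧ (∀ p ∈ V, IsRegularAt b p) ∧
      ∀ p ∈ U ∩ V, f p = a p - b p := by
  obtain ⟨p₀, h₀⟩ := hne
  obtain ⟨A, B, hB, hcop, hf_eq⟩ := (hf p₀ h₀).exists_reduced_fraction
  obtain ⟨B₁, B₂, hB₁, hB₂, hcop', rfl, hroots₁, hroots₂⟩ :=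
    exists_factorization_of_roots_mem hB {z | P1.fin z ∉ U}
  obtain ⟨r₁, r₂, hr₁, hr₂, hA⟩ := exists_partialFractions A hB₁ hB₂ hcop'
  obtain ⟨q₁, q₂, hq, hq₁, hq₂⟩ : ∃ q₁ q₂ : ℂ[X], A /ₘ (B₁ * B₂) = q₁ + q₂ ∧
      (P1.inf ∈ U → q₁.natDegree = 0) ∧ (P1.inf ∈ V → q₂.natDegree = 0) := by
    by_cases hV : P1.inf ∈ V
    · refine ⟨A /ₘ (B₁ * B₂), 0, (add_zero _).symm, fun hU => ?_, fun _ => natDegree_zero⟩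
      rw [natDegree_divByMonic _ hB]
      exact Nat.sub_eq_zero_of_le ((hf _ ⟨hU, hV⟩).natDegree_le hB.ne_zero hf_eq)
    · exact ⟨0, _, (zero_add _).symm, fun _ => natDegree_zero, fun h => absurd h hV⟩
  have hdeg {q r D : ℂ[X]} (hq : q.natDegree = 0) (hr : r.degree < D.degree) :
      (q * D + r).natDegree ≤ D.natDegree :=
    natDegree_add_le_of_degree_le (natDegree_mul_le.trans (by omega)) (natDegree_le_natDegree hr.le)
  have ha : ∀ p ∈ U, IsRegularAt (ratFn (q₁ * B₁ + r₁) B₁) p := fun p hp =>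
    isRegularAt_ratFn (by rintro z rfl h0; exact hroots₁ z h0 hp)
      (by rintro rfl; exact ⟨hB₁.ne_zero, hdeg (hq₁ hp) hr₁⟩)
  have hb : ∀ p ∈ V, IsRegularAt (ratFn (-(q₂ * B₂ + r₂)) B₂) p := fun p hp =>
    isRegularAt_ratFn
      (by
        rintro z rfl h0
        exact (hf _ ⟨not_not.mp (hroots₂ z h0), hp⟩).denom_ne_zero hB.ne_zero hcop hf_eq
          (by simp [h0]))
      (by rintro rfl; exact ⟨hB₂.ne_zero, by rw [natDegree_neg]; exact hdeg (hq₂ hp) hr₂⟩)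
  refine ⟨_, _, ha, hb, fun p hp => (hf p hp).eq_of_eventually ((ha p hp.1).sub (hb p hp.2)) ?_⟩
  rw [P1.eventually_cofinite_iff]
  filter_upwards [hf_eq, eventually_eval_ne_zero hB₁.ne_zero, eventually_eval_ne_zero hB₂.ne_zero]
    with z hz h₁ h₂
  rw [hz, Pi.sub_apply, ratFn_fin, ratFn_fin, hA, hq]
  simp only [eval_mul, eval_add, eval_neg]
  field_simp
  ring

lemma exists_interpolation (D : Finset P1) :
    ∃ a : ℂ, P1.fin a ∉ D ∧ ∀ y : P1 → ℂ, ∃ f : P1 → ℂ,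
      (∀ p, p ≠ P1.fin a → IsRegularAt f p) ∧ ∀ p ∈ D, f p = y p := by
  classical
  let E : Finset ℂ := D.preimage P1.fin P1.fin_injective.injOn
  obtain ⟨a, ha⟩ := Infinite.exists_notMem_finset E
  refine ⟨a, fun h => ha (Finset.mem_preimage.mpr h), fun y => ?_⟩
  let B : ℂ[X] := (X - C a) ^ E.card
  have hB : B.Monic := (monic_X_sub_C a).pow _
  have hBd : B.natDegree = E.card := by simp [B]
  have hBz {z : ℂ} (hz : z ≠ a) : B.eval z ≠ 0 := by
    simpa [B, sub_eq_zero] using fun h => absurd h hz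
  obtain ⟨A, hAd, hA_inf, hA⟩ :=
    exists_polynomial_interpolating E (fun z => y (P1.fin z) * B.eval z) (y P1.inf)
  refine ⟨ratFn A B, fun p hp => isRegularAt_ratFn ?_ fun _ => ⟨hB.ne_zero, hBd ▸ hAd⟩, ?_⟩
  · rintro z rfl
    exact hBz fun h => hp (by rw [h])
  · intro p hp
    rcases P1.eq_inf_or_eq_fin p with rfl | ⟨z, rfl⟩
    · rw [ratFn_inf, hB.leadingCoeff, div_one, hBd, hA_inf]
    · have hz : z ∈ E := Finset.mem_preimage.mpr hp
      rw [ratFn_fin, hA z hz, mul_div_cancel_right₀ _ (hBz fun h => ha (h ▸ hz))]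

end RationalFunctions

/-! ## Sheaves on nodal curves -/

/-- A subsheaf of the sheaf `W ↦ (π⁻¹ W → A)` of functions along `π`, given by its sections. -/
structure LocalFunctions {X Y : Type} [TopologicalSpace X] (π : Y → X) (A : Type) [AddCommGroup A]
    [Module ℂ A] where
  sec : (W : Opens X) → Submodule ℂ ({y // π y ∈ W} → A)
  res : ∀ {W W' : Opens X} (h : W' ≤ W) {f : {y // π y ∈ W} → A}, f ∈ sec W →
    (fun y => f ⟨y.1, h y.2⟩) ∈ sec W'
  isLocal : ∀ {W : Opens X} {f : {y // π y ∈ W} → A}, (∀ x ∈ W, ∃ (W' : Opens X) (h : W' ≤ W),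
    x ∈ W' ∧ (fun y : {y // π y ∈ W'} => f ⟨y.1, h y.2⟩) ∈ sec W') → f ∈ sec W

namespace LocalFunctions

variable {X Y : Type} [TopologicalSpace X] {π : Y → X} {A : Type} [AddCommGroup A] [Module ℂ A]
  (K : LocalFunctions π A)

/-- The presheaf of functions satisfying the local condition. -/
def presheaf : TopCat.Presheaf AddCommGrpCat.{0} (TopCat.of X) where
  obj W := AddCommGrpCat.of (K.sec W.unop)
  map i := AddCommGrpCat.ofHom
    { toFun := fun f => ⟨fun y => f.1 ⟨y.1, i.unop.le y.2⟩, K.res i.unop.le f.2⟩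
      map_zero' := rfl
      map_add' := fun _ _ => rfl }
  map_id _ := rfl
  map_comp _ _ := rfl

lemma presheaf_isSheaf : K.presheaf.IsSheaf := by
  rw [TopCat.Presheaf.isSheaf_iff_isSheaf_comp (forget AddCommGrpCat.{0})]
  apply TopCat.Presheaf.isSheaf_of_isSheafUniqueGluing_types
  intro ι U s hs
  have hcomp (i j : ι) (y : Y) (hi : π y ∈ U i) (hj : π y ∈ U j) :
      (s i : K.sec (U i)).1 ⟨y, hi⟩ = (s j : K.sec (U j)).1 ⟨y, hj⟩ :=
    congrFun (congrArg Subtype.val (hs i j)) ⟨y, ⟨hi, hj⟩⟩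
  choose i hi using fun y : {y // π y ∈ iSup U} => Opens.mem_iSup.mp y.2
  let f : {y // π y ∈ iSup U} → A := fun y => (s (i y) : K.sec (U (i y))).1 ⟨y.1, hi y⟩
  have hf : f ∈ K.sec (iSup U) := by
    refine K.isLocal fun x hx => ?_
    obtain ⟨j, hj⟩ := Opens.mem_iSup.mp hx
    refine ⟨U j, le_iSup U j, hj, ?_⟩
    convert (s j : K.sec (U j)).2 using 1
    exact funext fun y => hcomp _ _ _ _ _
  refine ⟨(⟨f, hf⟩ : K.sec (iSup U)), fun j => Subtype.ext (funext fun y => hcomp _ _ _ _ _),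
    fun g hg => Subtype.ext (funext fun y => ?_)⟩
  exact congrFun (congrArg Subtype.val (hg (i y))) ⟨y.1, hi y⟩

/-- The sheaf of functions satisfying the local condition. -/
def sheaf : Sheaf (Opens.grothendieckTopology X) AddCommGrpCat.{0} :=
  ⟨K.presheaf, K.presheaf_isSheaf⟩

/-- Multiplication by a complex number. -/
def scalar (a : ℂ) : K.sheaf ⟶ K.sheaf :=
  ⟨{ app := fun W => AddCommGrpCat.ofHom
      { toFun := fun s => (⟨a • s.1, (K.sec W.unop).smul_mem a s.2⟩ : K.sec W.unop)
        map_zero' := Subtype.ext (smul_zero _)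
        map_add' := fun _ _ => Subtype.ext (smul_add _ _ _) }
     naturality := fun _ _ _ => rfl }⟩

end LocalFunctions

namespace NodalCurve

variable (C : NodalCurve)

/-- The normalization. -/
abbrev Norm : Type := Σ _ : C.Comp, P1

/-- The normalization map. -/
def proj (x : C.Norm) : C.Point := Quot.mk _ x

lemma continuous_proj : Continuous C.proj := continuous_quot_mk

lemma proj_surjective : Function.Surjective C.proj := Quot.mk_surjective

instance : CompactSpace C.Point := inferInstanceAs (CompactSpace (Quot _))

lemma proj_branch (ν : C.Node) : C.proj (C.branch ν false) = C.proj (C.branch ν true) :=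
  Quot.sound ⟨ν, rfl, rfl⟩

variable {C}

lemma eq_of_proj_eq {x y : C.Norm} (hx : ∀ ν b, C.branch ν b ≠ x) (h : C.proj y = C.proj x) :
    y = x := by
  let isX : C.Point → Prop := Quot.lift (· = x) (by
    rintro a b ⟨ν, rfl, rfl⟩
    exact propext (iff_of_false (hx ν false) (hx ν true)))
  have : isX (C.proj y) := h ▸ rfl
  exact this

lemma proj_mem_image_iff {S : Set C.Norm} (hS : ∀ x ∈ S, ∀ ν b, C.branch ν b ≠ x) {y : C.Norm} :
    C.proj y ∈ C.proj '' S ↔ y ∈ S :=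
  ⟨fun ⟨x, hx, hxy⟩ => eq_of_proj_eq (hS x hx) hxy.symm ▸ hx, Set.mem_image_of_mem C.proj⟩

lemma isClosed_image_proj {S : Set C.Norm} (hfin : S.Finite)
    (hS : ∀ x ∈ S, ∀ ν b, C.branch ν b ≠ x) : IsClosed (C.proj '' S) := by
  have hpre : C.proj ⁻¹' (C.proj '' S) = S := Set.ext fun _ => proj_mem_image_iff hS
  refine isClosed_coinduced.mpr ?_
  change IsClosed (C.proj ⁻¹' (C.proj '' S))
  rw [hpre, isClosed_sigma_iff]
  exact fun i => CofiniteTopology.isClosed_iff.mpr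
    (.inr (hfin.preimage sigma_mk_injective.injOn))

lemma eventually_proj_mem {W : Opens C.Point} {x : C.Norm} (hx : C.proj x ∈ W) :
    ∀ᶠ q in cofinite, C.proj ⟨x.1, q⟩ ∈ W := by
  have hopen : IsOpen ((fun q : P1 => C.proj ⟨x.1, q⟩) ⁻¹' W) :=
    W.isOpen.preimage (C.continuous_proj.comp continuous_sigmaMk)
  exact CofiniteTopology.isOpen_iff.mp hopen ⟨x.2, hx⟩

/-- Extension by zero of functions on the part of the normalization over `W`. -/
def extendByZero (W : Opens C.Point) (A : Type) [AddCommGroup A] [Module ℂ A] :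
    ({y // C.proj y ∈ W} → A) →ₗ[ℂ] C.Norm → A where
  toFun f := Function.extend Subtype.val f (0 : C.Norm → A)
  map_add' f g := by rw [← Function.extend_add, add_zero]
  map_smul' a f := by rw [RingHom.id_apply, ← Function.extend_smul, smul_zero]

section ExtendByZero

variable {W : Opens C.Point} {A : Type} [AddCommGroup A] [Module ℂ A]
  (f : {y // C.proj y ∈ W} → A) {y : C.Norm}

lemma extendByZero_of_mem (h : C.proj y ∈ W) : extendByZero W A f y = f ⟨y, h⟩ :=
  Subtype.val_injective.extend_apply f 0 ⟨y, h⟩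

lemma extendByZero_of_notMem (h : C.proj y ∉ W) : extendByZero W A f y = 0 :=
  Function.extend_apply' f (0 : C.Norm → A) y fun ⟨z, hz⟩ => h (hz ▸ z.2)

end ExtendByZero

section RegularFunctions

variable {n : ℕ}

variable (n) in
/-- The vectors of `n` functions on the normalization which are regular at `x`. -/
def regularAt (x : C.Norm) : Submodule ℂ (C.Norm → Fin n → ℂ) where
  carrier := {f | ∀ j, IsRegularAt (fun q => f ⟨x.1, q⟩ j) x.2}
  add_mem' hf hg j := (hf j).add (hg j)
  zero_mem' _ := isRegularAt_const 0 _
  smul_mem' a _ hf j := (isRegularAt_const a _).mul (hf j)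

lemma regularAt_congr {f g : C.Norm → Fin n → ℂ} {W : Opens C.Point} {x : C.Norm}
    (hx : C.proj x ∈ W) (h : ∀ y, C.proj y ∈ W → f y = g y) (hf : f ∈ regularAt n x) :
    g ∈ regularAt n x := fun j =>
  (hf j).congr (congrFun (h x hx) j) <| by
    filter_upwards [eventually_proj_mem hx] with q hq
    rw [h _ hq]

variable (C n) in
/-- The sheaf of vectors of `n` regular functions on the normalization, pushed forward to the
curve. -/
def normFunctions : LocalFunctions C.proj (Fin n → ℂ) where
  sec W := ⨅ x : {x // C.proj x ∈ W}, (regularAt n x.1).comap (extendByZero W _)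
  res h f hf := Submodule.mem_iInf _ |>.mpr fun x =>
    regularAt_congr x.2 (fun y hy => by
      rw [extendByZero_of_mem _ hy, extendByZero_of_mem _ (h hy)])
      ((Submodule.mem_iInf _).mp hf ⟨x.1, h x.2⟩)
  isLocal {W f} hf := Submodule.mem_iInf _ |>.mpr fun x => by
    obtain ⟨W', h, hxW', hf'⟩ := hf (C.proj x.1) x.2
    exact regularAt_congr hxW' (fun y hy => by
      rw [extendByZero_of_mem _ hy, extendByZero_of_mem _ (h hy)])
      ((Submodule.mem_iInf _).mp hf' ⟨x.1, hxW'⟩)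

lemma mem_normFunctions_iff {W : Opens C.Point} {f : {y // C.proj y ∈ W} → Fin n → ℂ} :
    f ∈ (C.normFunctions n).sec W ↔
      ∀ x, C.proj x ∈ W → extendByZero W _ f ∈ regularAt n x :=
  (Submodule.mem_iInf _).trans Subtype.forall

lemma mem_normFunctions_of_regularAt {W : Opens C.Point} {F : C.Norm → Fin n → ℂ}
    (hF : ∀ x, C.proj x ∈ W → F ∈ regularAt n x) :
    (fun y => F y.1) ∈ (C.normFunctions n).sec W :=
  mem_normFunctions_iff.mpr fun x hx =>
    regularAt_congr hx (fun _ hy => (extendByZero_of_mem (fun y => F y.1) hy).symm) (hF x hx)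

lemma normFunctions_const (f : (C.normFunctions n).sec ⊤) (i : C.Comp) (p q : P1) :
    f.1 ⟨⟨i, p⟩, trivial⟩ = f.1 ⟨⟨i, q⟩, trivial⟩ := by
  funext j
  have h := eq_of_isRegularAt (f := fun p => extendByZero ⊤ _ f.1 ⟨i, p⟩ j)
    (fun p => mem_normFunctions_iff.mp f.2 ⟨i, p⟩ trivial j) p q
  rwa [extendByZero_of_mem (W := ⊤) _ trivial, extendByZero_of_mem (W := ⊤) _ trivial] at h

lemma exists_split_extendByZero {U V : Opens C.Point} {f : {y // C.proj y ∈ U ⊓ V} → Fin n → ℂ}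
    (hf : f ∈ (C.normFunctions n).sec (U ⊓ V)) (i : C.Comp) (j : Fin n) :
    ∃ a b : P1 → ℂ, (∀ p, C.proj ⟨i, p⟩ ∈ U → IsRegularAt a p) ∧
      (∀ p, C.proj ⟨i, p⟩ ∈ V → IsRegularAt b p) ∧
      ∀ p, C.proj ⟨i, p⟩ ∈ U ⊓ V → extendByZero _ _ f ⟨i, p⟩ j = a p - b p := by
  by_cases h : ∃ p₀, C.proj ⟨i, p₀⟩ ∈ U ⊓ V
  · exact exists_sub_of_isRegularAt (U := {p | C.proj ⟨i, p⟩ ∈ U})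
      (V := {p | C.proj ⟨i, p⟩ ∈ V}) h fun p hp => mem_normFunctions_iff.mp hf ⟨i, p⟩ hp j
  · exact ⟨0, 0, fun p _ => isRegularAt_const 0 p, fun p _ => isRegularAt_const 0 p,
      fun p hp => (h ⟨p, hp⟩).elim⟩

lemma normFunctions_splitsOverlaps :
    SplitsOverlaps (X := TopCat.of C.Point) (C.normFunctions n).sheaf := by
  intro U V s
  change (C.normFunctions n).sec (U ⊓ V) at s
  choose a b ha hb hab using exists_split_extendByZero s.2
  refine ⟨(⟨_, mem_normFunctions_of_regularAt (F := fun z j => a z.1 j z.2)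
      fun z hz j => ha z.1 j z.2 hz⟩ : (C.normFunctions n).sec U),
    (⟨_, mem_normFunctions_of_regularAt (F := fun z j => b z.1 j z.2)
      fun z hz j => hb z.1 j z.2 hz⟩ : (C.normFunctions n).sec V),
    Subtype.ext (funext fun z => funext fun j => ?_)⟩
  have h := hab z.1.1 j z.1.2 z.2
  rwa [extendByZero_of_mem _ z.2] at h

instance : Subsingleton (Sheaf.H (C.normFunctions n).sheaf 1) :=
  subsingleton_H_one_of_splitsOverlaps (X := TopCat.of C.Point) normFunctions_splitsOverlaps

lemma exists_regularAt_interpolation (D : Finset C.Norm) :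
    ∃ S : Set C.Norm, S.Finite ∧ (∀ x ∈ S, x ∉ D) ∧ ∀ y : C.Norm → Fin n → ℂ,
      ∃ F : C.Norm → Fin n → ℂ, (∀ x ∉ S, F ∈ regularAt n x) ∧ ∀ x ∈ D, F x = y x := by
  choose a ha hint using fun i : C.Comp =>
    exists_interpolation (D.preimage (fun p => (⟨i, p⟩ : C.Norm))
      (sigma_mk_injective (β := fun _ : C.Comp => P1)).injOn)
  refine ⟨Set.range fun i => ⟨i, P1.fin (a i)⟩, Set.finite_range _, ?_, fun y => ?_⟩
  · rintro _ ⟨i, rfl⟩ h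
    exact ha i (Finset.mem_preimage.mpr h)
  · choose f hf hfD using fun i (j : Fin n) => hint i fun p => y ⟨i, p⟩ j
    refine ⟨fun x j => f x.1 j x.2, fun x hx j => hf x.1 j x.2 fun h => hx ⟨x.1, ?_⟩,
      fun x hx => funext fun j => hfD x.1 j x.2 (Finset.mem_preimage.mpr hx)⟩
    exact Sigma.ext rfl (heq_of_eq h.symm)

end RegularFunctions

variable (C) in
/-- The sheaf of vectors attached to the nodes. -/
def nodeFunctions (n : ℕ) : LocalFunctions (fun ν => C.proj (C.branch ν false)) (Fin n → ℂ) where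
  sec _ := ⊤
  res _ _ _ := trivial
  isLocal _ := trivial

variable (C) in
/-- The difference of the values at the two branches of the nodes. -/
def nodeDifference (n : ℕ) : (C.normFunctions n).sheaf ⟶ (C.nodeFunctions n).sheaf :=
  ⟨{ app := fun W => AddCommGrpCat.ofHom
      { toFun := fun f => (⟨fun ν => f.1 ⟨C.branch ν.1 true, C.proj_branch ν.1 ▸ ν.2⟩ -
            f.1 ⟨C.branch ν.1 false, ν.2⟩, trivial⟩ : (C.nodeFunctions n).sec W.unop)
        map_zero' := Subtype.ext (funext fun _ => sub_zero _)
        map_add' := fun _ _ => Subtype.ext (funext fun _ => add_sub_add_comm _ _ _ _) }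
     naturality := fun _ _ _ => rfl }⟩

lemma exists_branch_sub_eq {A : Type} [AddCommGroup A] (t : C.Node → A) :
    ∃ y : C.Norm → A, ∀ ν, y (C.branch ν true) - y (C.branch ν false) = t ν := by
  let y : C.Norm → A := Function.extend (fun z : C.Node × Bool => C.branch z.1 z.2)
    (fun z => if z.2 then t z.1 else 0) 0
  have hy (ν : C.Node) (b : Bool) : y (C.branch ν b) = if b then t ν else 0 :=
    C.branch_injective.extend_apply _ _ (ν, b)
  exact ⟨y, fun ν => by simp [hy]⟩

/-- Functions with arbitrary values at the branches of the nodes exist once finitely many poles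
are allowed, and these poles can be chosen away from a given point. -/
lemma nodeDifference_locallySurjective (n : ℕ) :
    TopCat.Presheaf.IsLocallySurjective (X := TopCat.of C.Point) (C.nodeDifference n).hom := by
  classical
  rw [TopCat.Presheaf.isLocallySurjective_iff]
  intro W t c hc
  obtain ⟨x, rfl⟩ := C.proj_surjective c
  let branches : Finset C.Norm := Finset.univ.image fun z : C.Node × Bool => C.branch z.1 z.2
  have hbranch (ν : C.Node) (b : Bool) : C.branch ν b ∈ insert x branches :=
    Finset.mem_insert_of_mem (Finset.mem_image_of_mem _ (Finset.mem_univ (ν, b)))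
  obtain ⟨S, hfin, hSD, hint⟩ := exists_regularAt_interpolation (n := n) (insert x branches)
  have hS : ∀ y ∈ S, ∀ ν b, C.branch ν b ≠ y := fun y hy ν b h => hSD y hy (h ▸ hbranch ν b)
  obtain ⟨y, hy⟩ := exists_branch_sub_eq fun ν =>
    Function.extend Subtype.val (t : (C.nodeFunctions n).sec W).1 0 ν
  obtain ⟨F, hF, hFy⟩ := hint y
  let W' : Opens C.Point := W ⊓ ⟨(C.proj '' S)ᶜ, (isClosed_image_proj hfin hS).isOpen_compl⟩
  have hF' : (fun z : {z // C.proj z ∈ W'} => F z.1) ∈ (C.normFunctions n).sec W' :=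
    mem_normFunctions_of_regularAt fun z hz => hF z fun hzS => hz.2 ⟨z, hzS, rfl⟩
  refine ⟨W', inf_le_left, ⟨(⟨_, hF'⟩ : (C.normFunctions n).sec W'), ?_⟩, hc,
    fun hxS => hSD x ((proj_mem_image_iff hS).mp hxS) (Finset.mem_insert_self _ _)⟩
  refine Subtype.ext (funext fun ν => ?_)
  change F (C.branch ν.1 true) - F (C.branch ν.1 false) =
    (t : (C.nodeFunctions n).sec W).1 ⟨ν.1, ν.2.1⟩
  rw [hFy _ (hbranch _ _), hFy _ (hbranch _ _), hy]
  exact Subtype.val_injective.extend_apply _ _ ⟨ν.1, ν.2.1⟩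

end NodalCurve

/-! ## The cones of the degeneration -/

section Cones

open scoped NNReal

section BishopPhelps

variable {E : Type*} [NormedAddCommGroup E] [NormedSpace ℝ E]

/-- The Bishop–Phelps cone of the vectors on which the linear form `f` is bounded below by `ε`
times the norm. For `0 < ε`, its subcones are pointed. -/
def bishopPhelpsCone (f : E →L[ℝ] ℝ) (ε : ℝ≥0) : PointedCone ℝ E where
  carrier := {x | ε * ‖x‖ ≤ f x}
  add_mem' {x y} hx hy := calc
    ε * ‖x + y‖ ≤ ε * ‖x‖ + ε * ‖y‖ := by
      rw [← mul_add]
      exact mul_le_mul_of_nonneg_left (norm_add_le x y) ε.2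
    _ ≤ f x + f y := add_le_add hx hy
    _ = f (x + y) := (map_add f x y).symm
  zero_mem' := by simp
  smul_mem' c x hx := calc
    ε * ‖c • x‖ = c * (ε * ‖x‖) := by rw [Nonneg.mk_smul, norm_smul, Real.norm_of_nonneg c.2]; ring
    _ ≤ c * f x := mul_le_mul_of_nonneg_left hx c.2
    _ = f (c • x) := (map_smul f (c : ℝ) x).symm

lemma isClosed_bishopPhelpsCone (f : E →L[ℝ] ℝ) (ε : ℝ≥0) :
    IsClosed (bishopPhelpsCone f ε : Set E) :=
  isClosed_le (by fun_prop) f.continuous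

lemma nonneg_of_mem_bishopPhelpsCone {f : E →L[ℝ] ℝ} {ε : ℝ≥0} {x : E}
    (hx : x ∈ bishopPhelpsCone f ε) : 0 ≤ f x :=
  (mul_nonneg ε.2 (norm_nonneg x)).trans hx

lemma exists_subset_bishopPhelpsCone {G : Set E} (hG : G.Finite) {f : E →L[ℝ] ℝ}
    (h : ∀ g ∈ G, 0 < f g) : ∃ ε : ℝ≥0, 0 < ε ∧ G ⊆ bishopPhelpsCone f ε := by
  have hev : ∀ᶠ ε : ℝ≥0 in 𝓝[>] 0, ∀ g ∈ G, ε * ‖g‖ ≤ f g := by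
    refine (Filter.eventually_all_finite hG).mpr fun g hg => nhdsWithin_le_nhds ?_
    have : Tendsto (fun ε : ℝ≥0 => (ε : ℝ) * ‖g‖) (𝓝 0) (𝓝 0) :=
      Continuous.tendsto' (by fun_prop) 0 0 (by simp)
    exact this.eventually (eventually_le_nhds (h g hg))
  obtain ⟨ε, hε, h0⟩ := (hev.and self_mem_nhdsWithin).exists
  exact ⟨ε, h0, hε⟩

lemma isExposed_zero_of_subset_bishopPhelpsCone {s : Set E} (h0 : 0 ∈ s) {f : E →L[ℝ] ℝ} {ε : ℝ≥0}
    (hε : 0 < ε) (hs : s ⊆ bishopPhelpsCone f ε) : IsExposed ℝ s {0} := by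
  refine fun _ => ⟨-f, Set.ext fun x => ⟨?_, fun ⟨hx, hmax⟩ => ?_⟩⟩
  · rintro rfl
    exact ⟨h0, fun y hy => by simpa using nonneg_of_mem_bishopPhelpsCone (hs hy)⟩
  · have hfx : f x ≤ 0 := by simpa using hmax 0 h0
    have hx' : ε * ‖x‖ ≤ f x := hs hx
    exact norm_le_zero_iff.mp (nonpos_of_mul_nonpos_right (hx'.trans hfx) hε)

lemma zero_mem_of_isExposed {Z σ : Set E} (hZ : ∀ y ∈ Z, ∀ c : ℝ, 0 ≤ c → c • y ∈ Z)
    (h : IsExposed ℝ Z σ) (hσ : σ.Nonempty) : 0 ∈ σ := by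
  obtain ⟨l, rfl⟩ := h hσ
  obtain ⟨y, hy, hmax⟩ := hσ
  have h0 : (0 : E) ∈ Z := zero_smul ℝ y ▸ hZ y hy 0 le_rfl
  have h2 : l y + l y ≤ l y := by simpa [two_smul] using hmax _ (hZ y hy 2 zero_le_two)
  refine ⟨h0, fun z hz => (hmax z hz).trans ?_⟩
  rw [map_zero]
  linarith

end BishopPhelps

section Polyhedra

variable {E ι : Type*} [NormedAddCommGroup E] [NormedSpace ℝ E]

/-- The polyhedron generated by the points `u q`, `q ∈ A`, and the directions `u q`, `q ∈ B`. -/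
def polyhedron (u : ι → E) (A B : Finset ι) : Set E :=
  {x | ∃ a ∈ convexHull ℝ (u '' A), ∃ b : ι → ℝ, (∀ q, 0 ≤ b q) ∧ x = a + ∑ q ∈ B, b q • u q}

variable {u : ι → E} {A B : Finset ι}

lemma mem_polyhedron_of_mem {q : ι} (hq : q ∈ A) : u q ∈ polyhedron u A B :=
  ⟨u q, subset_convexHull ℝ _ ⟨q, hq, rfl⟩, 0, fun _ => le_rfl, by simp⟩

lemma add_mem_polyhedron {x : E} (hx : x ∈ polyhedron u A B) {q : ι} (hq : q ∈ B) :
    x + u q ∈ polyhedron u A B := by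
  classical
  obtain ⟨a, ha, b, hb, rfl⟩ := hx
  refine ⟨a, ha, b + Pi.single q 1, fun p => add_nonneg (hb p) ?_, ?_⟩
  · have : (0 : ι → ℝ) ≤ Pi.single q 1 := Pi.single_nonneg.mpr zero_le_one
    exact this p
  · simp [add_smul, Finset.sum_add_distrib, Pi.single_apply, ite_smul, hq, add_assoc]

/-- A linear form which is maximal on a polyhedron exactly at the vertex `v` is negative on the
directions of the polyhedron, so that `(x, a) ↦ (l v + 1) a - l x` is positive on all generators. -/
lemma exists_pos_of_isExposed_polyhedron {v : E} (hv : IsExposed ℝ (polyhedron u A B) {v}) :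
    ∃ f : E × ℝ →L[ℝ] ℝ, (∀ q ∈ A, 0 < f (u q, 1)) ∧ ∀ q ∈ B, u q ≠ 0 → 0 < f (u q, 0) := by
  obtain ⟨l, hl⟩ := hv (Set.singleton_nonempty v)
  have hmem : v ∈ polyhedron u A B ∧ ∀ y ∈ polyhedron u A B, l y ≤ l v := hl.subset rfl
  refine ⟨(l v + 1) • .snd ℝ E ℝ - l ∘L .fst ℝ E ℝ, fun q hq => ?_, fun q hq hq0 => ?_⟩
  · have := hmem.2 _ (mem_polyhedron_of_mem hq)
    simp only [sub_apply, smul_apply, ContinuousLinearMap.coe_snd', smul_eq_mul,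
      ContinuousLinearMap.comp_apply, ContinuousLinearMap.coe_fst']
    linarith
  · suffices l (u q) < 0 by simpa using this
    by_contra! hge
    have hmax : v + u q ∈ ({v} : Set E) := by
      rw [hl]
      refine ⟨add_mem_polyhedron hmem.1 hq, fun y hy => (hmem.2 y hy).trans ?_⟩
      rw [map_add]
      linarith
    exact hq0 (add_eq_left.mp hmax)

lemma smul_mem_of_mem_polyhedron {Z : PointedCone ℝ (E × ℝ)} (hA : ∀ q ∈ A, (u q, 1) ∈ Z)
    (hB : ∀ q ∈ B, (u q, 0) ∈ Z) {x : E} (hx : x ∈ polyhedron u A B) {a : ℝ} (ha : 0 ≤ a) :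
    (a • x, a) ∈ Z := by
  obtain ⟨y, hy, b, hb, rfl⟩ := hx
  have hhull : convexHull ℝ (u '' A) ⊆ {y | (y, (1 : ℝ)) ∈ Z} := by
    refine convexHull_min (Set.image_subset_iff.mpr fun q hq => hA q hq)
      fun x hx y hy s t hs ht hst => ?_
    have := Z.add_mem (Z.smul_mem hs hx) (Z.smul_mem ht hy)
    simpa [hst] using this
  have hsum : ∑ q ∈ B, b q • (u q, (0 : ℝ)) ∈ Z :=
    Z.sum_mem fun q hq => Z.smul_mem (hb q) (hB q hq)
  have hxa : (a • (y + ∑ q ∈ B, b q • u q), a) =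
      a • ((y, 1) + ∑ q ∈ B, b q • (u q, (0 : ℝ))) := by
    simp [Prod.ext_iff, Prod.fst_sum, Prod.snd_sum]
  exact hxa ▸ Z.smul_mem ha (Z.add_mem (hhull hy) hsum)

end Polyhedra

section Integrality

variable {n : ℕ}

/-- The pairing of `M × ℤ` with `N_ℝ × ℝ`, as a homomorphism to the continuous linear forms. -/
def pairingHom (n : ℕ) : Char n →+ ((Fin n → ℝ) × ℝ →L[ℝ] ℝ) where
  toFun m := LinearMap.toContinuousLinearMap
    { toFun := pairing m
      map_add' := fun x y => by
        simp only [pairing, Prod.fst_add, Prod.snd_add, Pi.add_apply, mul_add,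
          Finset.sum_add_distrib]
        ring
      map_smul' := fun c x => by
        simp only [pairing, Prod.smul_fst, Prod.smul_snd, Pi.smul_apply, smul_eq_mul,
          RingHom.id_apply, mul_add, Finset.mul_sum, mul_left_comm] }
  map_zero' := ContinuousLinearMap.ext pairing_zero
  map_add' m m' := ContinuousLinearMap.ext (pairing_add m m')

lemma pairingHom_apply (m : Char n) (x : (Fin n → ℝ) × ℝ) : pairingHom n m x = pairing m x := rfl

lemma linearForm_apply_eq_sum (f : (Fin n → ℝ) × ℝ →L[ℝ] ℝ) (x : (Fin n → ℝ) × ℝ) :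
    f x = ∑ i, f (Pi.single i 1, 0) * x.1 i + f (0, 1) * x.2 := by
  have h1 : f (x.1, 0) = ∑ i, f (Pi.single i 1, 0) * x.1 i := by
    have hx : (x.1, (0 : ℝ)) = ∑ i, x.1 i • (Pi.single i 1, (0 : ℝ)) := by
      simp [Prod.ext_iff, Prod.fst_sum, Prod.snd_sum, ← pi_eq_sum_univ']
    simp only [hx, map_sum, map_smul, smul_eq_mul, mul_comm]
  have h2 : f (0, x.2) = f (0, 1) * x.2 := by
    simpa [mul_comm] using map_smul f x.2 (0, 1)
  rw [← h1, ← h2, ← map_add]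
  simp

lemma exists_pairing_eq_mul (q : Fin n → ℚ) (r : ℚ) :
    ∃ (m : Char n) (d : ℝ), 0 < d ∧ ∀ x : (Fin n → ℝ) × ℝ,
      pairing m x = d * (∑ i, (q i : ℝ) * x.1 i + (r : ℝ) * x.2) := by
  obtain ⟨⟨b, hb⟩, hint⟩ := IsLocalization.exist_integer_multiples_of_finite (nonZeroDivisors ℤ)
    (fun i : Option (Fin n) => i.elim r q)
  choose k hk using hint
  have hk' (i : Option (Fin n)) : ((b * k i : ℤ) : ℝ) = (b : ℝ) ^ 2 * ((i.elim r q : ℚ) : ℝ) := by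
    have h : (k i : ℚ) = b * i.elim r q := by simpa using hk i
    have h' : (k i : ℝ) = b * ((i.elim r q : ℚ) : ℝ) := by exact_mod_cast congrArg Rat.cast h
    rw [Int.cast_mul, h', sq, mul_assoc]
  refine ⟨(fun i => b * k (some i), b * k none), (b : ℝ) ^ 2, ?_, fun x => ?_⟩
  · have := Int.cast_ne_zero (α := ℝ).mpr (nonZeroDivisors.ne_zero hb)
    positivity
  · simp only [pairing, hk', Option.elim, mul_add, Finset.mul_sum, mul_assoc]

lemma exists_pairing_pos {G : Set ((Fin n → ℝ) × ℝ)} (hG : G.Finite)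
    {f : (Fin n → ℝ) × ℝ →L[ℝ] ℝ} (h : ∀ g ∈ G, 0 < f g) :
    ∃ m : Char n, ∀ g ∈ G, 0 < pairing m g := by
  let O : Set ((Fin n → ℝ) × ℝ) := ⋂ g ∈ G, {w | 0 < ∑ i, w.1 i * g.1 i + w.2 * g.2}
  have hO : IsOpen O :=
    hG.isOpen_biInter fun g _ => isOpen_lt continuous_const (by fun_prop)
  have hdense : DenseRange
      (Prod.map (Pi.map fun (_ : Fin n) (q : ℚ) => (q : ℝ)) fun q : ℚ => (q : ℝ)) :=
    (DenseRange.piMap fun _ => Rat.denseRange_cast).prodMap Rat.denseRange_cast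
  obtain ⟨⟨q, r⟩, hqr⟩ := hdense.exists_mem_open hO ⟨(fun i => f (Pi.single i 1, 0), f (0, 1)),
    Set.mem_iInter₂.mpr fun g hg => (h g hg).trans_eq (linearForm_apply_eq_sum f g)⟩
  obtain ⟨m, d, hd, hm⟩ := exists_pairing_eq_mul q r
  exact ⟨m, fun g hg => hm g ▸ mul_pos hd (Set.mem_iInter₂.mp hqr g hg)⟩

end Integrality

section Fan

variable {n : ℕ}

lemma coneOver_subset {Ξ : Set (Fin n → ℝ)} {Z : Set ((Fin n → ℝ) × ℝ)} (hZ : IsClosed Z)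
    (h : ∀ a : ℝ, 0 ≤ a → ∀ x ∈ Ξ, (a • x, a) ∈ Z) : coneOver Ξ ⊆ Z :=
  closure_minimal (by rintro _ ⟨a, ha, x, hx, rfl⟩; exact h a ha x hx) hZ

lemma smul_mem_coneOver {Ξ : Set (Fin n → ℝ)} {y : (Fin n → ℝ) × ℝ} (hy : y ∈ coneOver Ξ) {c : ℝ}
    (hc : 0 ≤ c) : c • y ∈ coneOver Ξ :=
  coneOver_subset (Z := (c • ·) ⁻¹' coneOver Ξ)
    (isClosed_closure.preimage (continuous_const_smul c))
    (fun a ha x hx => subset_closure ⟨c * a, mul_nonneg hc ha, x, hx, by simp [smul_smul]⟩) hy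

lemma snd_nonneg_of_mem_coneOver {Ξ : Set (Fin n → ℝ)} {y : (Fin n → ℝ) × ℝ}
    (hy : y ∈ coneOver Ξ) : 0 ≤ y.2 :=
  coneOver_subset (isClosed_le continuous_const continuous_snd) (fun _ ha _ _ => ha) hy

namespace PolyDecomp

variable (P : PolyDecomp n)

lemma exists_coneOver_subset_bishopPhelpsCone {Ξ : Set (Fin n → ℝ)} (hΞ : Ξ ∈ P.cells) :
    ∃ (m : Char n) (ε : ℝ≥0), 0 < ε ∧ coneOver Ξ ⊆ bishopPhelpsCone (pairingHom n m) ε := by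
  obtain ⟨A, B, -, hAB⟩ := P.polyhedral Ξ hΞ
  obtain ⟨v, hv⟩ := P.vertex Ξ hΞ
  let u : (Fin n → ℚ) → Fin n → ℝ := fun q i => q i
  replace hAB : Ξ = polyhedron u A B := hAB
  subst hAB
  obtain ⟨f, hfA, hfB⟩ := exists_pos_of_isExposed_polyhedron hv
  let G : Set ((Fin n → ℝ) × ℝ) :=
    (fun q => (u q, 1)) '' A ∪ (fun q => (u q, 0)) '' {q ∈ B | u q ≠ 0}
  have hG : G.Finite := (A.finite_toSet.image _).union ((B.finite_toSet.sep _).image _)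
  obtain ⟨m, hm⟩ := exists_pairing_pos (G := G) hG (f := f) (by
    rintro _ (⟨q, hq, rfl⟩ | ⟨q, ⟨hq, hq0⟩, rfl⟩)
    exacts [hfA q hq, hfB q hq hq0])
  obtain ⟨ε, hε, hGε⟩ := exists_subset_bishopPhelpsCone hG (f := pairingHom n m) hm
  have hB : ∀ q ∈ B, (u q, (0 : ℝ)) ∈ bishopPhelpsCone (pairingHom n m) ε := by
    intro q hq
    by_cases hq0 : u q = 0
    · rw [hq0]
      exact zero_mem _
    · exact hGε (.inr ⟨q, ⟨hq, hq0⟩, rfl⟩)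
  exact ⟨m, ε, hε, coneOver_subset (isClosed_bishopPhelpsCone _ _) fun a ha x hx =>
    smul_mem_of_mem_polyhedron (fun q hq => hGε (.inl ⟨q, hq, rfl⟩)) hB hx ha⟩

variable {P} {σ : Set ((Fin n → ℝ) × ℝ)}

lemma exists_subset_bishopPhelpsCone_of_mem_fan (hσ : σ ∈ P.fan) :
    ∃ (m : Char n) (ε : ℝ≥0), 0 < ε ∧ σ ⊆ bishopPhelpsCone (pairingHom n m) ε := by
  obtain ⟨Ξ, hΞ, -, hexp⟩ := hσ
  obtain ⟨m, ε, hε, h⟩ := P.exists_coneOver_subset_bishopPhelpsCone hΞ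
  exact ⟨m, ε, hε, hexp.subset.trans h⟩

lemma isExposed_zero (hσ : σ ∈ P.fan) : IsExposed ℝ σ {0} := by
  obtain ⟨m, ε, hε, h⟩ := exists_subset_bishopPhelpsCone_of_mem_fan hσ
  obtain ⟨Ξ, -, hne, hexp⟩ := hσ
  exact isExposed_zero_of_subset_bishopPhelpsCone
    (zero_mem_of_isExposed (fun _ hy _ hc => smul_mem_coneOver hy hc) hexp hne) hε h

variable (P) in
lemma zero_mem_fan : {0} ∈ P.fan := by
  obtain ⟨Ξ, hΞ, h0⟩ : (0 : Fin n → ℝ) ∈ ⋃₀ P.cells := P.cover ▸ Set.mem_univ _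
  have hσ : coneOver Ξ ∈ P.fan := ⟨Ξ, hΞ, ⟨_, subset_closure ⟨1, zero_le_one, 0, h0, rfl⟩⟩,
    IsExposed.refl _⟩
  exact ⟨Ξ, hΞ, Set.singleton_nonempty 0, isExposed_zero hσ⟩

/-- Since the cones are pointed, their dual monoids generate `M × ℤ`, and adding multiples of a
single element suffices. -/
lemma exists_add_nsmul_mem_dualMonoid (hσ : σ ∈ P.fan) :
    ∃ m₀ ∈ dualMonoid σ, ∀ m : Char n, ∃ k : ℕ, m + k • m₀ ∈ dualMonoid σ := by
  obtain ⟨m₀, ε, hε, h⟩ := exists_subset_bishopPhelpsCone_of_mem_fan hσ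
  refine ⟨m₀, fun y hy => nonneg_of_mem_bishopPhelpsCone (h hy), fun m => ?_⟩
  obtain ⟨k, hk⟩ := exists_nat_ge (‖pairingHom n m‖ / ε)
  refine ⟨k, fun y hy => ?_⟩
  have hbound : ‖pairingHom n m‖ * ‖y‖ ≤ k * pairing m₀ y := calc
    ‖pairingHom n m‖ * ‖y‖ ≤ k * ε * ‖y‖ :=
      mul_le_mul_of_nonneg_right ((div_le_iff₀ (NNReal.coe_pos.mpr hε)).mp hk) (norm_nonneg y)
    _ = k * (ε * ‖y‖) := mul_assoc _ _ _
    _ ≤ k * pairing m₀ y := mul_le_mul_of_nonneg_left (h hy) k.cast_nonneg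
  have hm : -(‖pairingHom n m‖ * ‖y‖) ≤ pairing m y :=
    neg_le_of_abs_le ((pairingHom n m).le_opNorm y)
  calc 0 ≤ pairing m y + k * pairing m₀ y := by linarith
    _ = pairing (m + k • m₀) y := by
      rw [← pairingHom_apply, ← pairingHom_apply, ← pairingHom_apply, map_add, map_nsmul, add_apply,
        smul_apply, nsmul_eq_mul]

lemma snd_mem_dualMonoid (hσ : σ ∈ P.fan) : ((0, 1) : Char n) ∈ dualMonoid σ := by
  obtain ⟨Ξ, -, -, hexp⟩ := hσ
  intro y hy
  simpa [pairing] using snd_nonneg_of_mem_coneOver (hexp.subset hy)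

end PolyDecomp

end Fan

end Cones

/-! ## Laurent polynomials and logarithmic derivatives -/

section Laurent

variable {M : Type} [AddCommGroup M]

/-- Evaluation of an element of `ℂ[M]` at a point of the torus with character lattice `M`. -/
def evalTorus (t : Multiplicative M →* ℂˣ) : AddMonoidAlgebra ℂ M →ₐ[ℂ] ℂ :=
  AddMonoidAlgebra.lift ℂ ℂ M ((Units.coeHom ℂ).comp t)

/-- The character of the torus given by an element of its character lattice. -/
def torusChar (m : M) : (Multiplicative M →* ℂˣ) →* ℂ :=
  (Units.coeHom ℂ).comp (MonoidHom.eval (Multiplicative.ofAdd m))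

lemma exists_torus_ne_one [Module.Free ℤ M] {m : M} (hm : m ≠ 0) :
    ∃ t : Multiplicative M →* ℂˣ, t (Multiplicative.ofAdd m) ≠ 1 := by
  obtain ⟨c, hc⟩ : ∃ c : Module.Dual ℤ M, c m ≠ 0 := by
    simpa using (Module.forall_dual_apply_eq_zero_iff ℤ m).not.mpr hm
  refine ⟨(zpowersHom ℂˣ (Units.mk0 2 two_ne_zero)).comp c.toAddMonoidHom.toMultiplicative,
    fun h => ?_⟩
  have h2 : (2 : ℂ) ^ (c m) = 1 := by
    simpa using congrArg Units.val (show Units.mk0 (2 : ℂ) two_ne_zero ^ (c m) = 1 from h)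
  have h3 : (2 : ℝ) ^ (c m) = 1 := by simpa using congrArg norm h2
  rcases (zpow_eq_one_iff_of_ne_zero₀ hc).mp h3 with h | h <;> norm_num at h

lemma torusChar_injective [Module.Free ℤ M] : Function.Injective (torusChar (M := M)) := by
  intro m m' h
  by_contra hne
  obtain ⟨t, ht⟩ := exists_torus_ne_one (sub_ne_zero.mpr hne)
  have hmm' : t (Multiplicative.ofAdd m) = t (Multiplicative.ofAdd m') :=
    Units.ext (DFunLike.congr_fun h t)
  exact ht (by rw [ofAdd_sub, map_div, hmm', div_self'])

lemma eq_zero_of_evalTorus_eq_zero [Module.Free ℤ M] {f : AddMonoidAlgebra ℂ M}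
    (h : ∀ t, evalTorus t f = 0) : f = 0 := by
  have hli := (linearIndependent_monoidHom (Multiplicative M →* ℂˣ) ℂ).comp _ torusChar_injective
  rw [← AddMonoidAlgebra.coeff_eq_zero]
  refine linearIndependent_iff.mp hli f.coeff (funext fun t => ?_)
  have ht := h t
  rw [evalTorus, AddMonoidAlgebra.lift_apply] at ht
  rw [Finsupp.linearCombination_apply, Finsupp.sum_apply']
  exact ht

end Laurent

section LogDeriv

variable {M : Type} [AddCommMonoid M]

/-- The linear map `χ^m ↦ c(m) χ^m` of `ℂ[M]`. -/
def logDerivLinear (c : M →+ ℂ) : AddMonoidAlgebra ℂ M →ₗ[ℂ] AddMonoidAlgebra ℂ M where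
  toFun f := f.coeff.sum fun m a => AddMonoidAlgebra.single m (c m * a)
  map_add' f g := by
    rw [AddMonoidAlgebra.coeff_add, Finsupp.sum_add_index']
    · simp
    · intro m a b
      rw [mul_add, AddMonoidAlgebra.single_add]
  map_smul' r f := by
    rw [AddMonoidAlgebra.coeff_smul, Finsupp.sum_smul_index (by simp), RingHom.id_apply,
      Finsupp.smul_sum]
    refine Finsupp.sum_congr fun m _ => ?_
    rw [AddMonoidAlgebra.smul_single, smul_eq_mul, mul_left_comm]

lemma logDerivLinear_single (c : M →+ ℂ) (m : M) (a : ℂ) :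
    logDerivLinear c (AddMonoidAlgebra.single m a) = AddMonoidAlgebra.single m (c m * a) := by
  change (AddMonoidAlgebra.single m a).coeff.sum
    (fun m a => AddMonoidAlgebra.single m (c m * a)) = _
  rw [AddMonoidAlgebra.coeff_single, Finsupp.sum_single_index (by simp)]

/-- The derivation `χ^m ↦ c(m) χ^m` of `ℂ[M]`. -/
def logDeriv (c : M →+ ℂ) : Derivation ℂ (AddMonoidAlgebra ℂ M) (AddMonoidAlgebra ℂ M) :=
  Derivation.mk' (logDerivLinear c) fun f g => by
    simp only [smul_eq_mul]
    induction f using AddMonoidAlgebra.induction_linear with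
    | zero => simp
    | add f f' h h' => rw [add_mul, map_add, h, h', map_add]; ring
    | single m a =>
      induction g using AddMonoidAlgebra.induction_linear with
      | zero => simp
      | add g g' h h' => rw [mul_add, map_add, h, h', map_add]; ring
      | single m' a' =>
        simp only [AddMonoidAlgebra.single_mul_single, logDerivLinear_single, map_add]
        rw [add_comm m' m, ← AddMonoidAlgebra.single_add]
        congr 1
        ring

lemma logDeriv_single (c : M →+ ℂ) (m : M) (a : ℂ) :
    logDeriv c (AddMonoidAlgebra.single m a) = AddMonoidAlgebra.single m (c m * a) :=
  logDerivLinear_single c m a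

lemma logDeriv_mapDomain {N : Type} [AddCommMonoid N] (c : N →+ ℂ) (i : M →+ N)
    (f : AddMonoidAlgebra ℂ M) :
    logDeriv c (AddMonoidAlgebra.mapDomainAlgHom ℂ ℂ i f) =
      AddMonoidAlgebra.mapDomainAlgHom ℂ ℂ i (logDeriv (c.comp i) f) := by
  induction f using AddMonoidAlgebra.induction_linear with
  | zero => simp
  | add f f' h h' => simp only [map_add, h, h']
  | single m a => simp [logDeriv_single]

end LogDeriv

/-! ## Local rings of the toric variety -/

namespace PolyDecomp.Total

variable {n : ℕ} {P : PolyDecomp n} {σ : Set ((Fin n → ℝ) × ℝ)}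

/-- The inclusion of the coordinate ring of a chart in the Laurent polynomials. -/
def toLaurent (σ : Set ((Fin n → ℝ) × ℝ)) :
    AddMonoidAlgebra ℂ (dualMonoid σ) →ₐ[ℂ] AddMonoidAlgebra ℂ (Char n) :=
  AddMonoidAlgebra.mapDomainAlgHom ℂ ℂ (dualMonoid σ).subtype

lemma toLaurent_injective (σ : Set ((Fin n → ℝ) × ℝ)) : Function.Injective (toLaurent σ) :=
  AddMonoidAlgebra.mapDomain_injective Subtype.val_injective

instance (σ : Set ((Fin n → ℝ) × ℝ)) : NoZeroDivisors (AddMonoidAlgebra ℂ (dualMonoid σ)) :=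
  (toLaurent_injective σ).noZeroDivisors _ (map_zero _) (map_mul _)

variable (P) in
/-- The point of the big torus of `𝔛` given by a homomorphism on the character lattice. -/
def torus (t : Multiplicative (Char n) →* ℂˣ) : P.Total where
  cone := {0}
  mem := P.zero_mem_fan
  char := t.comp (AddMonoidHom.toMultiplicative (perp {0}).subtype)

lemma torus_mem_chart (hσ : σ ∈ P.fan) (t : Multiplicative (Char n) →* ℂˣ) :
    torus P t ∈ chart σ :=
  PolyDecomp.isExposed_zero hσ

lemma monomial_torus (t : Multiplicative (Char n) →* ℂˣ) (m : Char n) :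
    monomial m (torus P t) = t (Multiplicative.ofAdd m) :=
  dif_pos (by rintro x rfl; exact map_zero (pairingHom n m))

lemma evalFun_single {y : P.Total} (hy : y ∈ chart σ) (m : dualMonoid σ) (a : ℂ) :
    evalFun (AddMonoidAlgebra.single m a) y = a * monomial (m : Char n) y := by
  rw [evalFun, dif_pos hy, evalHom, AddMonoidAlgebra.lift_single]
  rfl

lemma evalFun_torus (hσ : σ ∈ P.fan) (f : AddMonoidAlgebra ℂ (dualMonoid σ))
    (t : Multiplicative (Char n) →* ℂˣ) :
    evalFun f (torus P t) = evalTorus t (toLaurent σ f) := by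
  induction f using AddMonoidAlgebra.induction_linear with
  | zero => simp [evalFun]
  | add f g hf hg => rw [evalFun_add (torus_mem_chart hσ t), hf, hg, map_add, map_add]
  | single m a =>
    rw [evalFun_single (torus_mem_chart hσ t), monomial_torus]
    simp [toLaurent, evalTorus]

variable (P) in
/-- The neighbourhoods of the generic point of `𝔛`: the sets which contain the complement in the
torus of the zeros of some nonzero Laurent polynomial. -/
def generic : Filter P.Total where
  sets := {O | ∃ h : AddMonoidAlgebra ℂ (Char n), h ≠ 0 ∧ ∀ t, evalTorus t h ≠ 0 → torus P t ∈ O}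
  univ_sets := ⟨1, one_ne_zero, fun _ _ => trivial⟩
  sets_of_superset := by
    rintro O O' ⟨h, h0, hO⟩ hOO'
    exact ⟨h, h0, fun t ht => hOO' (hO t ht)⟩
  inter_sets := by
    rintro O O' ⟨h, h0, hO⟩ ⟨h', h0', hO'⟩
    refine ⟨h * h', mul_ne_zero h0 h0', fun t ht => ?_⟩
    rw [map_mul] at ht
    exact ⟨hO t (left_ne_zero_of_mul ht), hO' t (right_ne_zero_of_mul ht)⟩

lemma generic_le_nhds (x : P.Total) : generic P ≤ 𝓝 x := by
  rw [nhds_generateFrom]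
  refine le_iInf₂ fun U hU => le_principal_iff.mpr ?_
  obtain ⟨hx, σ, hσ, f, rfl⟩ := hU
  refine ⟨toLaurent σ f, fun h0 => hx.2 ?_, fun t ht => ⟨torus_mem_chart hσ t, ?_⟩⟩
  · rw [toLaurent_injective σ (h0.trans (map_zero _).symm)]
    simp [evalFun]
  · rwa [evalFun_torus hσ]

lemma eq_zero_of_eventually (hσ : σ ∈ P.fan) {f : AddMonoidAlgebra ℂ (dualMonoid σ)} {x : P.Total}
    (h : ∀ᶠ y in 𝓝 x, evalFun f y = 0) : f = 0 := by
  obtain ⟨g, hg0, hg⟩ := generic_le_nhds x h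
  have hgf : g * toLaurent σ f = 0 := eq_zero_of_evalTorus_eq_zero fun t => by
    rw [map_mul]
    by_cases ht : evalTorus t g = 0
    · rw [ht, zero_mul]
    · rw [← evalFun_torus hσ, show evalFun f (torus P t) = 0 from hg t ht, mul_zero]
  exact toLaurent_injective σ (((mul_eq_zero.mp hgf).resolve_left hg0).trans (map_zero _).symm)

lemma isOpen_principal (hσ : σ ∈ P.fan) (f : AddMonoidAlgebra ℂ (dualMonoid σ)) :
    IsOpen {y : P.Total | y ∈ chart σ ∧ evalFun f y ≠ 0} :=
  isOpen_generateFrom_of_mem ⟨σ, hσ, f, rfl⟩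

lemma evalFun_one {y : P.Total} (hy : y ∈ chart σ) :
    evalFun (1 : AddMonoidAlgebra ℂ (dualMonoid σ)) y = 1 := by
  simp [evalFun, hy]

lemma eventually_mem_chart (hσ : σ ∈ P.fan) {x : P.Total} (hx : x ∈ chart σ) :
    ∀ᶠ y in 𝓝 x, y ∈ chart σ := by
  have h1 : evalFun (1 : AddMonoidAlgebra ℂ (dualMonoid σ)) x ≠ 0 := by
    rw [evalFun_one hx]
    exact one_ne_zero
  filter_upwards [(isOpen_principal hσ 1).mem_nhds ⟨hx, h1⟩] with y hy using hy.1

lemma dualMonoid_le_dualMonoid_cone {x : P.Total} (hx : x ∈ chart σ) :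
    dualMonoid σ ≤ dualMonoid x.cone :=
  fun _ hm y hy => hm y (cone_subset hx hy)

/-- Restriction of functions from the chart of `σ` to the smallest chart around `x`. -/
def restrict {x : P.Total} (hx : x ∈ chart σ) :
    AddMonoidAlgebra ℂ (dualMonoid σ) →ₐ[ℂ] AddMonoidAlgebra ℂ (dualMonoid x.cone) :=
  AddMonoidAlgebra.mapDomainAlgHom ℂ ℂ (AddSubmonoid.inclusion (dualMonoid_le_dualMonoid_cone hx))

lemma evalFun_restrict {x y : P.Total} (hx : x ∈ chart σ) (hy : y ∈ chart σ)
    (hy' : y ∈ chart x.cone) (f : AddMonoidAlgebra ℂ (dualMonoid σ)) :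
    evalFun (restrict hx f) y = evalFun f y := by
  induction f using AddMonoidAlgebra.induction_linear with
  | zero => simp [evalFun]
  | add f g hf hg => rw [map_add, evalFun_add hy', evalFun_add hy, hf, hg]
  | single m a =>
    have : restrict hx (AddMonoidAlgebra.single m a) = AddMonoidAlgebra.single
        (AddSubmonoid.inclusion (dualMonoid_le_dualMonoid_cone hx) m) a := by
      simp [restrict]
    rw [this, evalFun_single hy, evalFun_single hy']
    rfl

lemma div_mem_stalk (hσ : σ ∈ P.fan) {x : P.Total} (hx : x ∈ chart σ)
    (f h : AddMonoidAlgebra ℂ (dualMonoid σ)) (hh : evalFun h x ≠ 0) :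
    ((fun y => evalFun f y / evalFun h y : P.Total → ℂ) : (𝓝 x).Germ ℂ) ∈ Stalk x := by
  refine ⟨restrict hx f, restrict hx h, ?_, ?_⟩
  · rwa [evalFun_restrict hx hx (mem_chart_self x)]
  · apply Filter.Germ.coe_eq.mpr
    filter_upwards [eventually_mem_chart hσ hx, eventually_mem_chart x.mem (mem_chart_self x)]
      with y hy hy'
    rw [evalFun_restrict hx hy hy', evalFun_restrict hx hy hy']

lemma evalFun_mem_stalk (hσ : σ ∈ P.fan) {x : P.Total} (hx : x ∈ chart σ)
    (f : AddMonoidAlgebra ℂ (dualMonoid σ)) :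
    ((evalFun f : P.Total → ℂ) : (𝓝 x).Germ ℂ) ∈ Stalk x := by
  convert div_mem_stalk hσ hx f 1 (by rw [evalFun_one hx]; exact one_ne_zero) using 1
  apply Filter.Germ.coe_eq.mpr
  filter_upwards [eventually_mem_chart hσ hx] with y hy
  rw [evalFun_one hy, div_one]

lemma stalk_ext_of_chart (hσ : σ ∈ P.fan) {x : P.Total} (hx : x ∈ chart σ) {f g : P.Total → ℂ}
    {hf : (f : (𝓝 x).Germ ℂ) ∈ Stalk x} {hg : (g : (𝓝 x).Germ ℂ) ∈ Stalk x}
    (h : ∀ y ∈ chart σ, f y = g y) : (⟨f, hf⟩ : Stalk x) = ⟨g, hg⟩ :=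
  Subtype.ext (Filter.Germ.coe_eq.mpr ((eventually_mem_chart hσ hx).mono h))

/-- The germ at `x` of a function on a chart. -/
def toStalk (hσ : σ ∈ P.fan) {x : P.Total} (hx : x ∈ chart σ) :
    AddMonoidAlgebra ℂ (dualMonoid σ) →ₐ[ℂ] Stalk x where
  toFun f := ⟨_, evalFun_mem_stalk hσ hx f⟩
  map_one' := stalk_ext_of_chart hσ hx fun _ hy => evalFun_one hy
  map_mul' f g := stalk_ext_of_chart hσ hx fun _ hy => evalFun_mul hy f g
  map_zero' := stalk_ext_of_chart hσ hx fun _ _ => by simp [evalFun]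
  map_add' f g := stalk_ext_of_chart hσ hx fun _ hy => evalFun_add hy f g
  commutes' r := by
    apply Subtype.ext
    change _ = algebraMap ℂ ((𝓝 x).Germ ℂ) r
    rw [Algebra.algebraMap_eq_smul_one]
    exact Filter.Germ.coe_eq.mpr
      ((eventually_mem_chart hσ hx).mono fun y hy => by simp [evalFun, hy])

lemma toStalk_injective (hσ : σ ∈ P.fan) {x : P.Total} (hx : x ∈ chart σ) :
    Function.Injective (toStalk hσ hx) :=
  (injective_iff_map_eq_zero _).mpr fun _ hf =>
    eq_zero_of_eventually hσ (x := x) (Filter.Germ.coe_eq.mp (congrArg Subtype.val hf))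

lemma toStalk_mul_inv (hσ : σ ∈ P.fan) {x : P.Total} (hx : x ∈ chart σ)
    {f : AddMonoidAlgebra ℂ (dualMonoid σ)} (hf : evalFun f x ≠ 0) :
    toStalk hσ hx f * ⟨_, div_mem_stalk hσ hx 1 f hf⟩ = 1 := by
  apply Subtype.ext
  apply Filter.Germ.coe_eq.mpr
  filter_upwards [(isOpen_principal hσ f).mem_nhds ⟨hx, hf⟩] with y hy
  change evalFun f y * (evalFun 1 y / evalFun f y) = 1
  rw [evalFun_one hy.1, mul_one_div_cancel hy.2]

/-- The germ at `x` of a function on the smallest chart around `x`. -/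
abbrev coordStalk (x : P.Total) : AddMonoidAlgebra ℂ (dualMonoid x.cone) →ₐ[ℂ] Stalk x :=
  toStalk x.mem (mem_chart_self x)

lemma coordStalk_restrict (hσ : σ ∈ P.fan) {x : P.Total} (hx : x ∈ chart σ)
    (f : AddMonoidAlgebra ℂ (dualMonoid σ)) : coordStalk x (restrict hx f) = toStalk hσ hx f := by
  apply Subtype.ext
  apply Filter.Germ.coe_eq.mpr
  filter_upwards [eventually_mem_chart hσ hx, eventually_mem_chart x.mem (mem_chart_self x)]
    with y hy hy'
  exact evalFun_restrict hx hy hy' f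

instance (x : P.Total) : Algebra (AddMonoidAlgebra ℂ (dualMonoid x.cone)) (Stalk x) :=
  (coordStalk x).toAlgebra

instance (x : P.Total) : IsScalarTower ℂ (AddMonoidAlgebra ℂ (dualMonoid x.cone)) (Stalk x) :=
  IsScalarTower.of_algHom (coordStalk x)

/-- The maximal ideal of `x` in the coordinate ring of the smallest chart around `x`. -/
abbrev vanishingIdeal (x : P.Total) : Ideal (AddMonoidAlgebra ℂ (dualMonoid x.cone)) :=
  RingHom.ker (evalHom (mem_chart_self x))

instance (x : P.Total) : (vanishingIdeal x).IsPrime := RingHom.ker_isPrime _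

lemma mem_primeCompl_vanishingIdeal {x : P.Total} {f : AddMonoidAlgebra ℂ (dualMonoid x.cone)} :
    f ∈ (vanishingIdeal x).primeCompl ↔ evalFun f x ≠ 0 := by
  rw [Ideal.mem_primeCompl_iff, RingHom.mem_ker, evalFun, dif_pos (mem_chart_self x)]

instance isLocalization_stalk (x : P.Total) :
    IsLocalization.AtPrime (Stalk x) (vanishingIdeal x) where
  map_units f := .of_mul_eq_one _
    (toStalk_mul_inv x.mem (mem_chart_self x) (mem_primeCompl_vanishingIdeal.mp f.2))
  surj := by
    rintro ⟨_, A, B, hB, rfl⟩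
    refine ⟨⟨A, B, mem_primeCompl_vanishingIdeal.mpr hB⟩, Subtype.ext (Filter.Germ.coe_eq.mpr ?_)⟩
    filter_upwards [nhds_principal hB] with y hy using div_mul_cancel₀ _ hy.2
  exists_of_eq h := ⟨1, congrArg _ (toStalk_injective x.mem (mem_chart_self x) h)⟩

instance (x : P.Total) : IsDomain (Stalk x) :=
  have : IsDomain (AddMonoidAlgebra ℂ (dualMonoid x.cone)) := NoZeroDivisors.to_isDomain _
  IsLocalization.isDomain_of_atPrime (Stalk x) (vanishingIdeal x)

/-- The germ at `x` of the monomial `χ^m`. -/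
def monomialGerm {x : P.Total} {m : Char n} (hm : m ∈ dualMonoid x.cone) : Stalk x :=
  coordStalk x (AddMonoidAlgebra.single ⟨m, hm⟩ 1)

lemma coe_monomialGerm {x : P.Total} {m : Char n} (hm : m ∈ dualMonoid x.cone) :
    ((monomialGerm hm : Stalk x) : (𝓝 x).Germ ℂ) = (monomial m : P.Total → ℂ) := by
  apply Filter.Germ.coe_eq.mpr
  filter_upwards [eventually_mem_chart x.mem (mem_chart_self x)] with y hy
  rw [evalFun_single hy, one_mul]

lemma monomialGerm_add {x : P.Total} {m m' : Char n} (hm : m ∈ dualMonoid x.cone)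
    (hm' : m' ∈ dualMonoid x.cone) :
    monomialGerm (add_mem hm hm') = monomialGerm hm * monomialGerm hm' := by
  rw [monomialGerm, monomialGerm, monomialGerm, ← map_mul, AddMonoidAlgebra.single_mul_single,
    one_mul]
  rfl

lemma monomialGerm_ne_zero {x : P.Total} {m : Char n} (hm : m ∈ dualMonoid x.cone) :
    monomialGerm hm ≠ 0 :=
  (map_ne_zero_iff _ (toStalk_injective x.mem (mem_chart_self x))).mpr (by simp)

end PolyDecomp.Total

/-! ## The logarithmic tangent sheaf is free -/

section Derivations

variable {R A B : Type} [CommRing R] [CommRing A] [CommRing B] [Algebra R A] [Algebra R B]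
  [Algebra A B] [IsScalarTower R A B] (M : Submonoid A) [IsLocalization M B]

/-- The extension to a localization `B` of `A` of a derivation of `A` with values in `B`. -/
def extendDerivation (D : Derivation R A B) : Derivation R B B :=
  have := Algebra.FormallyEtale.of_isLocalization (Rₘ := B) M
  (D.liftKaehlerDifferential.liftBaseChange B ∘ₗ
    (KaehlerDifferential.tensorKaehlerEquivOfFormallyEtale R A B).symm.toLinearMap).compDer
      (KaehlerDifferential.D R B)

lemma extendDerivation_algebraMap (D : Derivation R A B) (a : A) :
    extendDerivation M D (algebraMap A B a) = D a := by
  have := Algebra.FormallyEtale.of_isLocalization (Rₘ := B) M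
  simp [extendDerivation, KaehlerDifferential.tensorKaehlerEquivOfFormallyEtale_symm_D_algebraMap]

include M in
omit [Algebra R A] [IsScalarTower R A B] in
lemma derivation_ext_of_isLocalization {D D' : Derivation R B B}
    (h : ∀ a, D (algebraMap A B a) = D' (algebraMap A B a)) : D = D' := by
  ext b
  obtain ⟨⟨a, s⟩, hs⟩ := IsLocalization.surj M b
  refine (IsLocalization.map_units B s).mul_left_cancel ?_
  have hD := h a
  rw [← hs, D.leibniz, D'.leibniz, h s] at hD
  exact add_left_cancel hD

end Derivations

lemma exists_extend_addMonoidHom {G A : Type} [AddCommGroup G] [AddCommGroup A]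
    {S : AddSubmonoid G} (hS : ∀ m, ∃ s ∈ S, m + s ∈ S) (q : S →+ A) :
    ∃ Q : G →+ A, ∀ m : S, Q m = q m := by
  let loc : (⊤ : AddSubmonoid S).LocalizationMap G :=
    { S.subtype with
      isLocalizationMap :=
        { map_addUnits := fun y => AddGroup.isAddUnit _
          surj := fun z => by
            obtain ⟨s, hs, hzs⟩ := hS z
            exact ⟨⟨⟨_, hzs⟩, ⟨s, hs⟩, trivial⟩, rfl⟩
          exists_of_eq := fun h => ⟨0, congrArg _ (Subtype.ext h)⟩ } }
  exact ⟨loc.lift (g := q) fun _ => AddGroup.isAddUnit _, loc.lift_eq _⟩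

/-- The pairing of a vector of coefficients with the characters, `m ↦ ∑ m_j q_j`: the logarithmic
derivative of `χ^m` along the combination with coefficients `q_j` of the fields `χ^m ↦ m_j χ^m`. -/
def charPairing {n : ℕ} {A : Type} [AddCommGroup A] (q : Fin n → A) : Char n →+ A :=
  ∑ j, (zmultiplesHom A (q j)).comp
    ((Pi.evalAddMonoidHom (fun _ : Fin n => ℤ) j).comp (AddMonoidHom.fst _ _))

lemma charPairing_apply {n : ℕ} {A : Type} [AddCommGroup A] (q : Fin n → A) (m : Char n) :
    charPairing q m = ∑ j, m.1 j • q j := by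
  simp [charPairing]

lemma charPairing_single {n : ℕ} {A : Type} [AddCommGroup A] (q : Fin n → A) (i : Fin n) :
    charPairing q (Pi.single i 1, 0) = q i := by
  simp [charPairing_apply, Pi.single_apply, ite_smul]

lemma eq_charPairing {n : ℕ} {A : Type} [AddCommGroup A] {Q : Char n →+ A} (hQ : Q (0, 1) = 0) :
    Q = charPairing fun j => Q (Pi.single j 1, 0) := by
  refine AddMonoidHom.ext fun m => ?_
  have hm : m = ∑ j, m.1 j • ((Pi.single j 1, 0) : Char n) + m.2 • ((0, 1) : Char n) := by
    ext i
    · simp [Prod.fst_sum, Finset.sum_apply, Pi.single_apply]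
    · simp [Prod.snd_sum]
  conv_lhs => rw [hm]
  simp only [charPairing_apply, map_add, map_sum, map_zsmul, hQ, zsmul_zero, add_zero]

namespace PolyDecomp.Total

variable {n : ℕ} {P : PolyDecomp n}

/-- The derivation `χ^m ↦ c(m) χ^m` of the local ring at `x`. -/
def stalkDeriv (x : P.Total) (c : Char n →+ ℂ) : Derivation ℂ (Stalk x) (Stalk x) :=
  extendDerivation (vanishingIdeal x).primeCompl
    ((Algebra.linearMap (AddMonoidAlgebra ℂ (dualMonoid x.cone)) (Stalk x)).compDer
      (logDeriv (c.comp (dualMonoid x.cone).subtype)))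

lemma stalkDeriv_coordStalk (x : P.Total) (c : Char n →+ ℂ)
    (A : AddMonoidAlgebra ℂ (dualMonoid x.cone)) :
    stalkDeriv x c (coordStalk x A) =
      coordStalk x (logDeriv (c.comp (dualMonoid x.cone).subtype) A) :=
  extendDerivation_algebraMap _ _ A

lemma stalkDeriv_toStalk {σ : Set ((Fin n → ℝ) × ℝ)} (hσ : σ ∈ P.fan) {x : P.Total}
    (hx : x ∈ chart σ) (c : Char n →+ ℂ) (A : AddMonoidAlgebra ℂ (dualMonoid σ)) :
    stalkDeriv x c (toStalk hσ hx A) =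
      toStalk hσ hx (logDeriv (c.comp (dualMonoid σ).subtype) A) := by
  rw [← coordStalk_restrict, stalkDeriv_coordStalk, ← coordStalk_restrict hσ hx]
  exact congrArg (coordStalk x) (logDeriv_mapDomain (c.comp (dualMonoid x.cone).subtype)
    (AddSubmonoid.inclusion (dualMonoid_le_dualMonoid_cone hx)) A)

lemma stalkDeriv_monomialGerm {x : P.Total} (c : Char n →+ ℂ) {m : Char n}
    (hm : m ∈ dualMonoid x.cone) :
    stalkDeriv x c (monomialGerm hm) = c m • monomialGerm hm := by
  rw [monomialGerm, stalkDeriv_coordStalk, logDeriv_single, ← map_smul,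
    AddMonoidAlgebra.smul_single, smul_eq_mul]
  rfl

lemma derivation_ext {x : P.Total} {D D' : Derivation ℂ (Stalk x) (Stalk x)}
    (h : ∀ (m : Char n) (hm : m ∈ dualMonoid x.cone), D (monomialGerm hm) = D' (monomialGerm hm)) :
    D = D' := by
  refine derivation_ext_of_isLocalization (vanishingIdeal x).primeCompl fun A => ?_
  induction A using AddMonoidAlgebra.induction_linear with
  | zero => simp
  | add f g hf hg => rw [map_add, map_add, map_add, hf, hg]
  | single m a =>
    have : AddMonoidAlgebra.single m a = a • AddMonoidAlgebra.single m (1 : ℂ) := by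
      rw [AddMonoidAlgebra.smul_single, smul_eq_mul, mul_one]
    change D (coordStalk x _) = D' (coordStalk x _)
    rw [this, map_smul, Derivation.map_smul, Derivation.map_smul]
    exact congrArg _ (h m.1 m.2)

instance moduleLogTangentStalk (x : P.Total) : Module (Stalk x) (logTangentStalk x) :=
  Submodule.module (logTangentStalk x)

instance smulLogTangentStalk (x : P.Total) : SMul (Stalk x) (logTangentStalk x) :=
  (moduleLogTangentStalk x).toSMul

/-- The `j`-th coordinate of a character. -/
def charCoord (j : Fin n) : Char n →+ ℂ :=
  (Int.castAddHom ℂ).comp ((Pi.evalAddMonoidHom (fun _ : Fin n => ℤ) j).comp (AddMonoidHom.fst _ _))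

lemma stalkDeriv_mem_logTangentStalk (x : P.Total) {c : Char n →+ ℂ} (hc : c (0, 1) = 0) :
    stalkDeriv x c ∈ logTangentStalk x := by
  refine ⟨?_, fun f hf => ?_⟩
  · rintro f ⟨m, hm, u, hu⟩
    have hf : f = monomialGerm hm * u := Subtype.ext (by
      rw [hu, ← coe_monomialGerm hm]
      rfl)
    rw [hf, Derivation.leibniz, stalkDeriv_monomialGerm]
    exact dvd_add (mul_dvd_mul_left _ (u.isUnit.dvd))
      ⟨algebraMap ℂ _ (c m), by rw [smul_eq_mul, Algebra.smul_def]; ring⟩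
  · have hft : f = monomialGerm (PolyDecomp.snd_mem_dualMonoid x.mem) :=
      Subtype.ext (hf.trans (coe_monomialGerm _).symm)
    rw [hft, stalkDeriv_monomialGerm, hc, zero_smul]

/-- The logarithmic vector field `χ^m ↦ m_j χ^m`. -/
def coordField (x : P.Total) (j : Fin n) : logTangentStalk x :=
  ⟨stalkDeriv x (charCoord j), stalkDeriv_mem_logTangentStalk x (by simp [charCoord])⟩

lemma sum_coordField_monomialGerm {x : P.Total} (q : Fin n → Stalk x) {m : Char n}
    (hm : m ∈ dualMonoid x.cone) :
    (∑ j, q j • coordField x j).1 (monomialGerm hm) = monomialGerm hm * charPairing q m := by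
  have hsum : ∀ D : Fin n → Derivation ℂ (Stalk x) (Stalk x),
      (∑ j, D j) (monomialGerm hm) = ∑ j, D j (monomialGerm hm) := fun D =>
    (congrFun (map_sum Derivation.coeFnAddMonoidHom D Finset.univ) _).trans
      (Finset.sum_apply _ _ _)
  rw [Submodule.coe_sum, hsum, charPairing_apply, Finset.mul_sum]
  refine Finset.sum_congr rfl fun j _ => ?_
  change q j * stalkDeriv x (charCoord j) (monomialGerm hm) = _
  rw [stalkDeriv_monomialGerm, show charCoord j m = (m.1 j : ℂ) from rfl, Int.cast_smul_eq_zsmul,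
    zsmul_eq_mul, zsmul_eq_mul]
  ring

lemma addMonoidHom_eq_zero_of_dualMonoid {σ : Set ((Fin n → ℝ) × ℝ)} (hσ : σ ∈ P.fan) {A : Type}
    [AddCommGroup A] {Q : Char n →+ A} (h : ∀ m ∈ dualMonoid σ, Q m = 0) : Q = 0 := by
  obtain ⟨m₀, h₀, hadd⟩ := PolyDecomp.exists_add_nsmul_mem_dualMonoid hσ
  refine AddMonoidHom.ext fun m => ?_
  obtain ⟨k, hk⟩ := hadd m
  have := h _ hk
  rwa [map_add, map_nsmul, h m₀ h₀, nsmul_zero, add_zero] at this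

lemma linearIndependent_coordField (x : P.Total) : LinearIndependent (Stalk x) (coordField x) := by
  refine Fintype.linearIndependent_iffₛ.mpr fun q q' h i => ?_
  have hpair : charPairing q - charPairing q' = 0 :=
    addMonoidHom_eq_zero_of_dualMonoid x.mem fun m hm => sub_eq_zero.mpr <| by
      refine mul_left_cancel₀ (monomialGerm_ne_zero hm) ?_
      rw [← sum_coordField_monomialGerm, ← sum_coordField_monomialGerm, h]
  rw [← charPairing_single q i, ← charPairing_single q' i, sub_eq_zero.mp hpair]

lemma monomialGerm_mem_logStructure {x : P.Total} {m : Char n} (hm : m ∈ dualMonoid x.cone) :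
    monomialGerm hm ∈ logStructure x :=
  ⟨m, hm, 1, by rw [coe_monomialGerm]; exact (mul_one _).symm⟩

lemma exists_logarithmic_derivative {x : P.Total} (D : logTangentStalk x) :
    ∃ Q : Char n →+ Stalk x, ∀ (m : Char n) (hm : m ∈ dualMonoid x.cone),
      D.1 (monomialGerm hm) = monomialGerm hm * Q m := by
  choose q hq using fun m : dualMonoid x.cone =>
    D.2.1 (monomialGerm m.2) (monomialGerm_mem_logStructure m.2)
  have hadd (m m') : q (m + m') = q m + q m' := by
    apply mul_left_cancel₀ (monomialGerm_ne_zero (m + m').2)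
    have hmul : monomialGerm (m + m').2 = monomialGerm m.2 * monomialGerm m'.2 :=
      monomialGerm_add m.2 m'.2
    rw [← hq (m + m'), hmul, Derivation.leibniz, hq m, hq m', smul_eq_mul, smul_eq_mul]
    ring
  obtain ⟨m₀, h₀, hk⟩ := PolyDecomp.exists_add_nsmul_mem_dualMonoid x.mem
  obtain ⟨Q, hQ⟩ := exists_extend_addMonoidHom
    (fun m => ⟨_, nsmul_mem h₀ _, (hk m).choose_spec⟩) (AddMonoidHom.mk' q hadd)
  exact ⟨Q, fun m hm => (hq ⟨m, hm⟩).trans (congrArg _ (hQ ⟨m, hm⟩).symm)⟩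

lemma span_coordField (x : P.Total) :
    Submodule.span (Stalk x) (Set.range (coordField x)) = ⊤ := by
  refine eq_top_iff.mpr fun D _ => ?_
  obtain ⟨Q, hQ⟩ := exists_logarithmic_derivative D
  have hQt : Q (0, 1) = 0 := by
    have ht := PolyDecomp.snd_mem_dualMonoid x.mem
    have h0 : monomialGerm ht * Q (0, 1) = 0 :=
      (hQ _ ht).symm.trans (D.2.2 _ (coe_monomialGerm ht))
    exact (mul_eq_zero.mp h0).resolve_left (monomialGerm_ne_zero ht)
  have hD : D = ∑ j, Q (Pi.single j 1, 0) • coordField x j :=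
    Subtype.ext (derivation_ext fun m hm => by
      rw [sum_coordField_monomialGerm, ← eq_charPairing hQt, hQ])
  rw [hD]
  exact Submodule.sum_mem _ fun j _ => Submodule.smul_mem _ _ (Submodule.subset_span ⟨j, rfl⟩)

/-- The basis of the logarithmic tangent space at `x` which consists of the coordinate fields. -/
def logBasis (x : P.Total) : Module.Basis (Fin n) (Stalk x) (logTangentStalk x) :=
  Module.Basis.mk (linearIndependent_coordField x) (span_coordField x).ge

lemma logBasis_apply (x : P.Total) (j : Fin n) : logBasis x j = coordField x j :=
  Module.Basis.mk_apply _ _ j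

lemma apply_monomialGerm {x : P.Total} (D : logTangentStalk x) {m : Char n}
    (hm : m ∈ dualMonoid x.cone) :
    D.1 (monomialGerm hm) = monomialGerm hm * charPairing ((logBasis x).repr D) m := by
  rw [← sum_coordField_monomialGerm]
  simp_rw [← logBasis_apply, (logBasis x).sum_repr]

end PolyDecomp.Total

namespace PolyDecomp.Total

variable {n : ℕ} {P : PolyDecomp n}

/-- The germs `d y` are near `x` the germs of a single function. -/
def CoherentAt {U : Opens P.Total} (d : (y : U) → Stalk y.1) (x : P.Total) : Prop :=
  ∃ g : P.Total → ℂ, ∀ᶠ y in 𝓝 x, ∀ hy : y ∈ U, (d ⟨y, hy⟩ : (𝓝 y).Germ ℂ) = g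

lemma CoherentAt.sub {U : Opens P.Total} {d d' : (y : U) → Stalk y.1} {x : P.Total}
    (h : CoherentAt d x) (h' : CoherentAt d' x) : CoherentAt (fun y => d y - d' y) x := by
  obtain ⟨g, hg⟩ := h
  obtain ⟨g', hg'⟩ := h'
  refine ⟨g - g', ?_⟩
  filter_upwards [hg, hg'] with y h h' hy
  change (d ⟨y, hy⟩ : (𝓝 y).Germ ℂ) - (d' ⟨y, hy⟩ : (𝓝 y).Germ ℂ) = _
  rw [h hy, h' hy]
  rfl

lemma exists_isRegularOn_of_coherentAt {U : Opens P.Total} {d : (y : U) → Stalk y.1}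
    (h : ∀ x ∈ U, CoherentAt d x) :
    ∃ g : P.Total → ℂ, IsRegularOn g (U : Set P.Total) ∧
      ∀ (x : P.Total) (hx : x ∈ U), (d ⟨x, hx⟩ : (𝓝 x).Germ ℂ) = g := by
  classical
  let g : P.Total → ℂ := fun y => if hy : y ∈ U then (d ⟨y, hy⟩ : (𝓝 y).Germ ℂ).value else 0
  have hg (x : P.Total) (hx : x ∈ U) : (d ⟨x, hx⟩ : (𝓝 x).Germ ℂ) = g := by
    obtain ⟨g', hg'⟩ := h x hx
    rw [hg'.self_of_nhds hx]
    refine Filter.Germ.coe_eq.mpr ?_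
    filter_upwards [hg', U.isOpen.mem_nhds hx] with y hy hyU
    rw [show g y = (d ⟨y, hyU⟩ : (𝓝 y).Germ ℂ).value from dif_pos hyU, hy hyU]
    rfl
  exact ⟨g, fun x hx => hg x hx ▸ (d ⟨x, hx⟩).2, hg⟩

lemma coherentAt_stalkDeriv (c : Char n →+ ℂ) {U : Opens P.Total} {f : P.Total → ℂ}
    (hf : IsRegularOn f (U : Set P.Total)) {x : P.Total} (hx : x ∈ U) :
    CoherentAt (U := U) (fun y => stalkDeriv y.1 c ⟨(f : (𝓝 y.1).Germ ℂ), hf y.1 y.2⟩) x := by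
  obtain ⟨A, B, hB, hAB⟩ := hf x hx
  let A' := logDeriv (c.comp (dualMonoid x.cone).subtype) A
  let B' := logDeriv (c.comp (dualMonoid x.cone).subtype) B
  refine ⟨fun y => (evalFun A' y - f y * evalFun B' y) *
    (evalFun (1 : AddMonoidAlgebra ℂ (dualMonoid x.cone)) y / evalFun B y), ?_⟩
  filter_upwards [(Filter.Germ.coe_eq.mp hAB).eventually_nhds,
    (isOpen_principal x.mem B).mem_nhds ⟨mem_chart_self x, hB⟩] with y hfy ⟨hy, hBy⟩ hyU
  let F : Stalk y := ⟨(f : (𝓝 y).Germ ℂ), hf y hyU⟩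
  let I : Stalk y := ⟨_, div_mem_stalk x.mem hy 1 B hBy⟩
  have hI : toStalk x.mem hy B * I = 1 := toStalk_mul_inv x.mem hy hBy
  have hF : F * toStalk x.mem hy B = toStalk x.mem hy A := by
    refine Subtype.ext (Filter.Germ.coe_eq.mpr ?_)
    filter_upwards [hfy, (isOpen_principal x.mem B).mem_nhds ⟨hy, hBy⟩] with z hz hBz
    change f z * evalFun B z = evalFun A z
    rw [hz]
    exact div_mul_cancel₀ _ hBz.2
  have hD := congrArg (stalkDeriv y c) hF
  rw [Derivation.leibniz, stalkDeriv_toStalk, stalkDeriv_toStalk, smul_eq_mul, smul_eq_mul] at hD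
  have hDF : stalkDeriv y c F = (toStalk x.mem hy A' - F * toStalk x.mem hy B') * I := by
    linear_combination I * hD - stalkDeriv y c F * hI
  exact congrArg Subtype.val hDF

lemma isLogField_coordField (U : Opens P.Total) (j : Fin n) :
    IsLogField U fun x => coordField x.1 j := fun _ _ _ hf =>
  exists_isRegularOn_of_coherentAt fun _ hx => coherentAt_stalkDeriv (charCoord j) hf hx

lemma exists_isRegularOn_germ_eq {x : P.Total} (q : Stalk x) :
    ∃ (g : P.Total → ℂ) (V : Opens P.Total), x ∈ V ∧ IsRegularOn g (V : Set P.Total) ∧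
      (q : (𝓝 x).Germ ℂ) = g := by
  obtain ⟨q, A, B, hB, rfl⟩ := q
  exact ⟨_, ⟨_, isOpen_principal x.mem B⟩, ⟨mem_chart_self x, hB⟩,
    fun y hy => div_mem_stalk x.mem hy.1 A B hy.2, rfl⟩

lemma IsLogField.coherentAt_charPairing {U : Opens P.Total} {θ : (x : U) → logTangentStalk x.1}
    (hθ : IsLogField U θ) {x : P.Total} (hx : x ∈ U) {m : Char n} (hm : m ∈ dualMonoid x.cone) :
    CoherentAt (fun y => charPairing ((logBasis y.1).repr (θ y)) m) x := by
  obtain ⟨g, V, hxV, hg, hgx⟩ :=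
    exists_isRegularOn_germ_eq (charPairing ((logBasis x).repr (θ ⟨x, hx⟩)) m)
  obtain ⟨W, hW, hWo, hxW⟩ := eventually_nhds_iff.mp (eventually_mem_chart x.mem (mem_chart_self x))
  have hmW {y : P.Total} (hy : y ∈ W) : m ∈ dualMonoid y.cone :=
    dualMonoid_le_dualMonoid_cone (hW y hy) hm
  have hmon : IsRegularOn (monomial m) ((U ⊓ ⟨W, hWo⟩ : Opens P.Total) : Set P.Total) :=
    fun y hy => coe_monomialGerm (hmW hy.2) ▸ (monomialGerm (hmW hy.2)).2
  obtain ⟨G, -, hθG⟩ := hθ _ inf_le_left (monomial m) hmon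
  have hG {y : P.Total} (hyU : y ∈ U) (hyW : y ∈ W) :
      ((monomialGerm (hmW hyW) * charPairing ((logBasis y).repr (θ ⟨y, hyU⟩)) m : Stalk y) :
        (𝓝 y).Germ ℂ) = G := by
    rw [← apply_monomialGerm, ← hθG y ⟨hyU, hyW⟩]
    exact congrArg (fun f => (((θ ⟨y, hyU⟩).1 f : Stalk y) : (𝓝 y).Germ ℂ))
      (Subtype.ext (coe_monomialGerm _))
  have hmg : ∀ᶠ y in 𝓝 x, monomial m y * g y = G y := by
    refine Filter.Germ.coe_eq.mp (Eq.trans ?_ (hG hx hxW))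
    change _ = (monomialGerm (hmW hxW) : (𝓝 x).Germ ℂ) * (_ : (𝓝 x).Germ ℂ)
    rw [hgx, coe_monomialGerm]
    rfl
  refine ⟨g, ?_⟩
  filter_upwards [hmg.eventually_nhds, V.isOpen.mem_nhds hxV, hWo.mem_nhds hxW]
    with y hy hyV hyW hyU
  suffices h : charPairing ((logBasis y).repr (θ ⟨y, hyU⟩)) m = ⟨(g : (𝓝 y).Germ ℂ), hg y hyV⟩ from
    congrArg Subtype.val h
  refine mul_left_cancel₀ (monomialGerm_ne_zero (hmW hyW)) (Subtype.ext ((hG hyU hyW).trans ?_))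
  change _ = (monomialGerm (hmW hyW) : (𝓝 y).Germ ℂ) * (g : (𝓝 y).Germ ℂ)
  rw [coe_monomialGerm]
  exact (Filter.Germ.coe_eq.mpr hy).symm

lemma IsLogField.exists_repr_eq {U : Opens P.Total} {θ : (x : U) → logTangentStalk x.1}
    (hθ : IsLogField U θ) (j : Fin n) :
    ∃ g : P.Total → ℂ, IsRegularOn g (U : Set P.Total) ∧ ∀ (x : P.Total) (hx : x ∈ U),
      ((logBasis x).repr (θ ⟨x, hx⟩) j : (𝓝 x).Germ ℂ) = g := by
  refine exists_isRegularOn_of_coherentAt (d := fun y => (logBasis y.1).repr (θ y) j)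
    fun x hx => ?_
  obtain ⟨m₀, h₀, hk⟩ := PolyDecomp.exists_add_nsmul_mem_dualMonoid x.mem
  obtain ⟨k, hk⟩ := hk (Pi.single j 1, 0)
  have := (hθ.coherentAt_charPairing hx hk).sub
    (hθ.coherentAt_charPairing hx (nsmul_mem h₀ k))
  simpa only [← map_sub, add_sub_cancel_right, charPairing_single] using this

end PolyDecomp.Total

/-! ## The normalization sequence of the pulled back sheaf -/

section PullbackCoordinates

open PolyDecomp.Total

variable {n : ℕ} {P : PolyDecomp n} {C : NodalCurve} (φ : Mor C.Point P.Total)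

/-- The basis of the stalk of `φ^*Θ` which consists of the coordinate fields. -/
def pullBasis (c : C.Point) : Module.Basis (Fin n) (StalkAlong φ c) (PullStalk φ c) :=
  Algebra.TensorProduct.basis (StalkAlong φ c) (logBasis (φ.toFun c))

/-- The coefficients of an element of the stalk of `φ^*Θ` with respect to the coordinate fields. -/
def coeff (c : C.Point) (j : Fin n) : PullStalk φ c →+ Stalk c :=
  ((pullBasis φ c).coord j).toAddMonoidHom

lemma coeff_smul (c : C.Point) (j : Fin n) (r : StalkAlong φ c) (s : PullStalk φ c) :
    coeff φ c j (r • s) = (show Stalk c from r) * coeff φ c j s :=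
  ((pullBasis φ c).coord j).map_smul r s

lemma coeff_injective {c : C.Point} {s s' : PullStalk φ c}
    (h : ∀ j, coeff φ c j s = coeff φ c j s') : s = s' :=
  (pullBasis φ c).ext_elem h

lemma coeff_tensor (c : C.Point) (j : Fin n) (f : StalkAlong φ c)
    (θ : logTangentStalk (φ.toFun c)) :
    coeff φ c j (tensor φ c f θ) =
      (show Stalk c from f) * φ.comap c ((logBasis (φ.toFun c)).repr θ j) :=
  congrArg (fun x => x j)
    (Algebra.TensorProduct.basis_repr_tmul (A := StalkAlong φ c) (logBasis (φ.toFun c)) f θ)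

lemma coeff_tensor_coordField (c : C.Point) (j k : Fin n) (f : StalkAlong φ c) :
    coeff φ c j (tensor φ c f (coordField (φ.toFun c) k)) =
      if k = j then (show Stalk c from f) else 0 := by
  rw [coeff_tensor, ← logBasis_apply, Module.Basis.repr_self, Finsupp.single_apply]
  split_ifs
  · rw [map_one, mul_one]
  · rw [map_zero, mul_zero]

lemma IsPreSection.exists_coeff_eq {W : Opens C.Point} {s : (c : W) → PullStalk φ c.1}
    (hs : IsPreSection φ W s) (j : Fin n) :
    ∃ F : C.Point → ℂ, ∀ c : W, (coeff φ c.1 j (s c) : (𝓝 c.1).Germ ℂ) = F := by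
  obtain ⟨U, hU, ι, _, f, hf, θ, hθ, hs⟩ := hs
  choose g _ hgθ using fun k => (hθ k).exists_repr_eq j
  refine ⟨∑ k, f k * (g k ∘ φ.toFun), fun c => ?_⟩
  rw [hs, map_sum, AddSubmonoidClass.coe_finsetSum]
  refine Eq.trans ?_ (map_sum (Filter.Germ.coeRingHom (R := ℂ) (𝓝 c.1)) _ Finset.univ).symm
  refine Finset.sum_congr rfl fun k _ => ?_
  rw [coeff_tensor]
  change _ * Filter.Germ.compTendsto (_ : (𝓝 (φ.toFun c.1)).Germ ℂ) φ.toFun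
    (φ.cont.tendsto c.1) = _
  rw [hgθ k _ (hU c.1 c.2)]
  rfl

/-- The value of a regular germ. -/
def stalkValue {X : Type} [TopologicalSpace X] [HasRegularGerms X] (x : X) : Stalk x →+* ℂ :=
  (Filter.Germ.valueRingHom : (𝓝 x).Germ ℂ →+* ℂ).comp (Stalk x).val.toRingHom

lemma stalkValue_algebraMap {X : Type} [TopologicalSpace X] [HasRegularGerms X] (x : X) (a : ℂ) :
    stalkValue x (algebraMap ℂ (Stalk x) a) = a := by
  rw [Algebra.algebraMap_eq_smul_one]
  exact mul_one a

/-- The values of the `j`-th coefficient of a section of `φ^*Θ` over `W`, extended by zero. -/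
def coeffFun {W : Opens C.Point} (s : (c : W) → PullStalk φ c.1) (j : Fin n) : C.Point → ℂ :=
  Function.extend Subtype.val (fun c : W => stalkValue c.1 (coeff φ c.1 j (s c))) 0

lemma coeffFun_apply {W : Opens C.Point} (s : (c : W) → PullStalk φ c.1) (j : Fin n) (c : W) :
    coeffFun φ s j c.1 = stalkValue c.1 (coeff φ c.1 j (s c)) :=
  Subtype.val_injective.extend_apply _ _ c

lemma IsSection.coeff_eq_coeffFun {W : Opens C.Point} {s : (c : W) → PullStalk φ c.1}
    (hs : IsSection φ W s) (j : Fin n) (c : W) :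
    (coeff φ c.1 j (s c) : (𝓝 c.1).Germ ℂ) = coeffFun φ s j := by
  obtain ⟨W', hW, hc, hs'⟩ := hs c
  obtain ⟨F, hF⟩ := hs'.exists_coeff_eq φ j
  refine (hF ⟨c.1, hc⟩).trans (Filter.Germ.coe_eq.mpr ?_)
  filter_upwards [W'.isOpen.mem_nhds hc] with c' hc'
  rw [coeffFun_apply φ s j ⟨c', hW hc'⟩]
  exact (congrArg Filter.Germ.value (hF ⟨c', hc'⟩)).symm

lemma isRegularAt_of_mem_stalk {F : C.Point → ℂ} {x : C.Norm}
    (hF : (F : (𝓝 (C.proj x)).Germ ℂ) ∈ Stalk (C.proj x)) :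
    IsRegularAt (fun q => F (C.proj ⟨x.1, q⟩)) x.2 := by
  obtain ⟨f, hf, h⟩ := hF
  obtain ⟨O, hO, hOopen, hxO⟩ := eventually_nhds_iff.mp (Filter.Germ.coe_eq.mp hf)
  refine (h x.1 x.2 rfl).congr (hO _ hxO) ?_
  filter_upwards [NodalCurve.eventually_proj_mem (W := ⟨O, hOopen⟩) hxO] with q hq
  exact hO _ hq

lemma IsSection.coeffFun_mem_normFunctions {W : Opens C.Point} {s : (c : W) → PullStalk φ c.1}
    (hs : IsSection φ W s) :
    (fun y j => coeffFun φ s j (C.proj y.1)) ∈ (C.normFunctions n).sec W :=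
  NodalCurve.mem_normFunctions_of_regularAt (F := fun y j => coeffFun φ s j (C.proj y))
    fun _ hx j => isRegularAt_of_mem_stalk
      (hs.coeff_eq_coeffFun φ j ⟨_, hx⟩ ▸ (coeff φ _ j (s ⟨_, hx⟩)).2)

/-- The sections of `φ^*Θ` as functions on the normalization. -/
def toNormFunctions : pullbackSheaf φ ⟶ (C.normFunctions n).sheaf :=
  ⟨{ app := fun W => AddCommGrpCat.ofHom
      { toFun := fun s => (⟨_, IsSection.coeffFun_mem_normFunctions φ s.2⟩ :
          (C.normFunctions n).sec W.unop)
        map_zero' := Subtype.ext <| funext fun y => funext fun j => by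
          change coeffFun φ _ j _ = 0
          rw [coeffFun_apply φ _ j ⟨_, y.2⟩]
          exact (congrArg _ (map_zero _)).trans (map_zero _)
        map_add' := fun s s' => Subtype.ext <| funext fun y => funext fun j => by
          change coeffFun φ _ j _ = coeffFun φ _ j _ + coeffFun φ _ j _
          simp only [coeffFun_apply φ _ j ⟨_, y.2⟩, ← map_add]
          rfl }
     naturality := fun W W' i => by
      ext s
      refine Subtype.ext (funext fun y => funext fun j => ?_)
      exact (coeffFun_apply φ _ j ⟨_, y.2⟩).trans
        (coeffFun_apply φ s.1 j ⟨_, i.unop.le y.2⟩).symm }⟩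

lemma toNormFunctions_injective (W : Opens C.Point) :
    Function.Injective ((toNormFunctions φ).hom.app (Opposite.op W)) := by
  intro s s' h
  change sections φ W at s s'
  have hfun (j : Fin n) (c : W) : coeffFun φ s.1 j c.1 = coeffFun φ s'.1 j c.1 := by
    obtain ⟨y, hy⟩ := C.proj_surjective c.1
    have hyW : C.proj y ∈ W := hy ▸ c.2
    exact hy ▸ congrFun (congrFun (congrArg Subtype.val h) ⟨y, hyW⟩) j
  refine Subtype.ext (funext fun c => coeff_injective φ fun j => Subtype.ext ?_)
  rw [IsSection.coeff_eq_coeffFun φ s.2, IsSection.coeff_eq_coeffFun φ s'.2]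
  refine Filter.Germ.coe_eq.mpr ?_
  filter_upwards [W.isOpen.mem_nhds c.2] with c' hc'
  exact hfun j ⟨c', hc'⟩

lemma exists_isRegularOn_of_eq_at_branches {W : Opens C.Point} (f : (C.normFunctions n).sec W)
    (hf : ∀ (ν : C.Node) (h₁ : C.proj (C.branch ν true) ∈ W) (h₀ : C.proj (C.branch ν false) ∈ W),
      f.1 ⟨C.branch ν true, h₁⟩ = f.1 ⟨C.branch ν false, h₀⟩) :
    ∃ F : Fin n → C.Point → ℂ, (∀ j, IsRegularOn (F j) (W : Set C.Point)) ∧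
      ∀ y j, f.1 y j = F j (C.proj y.1) := by
  let F : Fin n → C.Point → ℂ := fun j =>
    Quot.lift (fun y => NodalCurve.extendByZero W _ f.1 y j) <| by
      rintro a b ⟨ν, rfl, rfl⟩
      by_cases h : C.proj (C.branch ν false) ∈ W
      · have h' : C.proj (C.branch ν true) ∈ W := by rwa [← C.proj_branch]
        rw [NodalCurve.extendByZero_of_mem _ h, NodalCurve.extendByZero_of_mem _ h', hf ν h' h]
      · have h' : C.proj (C.branch ν true) ∉ W := by rwa [← C.proj_branch]
        rw [NodalCurve.extendByZero_of_notMem _ h, NodalCurve.extendByZero_of_notMem _ h']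
  refine ⟨F, fun j c hc => ⟨F j, rfl, ?_⟩,
    fun y j => congrFun (NodalCurve.extendByZero_of_mem f.1 y.2).symm j⟩
  rintro i p rfl
  exact NodalCurve.mem_normFunctions_iff.mp f.2 ⟨i, p⟩ hc j

lemma exists_section_coeffFun_eq {W : Opens C.Point} {F : Fin n → C.Point → ℂ}
    (hF : ∀ j, IsRegularOn (F j) (W : Set C.Point)) :
    ∃ s : sections φ W, ∀ (j : Fin n) (c : W), coeffFun φ s.1 j c.1 = F j c.1 := by
  let s : (c : W) → PullStalk φ c.1 := fun c =>
    ∑ j, tensor φ c.1 (germAlong φ W (F j) (hF j) c) (coordField (φ.toFun c.1) j)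
  have hs : IsSection φ W s := fun c => ⟨W, le_rfl, c.2, ⊤, fun _ _ => trivial, Fin n,
    inferInstance, F, hF, fun j x => coordField x.1 j, fun j => isLogField_coordField ⊤ j,
    fun _ => rfl⟩
  refine ⟨⟨s, hs⟩, fun j c => ?_⟩
  have hcoeff : coeff φ c.1 j (s c) = germAlong φ W (F j) (hF j) c := by
    refine (map_sum _ _ _).trans ?_
    refine (Finset.sum_congr rfl fun k _ => coeff_tensor_coordField φ _ j k _).trans ?_
    exact (Finset.sum_ite_eq' Finset.univ j fun k =>
      (germAlong φ W (F k) (hF k) c : Stalk c.1)).trans (if_pos (Finset.mem_univ j))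
  rw [coeffFun_apply, hcoeff]
  rfl

/-- The normalization sequence `0 → φ^*Θ → ν_* 𝒪^n → ⨁ ℂ^n → 0` of `φ^*Θ`. -/
def normalizationSequence :
    ShortComplex (Sheaf (Opens.grothendieckTopology C.Point) AddCommGrpCat.{0}) where
  X₁ := pullbackSheaf φ
  X₂ := (C.normFunctions n).sheaf
  X₃ := (C.nodeFunctions n).sheaf
  f := toNormFunctions φ
  g := C.nodeDifference n
  zero := by
    apply Sheaf.hom_ext
    ext W s
    refine Subtype.ext (funext fun ν => funext fun j => ?_)
    change coeffFun φ s.1 j _ - coeffFun φ s.1 j _ = 0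
    rw [C.proj_branch, sub_self]

lemma normalizationSequence_shortExact : (normalizationSequence φ).ShortExact := by
  refine shortExact_of_sections (X := TopCat.of C.Point) (S := normalizationSequence φ)
    (toNormFunctions_injective φ) ?_ (NodalCurve.nodeDifference_locallySurjective n)
  intro W f hf
  change (C.normFunctions n).sec W at f
  obtain ⟨F, hF, hfF⟩ := exists_isRegularOn_of_eq_at_branches f fun ν _ h₀ =>
    sub_eq_zero.mp (congrFun (congrArg Subtype.val hf) ⟨ν, h₀⟩)
  obtain ⟨s, hs⟩ := exists_section_coeffFun_eq φ hF
  exact ⟨s, Subtype.ext (funext fun y => funext fun j => (hs j ⟨_, y.2⟩).trans (hfF y j).symm)⟩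

/-- Multiplication by a complex number on the normalization sequence. -/
def normalizationSequenceScalar (a : ℂ) : normalizationSequence φ ⟶ normalizationSequence φ where
  τ₁ := scalar φ a
  τ₂ := (C.normFunctions n).scalar a
  τ₃ := (C.nodeFunctions n).scalar a
  comm₁₂ := by
    apply Sheaf.hom_ext
    ext W s
    refine Subtype.ext (funext fun y => funext fun j => ?_)
    change coeffFun φ _ j _ = a * coeffFun φ _ j _
    rw [coeffFun_apply φ _ j ⟨_, y.2⟩, coeffFun_apply φ _ j ⟨_, y.2⟩]
    refine (congrArg _ (coeff_smul φ _ j _ _)).trans ((map_mul _ _ _).trans ?_)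
    exact congrArg (· * _) (stalkValue_algebraMap _ a)
  comm₂₃ := by
    apply Sheaf.hom_ext
    ext W s
    exact Subtype.ext (funext fun ν => (smul_sub a _ _).symm)

end PullbackCoordinates

/-! ## Cycles of graphs -/

section Graph

variable {V E : Type*} (k : Type*) [Field k] (a b : E → V)

/-- The set of connected components of the graph with edges from `a e` to `b e`. -/
abbrev Components : Type _ := Quot fun v w => ∃ e, a e = v ∧ b e = w

variable {a b} in
lemma card_components_eq_one [Nonempty V]
    (h : ∀ v w : V, Relation.EqvGen (fun v w => ∃ e, a e = v ∧ b e = w) v w) :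
    Nat.card (Components a b) = 1 := by
  have : Subsingleton (Components a b) :=
    ⟨Quot.ind fun v => Quot.ind fun w => Quot.eqvGen_sound (h v w)⟩
  exact Nat.card_of_subsingleton (Quot.mk _ (Classical.arbitrary V))

/-- The coboundary map of the graph with edges from `a e` to `b e`, with coefficients in `M`. -/
def coboundary (M : Type*) [AddCommGroup M] [Module k M] : (V → M) →ₗ[k] (E → M) :=
  LinearMap.funLeft k M b - LinearMap.funLeft k M a

lemma ker_coboundary (M : Type*) [AddCommGroup M] [Module k M] :
    LinearMap.ker (coboundary k a b M) =
      LinearMap.range (LinearMap.funLeft k M (Quot.mk _ : V → Components a b)) := by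
  ext u
  rw [LinearMap.mem_ker]
  constructor
  · intro hu
    refine ⟨Quot.lift u ?_, rfl⟩
    rintro _ _ ⟨e, rfl, rfl⟩
    exact (sub_eq_zero.mp (congrFun hu e)).symm
  · rintro ⟨w, rfl⟩
    exact funext fun e => sub_eq_zero.mpr (congrArg w (Quot.sound ⟨e, rfl, rfl⟩)).symm

lemma finrank_range_coboundary [Fintype V] (M : Type*) [AddCommGroup M] [Module k M]
    [Module.Finite k M] :
    Module.finrank k (LinearMap.range (coboundary k a b M)) +
      Nat.card (Components a b) * Module.finrank k M = Fintype.card V * Module.finrank k M := by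
  have : Fintype (Components a b) := Fintype.ofFinite _
  have h := LinearMap.finrank_range_add_finrank_ker (coboundary k a b M)
  rw [ker_coboundary, LinearMap.finrank_range_of_inj
    (LinearMap.funLeft_injective_of_surjective k M _ Quot.mk_surjective)] at h
  simpa [Module.finrank_pi_fintype] using h

/-- The incidence matrix of the graph with edges from `a e` to `b e`. Its kernel is the space of
cycles of the graph. -/
def incidence [DecidableEq V] : Matrix V E k :=
  Matrix.of fun v e => (if b e = v then 1 else 0) - (if a e = v then 1 else 0)

lemma incidence_transpose_mulVecLin [Fintype V] [DecidableEq V] :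
    (incidence k a b).transpose.mulVecLin = coboundary k a b k := by
  refine LinearMap.ext fun u => funext fun e => ?_
  simp [coboundary, Matrix.vecMul, dotProduct, incidence, mul_sub, Finset.sum_sub_distrib,
    LinearMap.funLeft_apply]

lemma finrank_ker_incidence [Fintype V] [Fintype E] [DecidableEq V] :
    Module.finrank k (LinearMap.ker (incidence k a b).mulVecLin) + Fintype.card V =
      Fintype.card E + Nat.card (Components a b) := by
  have hker := LinearMap.finrank_range_add_finrank_ker (incidence k a b).mulVecLin
  have hrank := (incidence k a b).rank_transpose
  have hcob := finrank_range_coboundary k a b k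
  rw [Module.finrank_fintype_fun_eq_card] at hker
  rw [Matrix.rank, Matrix.rank, incidence_transpose_mulVecLin] at hrank
  rw [Module.finrank_self] at hcob
  omega

lemma ker_incidence_subtype_eq_bot [Fintype E] [DecidableEq V] (p : E → Prop) [DecidablePred p]
    (h : ∀ c ∈ LinearMap.ker (incidence k a b).mulVecLin, (∀ e, c e ≠ 0 → p e) → c = 0) :
    LinearMap.ker (incidence k (fun e : Subtype p => a e) fun e => b e).mulVecLin = ⊥ := by
  refine LinearMap.ker_eq_bot'.mpr fun c hc => funext fun e => ?_
  let c' : E → k := Function.extend Subtype.val c (0 : E → k)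
  have hc' (e : Subtype p) : c' e = c e := Subtype.val_injective.extend_apply c _ e
  have hp (e : E) (he : ¬ p e) : c' e = 0 :=
    Function.extend_apply' c _ e fun ⟨e', h⟩ => he (h ▸ e'.2)
  have hcycle : c' ∈ LinearMap.ker (incidence k a b).mulVecLin := funext fun v => by
    refine Eq.trans ?_ (congrFun hc v)
    refine (Fintype.sum_of_injective Subtype.val Subtype.val_injective _ _ (fun e he => ?_)
      fun e => ?_).symm
    · rw [hp e (by simpa using he), mul_zero]
    · rw [hc']
      rfl
  rw [← hc', h c' hcycle fun e he => by_contra fun hpe => he (hp e hpe)]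
  rfl

/-- Contracting the edges of a forest does not change the first Betti number. -/
lemma finrank_ker_incidence_add_card_components [Finite V] [Fintype E] [DecidableEq V]
    (p : E → Prop)
    (h : ∀ c ∈ LinearMap.ker (incidence k a b).mulVecLin, (∀ e, c e ≠ 0 → p e) → c = 0) :
    Module.finrank k (LinearMap.ker (incidence k a b).mulVecLin) +
        Nat.card (Components (fun e : Subtype p => a e) fun e => b e) =
      Nat.card {e // ¬ p e} + Nat.card (Components a b) := by
  classical
  have := Fintype.ofFinite V
  have hall := finrank_ker_incidence k a b
  have hforest := finrank_ker_incidence k (fun e : Subtype p => a e) fun e => b e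
  rw [ker_incidence_subtype_eq_bot k a b p h, finrank_bot] at hforest
  have hcompl := Fintype.card_subtype_compl p
  have hle := Fintype.card_subtype_le p
  rw [Nat.card_eq_fintype_card (α := {e // ¬ p e})]
  change 0 + _ = Fintype.card {e // p e} + _ at hforest
  omega

end Graph

namespace TropicalCurve

variable {n : ℕ} {T : TropicalCurve n}

lemma boundary_eq_incidence [DecidableEq T.V] :
    T.boundary =
      (incidence ℚ (fun e => T.ends e false) fun e => T.ends e true).mulVecLin := by
  refine LinearMap.ext fun c => funext fun v => Finset.sum_congr rfl fun e _ => ?_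
  rw [mul_comm]
  simp only [incidence, Matrix.of_apply]
  congr!

lemma genus_add_card_cluster
    (hT : ∀ c ∈ LinearMap.ker T.boundary, (∀ e, c e ≠ 0 → T.Contracted e) → c = 0) :
    T.genus + Nat.card T.Cluster = Nat.card T.EdgeNC + 1 := by
  classical
  rw [boundary_eq_incidence] at hT
  have := T.nonempty
  have h := finrank_ker_incidence_add_card_components ℚ _ _ T.Contracted hT
  rw [card_components_eq_one T.connected, ← boundary_eq_incidence] at h
  have hcluster : T.Cluster = Components (fun e : Subtype T.Contracted => T.ends e false)
      fun e => T.ends e true := by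
    simp [Cluster, Components, and_left_comm]
  rwa [hcluster]

end TropicalCurve

/-! ## The first cohomology of the pulled back sheaf -/

namespace NodalCurve

variable (C : NodalCurve)

/-- The coboundary map of the dual graph of a nodal curve. -/
abbrev dualCoboundary (n : ℕ) : (C.Comp → Fin n → ℂ) →ₗ[ℂ] (C.Node → Fin n → ℂ) :=
  coboundary ℂ (fun ν => (C.branch ν false).1) (fun ν => (C.branch ν true).1) (Fin n → ℂ)

lemma card_components_dualGraph :
    Nat.card (Components (fun ν => (C.branch ν false).1) fun ν => (C.branch ν true).1) = 1 :=
  have := C.nonempty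
  card_components_eq_one C.connected

end NodalCurve

section Cohomology

variable {n : ℕ} {P : PolyDecomp n} {C : NodalCurve} (φ : Mor C.Point P.Total)

/-- The connecting homomorphism of the normalization sequence. -/
def nodeConnecting : (C.Node → Fin n → ℂ) →ₗ[ℂ] PullbackH1 φ where
  toFun u := connecting (X := TopCat.of C.Point) (normalizationSequence_shortExact φ)
    (⟨fun ν => u ν.1, trivial⟩ : (C.nodeFunctions n).sec ⊤)
  map_add' u u' := map_add (connecting (X := TopCat.of C.Point)
    (normalizationSequence_shortExact φ)) (⟨fun ν => u ν.1, trivial⟩ : (C.nodeFunctions n).sec ⊤)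
    (⟨fun ν => u' ν.1, trivial⟩ : (C.nodeFunctions n).sec ⊤)
  map_smul' r u := connecting_naturality (X := TopCat.of C.Point)
    (normalizationSequence_shortExact φ) (normalizationSequence_shortExact φ)
    (normalizationSequenceScalar φ r) (⟨fun ν => u ν.1, trivial⟩ : (C.nodeFunctions n).sec ⊤)

lemma nodeConnecting_surjective : Function.Surjective (nodeConnecting φ) := by
  intro x
  have : Subsingleton (Sheaf.H (normalizationSequence φ).X₂ 1) :=
    inferInstanceAs (Subsingleton (Sheaf.H (C.normFunctions n).sheaf 1))
  obtain ⟨u, hu⟩ := connecting_surjective (X := TopCat.of C.Point)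
    (normalizationSequence_shortExact φ) x
  change (C.nodeFunctions n).sec ⊤ at u
  exact ⟨fun ν => u.1 ⟨ν, trivial⟩, hu⟩

lemma ker_nodeConnecting :
    LinearMap.ker (nodeConnecting φ) = LinearMap.range (C.dualCoboundary n) := by
  ext u
  rw [LinearMap.mem_ker]
  refine (connecting_eq_zero_iff (X := TopCat.of C.Point) (normalizationSequence_shortExact φ)
    (⟨fun ν => u ν.1, trivial⟩ : (C.nodeFunctions n).sec ⊤)).trans ?_
  constructor
  · rintro ⟨f, hf⟩
    change (C.normFunctions n).sec ⊤ at f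
    refine ⟨fun i => f.1 ⟨⟨i, P1.inf⟩, trivial⟩, funext fun ν => ?_⟩
    refine Eq.trans ?_ (congrFun (congrArg Subtype.val hf) ⟨ν, trivial⟩)
    exact congrArg₂ (· - ·) (NodalCurve.normFunctions_const f _ _ _)
      (NodalCurve.normFunctions_const f _ _ _)
  · rintro ⟨w, rfl⟩
    exact ⟨(⟨fun y => w y.1.1, NodalCurve.mem_normFunctions_of_regularAt (F := fun y => w y.1)
      fun x _ j => isRegularAt_const (w x.1 j) x.2⟩ : (C.normFunctions n).sec ⊤), rfl⟩

instance : Module.Finite ℂ (PullbackH1 φ) :=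
  Module.Finite.of_surjective (nodeConnecting φ) (nodeConnecting_surjective φ)

lemma finrank_pullbackH1 :
    Module.finrank ℂ (PullbackH1 φ) + Fintype.card C.Comp * n = (Fintype.card C.Node + 1) * n := by
  have hH1 := LinearMap.finrank_range_add_finrank_ker (nodeConnecting φ)
  rw [LinearMap.range_eq_top.mpr (nodeConnecting_surjective φ), finrank_top,
    ker_nodeConnecting] at hH1
  have hcob : Module.finrank ℂ (LinearMap.range (C.dualCoboundary n)) + _ = _ :=
    finrank_range_coboundary ℂ (fun ν => (C.branch ν false).1) (fun ν => (C.branch ν true).1)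
      (Fin n → ℂ)
  rw [C.card_components_dualGraph, Module.finrank_fin_fun] at hcob
  have hnode : Module.finrank ℂ (C.Node → Fin n → ℂ) = Fintype.card C.Node * n := by
    simp [Module.finrank_pi_fintype]
  linarith

end Cohomology

/-! ## Sections of the dualizing sheaf -/

section Dualizing

open Polynomial

lemma RegularAtZero.exists_of_mul_id {g : ℂ → ℂ}
    (h : RegularAtZero (fun s => s * g s) 0) : ∃ v, RegularAtZero g v := by
  obtain ⟨A, B, hB, hA, h⟩ := h
  have hA0 : A.eval 0 = 0 := (div_eq_zero_iff.mp hA.symm).resolve_right hB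
  obtain ⟨A', rfl⟩ := X_dvd_iff.mpr ((coeff_zero_eq_eval_zero A).trans hA0)
  refine ⟨_, RegularAtZero.of_div (N := A') hB ?_⟩
  filter_upwards [h, eventually_ne_zero] with s hs hs0
  rw [eval_mul, eval_X, mul_div_assoc] at hs
  exact mul_left_cancel₀ hs0 hs

namespace NodalCurve

lemma HasResidue.regularAtZero {η : RatFunc ℂ} {p : P1} {r : ℂ} (h : HasResidue η p r) :
    RegularAtZero (fun s => s * formCoeff η p s) r := by
  obtain ⟨A, B, hB, hr, h⟩ := h
  exact ⟨A, B, hB, hr.symm, h⟩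

lemma HasResidue.unique {η : RatFunc ℂ} {p : P1} {r t : ℂ} (h : HasResidue η p r)
    (h' : HasResidue η p t) : r = t :=
  h.regularAtZero.unique h'.regularAtZero

lemma HasResidue.sub {η θ : RatFunc ℂ} {p : P1} {r t : ℂ} (hη : HasResidue η p r)
    (hθ : HasResidue θ p t) : HasResidue (η - θ) p (r - t) := by
  simpa [← sub_eq_add_neg] using hη.add (hθ.smul (-1))

lemma formCoeff_fin (η : RatFunc ℂ) (a s : ℂ) :
    formCoeff η (P1.fin a) s = η.eval (RingHom.id ℂ) (a + s) := rfl

lemma formCoeff_inf (η : RatFunc ℂ) (s : ℂ) :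
    formCoeff η P1.inf s = -(η.eval (RingHom.id ℂ) s⁻¹) / s ^ 2 := rfl

lemma HasResidue.denom_eval_ne_zero {η : RatFunc ℂ} {a : ℂ} (h : HasResidue η (P1.fin a) 0) :
    η.denom.eval a ≠ 0 := by
  intro hden
  obtain ⟨v, hv⟩ := h.regularAtZero.exists_of_mul_id
  have hcomp : η.denom.comp (X + C a) ≠ 0 :=
    comp_X_add_C_ne_zero_iff.mpr (RatFunc.denom_ne_zero η)
  have hnum := hv.eval_zero_eq_mul (N := η.num.comp (X + C a)) hcomp
    (Eventually.of_forall fun s => by simp [formCoeff_fin, RatFunc.eval, add_comm])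
  simp only [eval_comp, eval_add, eval_X, eval_C, zero_add, hden, mul_zero] at hnum
  obtain ⟨u, v, huv⟩ := RatFunc.isCoprime_num_denom η
  simpa [hnum, hden] using congrArg (eval a) huv

/-- Such a form is a polynomial multiple of `dz`, and `dz` has a double pole at infinity. -/
lemma eq_zero_of_hasResidue {η : RatFunc ℂ} {r : ℂ} (h : ∀ a, HasResidue η (P1.fin a) 0)
    (h' : HasResidue η P1.inf r) : η = 0 := by
  have hdeg : η.denom.degree = 0 := by
    by_contra hd
    obtain ⟨a, ha⟩ := IsAlgClosed.exists_root η.denom hd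
    exact (h a).denom_eval_ne_zero ha
  have hden : η.denom = 1 := (Monic.natDegree_eq_zero (RatFunc.monic_denom η)).mp
    (natDegree_eq_of_degree_eq_some hdeg)
  have hlead := h'.regularAtZero.eval_zero_eq_mul (N := -η.num.reflect η.num.natDegree)
    (M := X ^ (η.num.natDegree + 1)) (pow_ne_zero _ X_ne_zero) (by
      filter_upwards [eventually_ne_zero] with s hs
      rw [formCoeff_inf, RatFunc.eval, hden, eval₂_one, div_one, eval₂_id, eval_neg,
        eval_reflect_eq le_rfl hs, eval_pow, eval_X]
      field_simp
      ring)
  simp only [eval_neg, eval_zero_reflect, coeff_natDegree, eval_pow, eval_X, ne_eq,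
    Nat.add_eq_zero_iff, one_ne_zero, and_false, not_false_eq_true, zero_pow, mul_zero,
    neg_eq_zero] at hlead
  exact RatFunc.num_eq_zero_iff.mp (leadingCoeff_eq_zero.mp hlead)

/-- The form `dz / (z - q)`, with residue `1` at `q` and `-1` at infinity, for a finite point `q`,
and zero for `q = ∞`. -/
def simplePole (q : P1) : RatFunc ℂ :=
  (CofiniteTopology.of.symm q).elim 0 fun a => (algebraMap ℂ[X] (RatFunc ℂ) (X - C a))⁻¹

lemma simplePole_fin (a : ℂ) :
    simplePole (P1.fin a) = (algebraMap ℂ[X] (RatFunc ℂ) (X - C a))⁻¹ := rfl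

lemma simplePole_inf : simplePole P1.inf = 0 := rfl

lemma eventually_eval_simplePole (a : ℂ) : ∀ᶠ z in cofinite,
    (simplePole (P1.fin a)).eval (RingHom.id ℂ) z = (z - a)⁻¹ := by
  have hX : algebraMap ℂ[X] (RatFunc ℂ) (X - C a) ≠ 0 :=
    RatFunc.algebraMap_ne_zero (X_sub_C_ne_zero a)
  filter_upwards [eventually_denom (simplePole (P1.fin a))] with z hz
  have hmul := RatFunc.eval_mul (y := algebraMap ℂ[X] (RatFunc ℂ) (X - C a)) (RingHom.id ℂ) z hz
    (by rw [RatFunc.denom_algebraMap]; simp)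
  nth_rw 1 [simplePole_fin, inv_mul_cancel₀ hX, RatFunc.eval_algebraMap] at hmul
  exact eq_inv_of_mul_eq_one_left (by simpa using hmul.symm)

lemma hasResidue_simplePole_fin_inf (a : ℂ) : HasResidue (simplePole (P1.fin a)) P1.inf (-1) := by
  refine ⟨-1, 1 - C a * X, by simp, by simp, ?_⟩
  filter_upwards [(inv_injective (G := ℂ)).tendsto_cofinite.eventually
    (eventually_eval_simplePole a), eventually_ne_zero] with s hs hs0
  rw [formCoeff_inf, hs, show s⁻¹ - a = (1 - a * s) / s by field_simp, inv_div]
  simp only [eval_neg, eval_one, eval_sub, eval_mul, eval_C, eval_X]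
  field_simp

open Classical in
lemma hasResidue_simplePole_fin_fin (a b : ℂ) :
    HasResidue (simplePole (P1.fin a)) (P1.fin b) (if a = b then 1 else 0) := by
  have hev := (add_right_injective b).tendsto_cofinite.eventually (eventually_eval_simplePole a)
  split_ifs with hab
  · subst hab
    refine ⟨1, 1, by simp, by simp, ?_⟩
    filter_upwards [hev, eventually_ne_zero] with s hs hs0
    simp [formCoeff_fin, hs, hs0]
  · refine ⟨X, X + C (b - a), by simpa [sub_eq_zero] using Ne.symm hab, by simp, ?_⟩
    filter_upwards [hev] with s hs
    rw [formCoeff_fin, hs, eval_X, eval_add, eval_X, eval_C, ← div_eq_mul_inv,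
      add_sub_right_comm, add_comm]

open Classical in
lemma hasResidue_simplePole (q p : P1) : HasResidue (simplePole q) p
    ((if q = p then 1 else 0) - (if p = P1.inf then 1 else 0)) := by
  rcases P1.eq_inf_or_eq_fin q with rfl | ⟨a, rfl⟩
  · simpa [simplePole_inf, eq_comm] using hasResidue_zero p
  rcases P1.eq_inf_or_eq_fin p with rfl | ⟨b, rfl⟩
  · simpa [P1.fin_ne_inf] using hasResidue_simplePole_fin_inf a
  · simpa [P1.fin_ne_inf, P1.fin_injective.eq_iff] using hasResidue_simplePole_fin_fin a b

open Classical in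
lemma hasResidue_linearCombination_simplePole (D : P1 →₀ ℂ) (p : P1) :
    HasResidue (Finsupp.linearCombination ℂ simplePole D) p
      (D p - if p = P1.inf then D.degree else 0) := by
  induction D using Finsupp.induction_linear with
  | zero => simpa using hasResidue_zero p
  | add D D' hD hD' =>
    rw [map_add]
    convert hD.add hD' using 1
    rw [Finsupp.add_apply, map_add]
    split_ifs <;> ring
  | single q c =>
    rw [Finsupp.linearCombination_single]
    convert (hasResidue_simplePole q p).smul c using 1
    rw [Finsupp.single_apply, Finsupp.degree_single]
    split_ifs <;> ring

variable (C : NodalCurve)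

/-- The divisor on the normalization with coefficients `r ν` and `-r ν` at the two branches of each
node `ν`: these are the residues of a section of the dualizing sheaf. -/
def residueDivisor : (C.Node → ℂ) →ₗ[ℂ] C.Norm →₀ ℂ :=
  ∑ ν, (Finsupp.lsingle (C.branch ν false) - Finsupp.lsingle (C.branch ν true)) ∘ₗ
    LinearMap.proj ν

lemma residueDivisor_apply (r : C.Node → ℂ) : C.residueDivisor r =
    ∑ ν, (Finsupp.single (C.branch ν false) (r ν) - Finsupp.single (C.branch ν true) (r ν)) := by
  simp [residueDivisor, LinearMap.sum_apply]

variable {C} in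
lemma residueDivisor_of_forall_branch_ne (r : C.Node → ℂ) {y : C.Norm}
    (h : ∀ ν b, C.branch ν b ≠ y) : C.residueDivisor r y = 0 := by
  simp [residueDivisor_apply, h]

lemma residueDivisor_branch_false (r : C.Node → ℂ) (ν : C.Node) :
    C.residueDivisor r (C.branch ν false) = r ν := by
  classical
  have hinj (x y : C.Node × Bool) : C.branch x.1 x.2 = C.branch y.1 y.2 ↔ x = y :=
    C.branch_injective.eq_iff
  simp [residueDivisor_apply, Finsupp.single_apply, fun μ b => hinj (μ, b) (ν, false)]

lemma residueDivisor_branch_true (r : C.Node → ℂ) (ν : C.Node) :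
    C.residueDivisor r (C.branch ν true) = -r ν := by
  classical
  have hinj (x y : C.Node × Bool) : C.branch x.1 x.2 = C.branch y.1 y.2 ↔ x = y :=
    C.branch_injective.eq_iff
  simp [residueDivisor_apply, Finsupp.single_apply, fun μ b => hinj (μ, b) (ν, true)]

lemma mem_dualizingSections_iff {η : C.Comp → RatFunc ℂ} :
    η ∈ C.dualizingSections ↔ ∃ r, ∀ i p, HasResidue (η i) p (C.residueDivisor r ⟨i, p⟩) := by
  constructor
  · rintro ⟨hreg, hnode⟩
    choose r hr hr' using hnode
    suffices h : ∀ y : C.Norm, HasResidue (η y.1) y.2 (C.residueDivisor r y) from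
      ⟨r, fun i p => h ⟨i, p⟩⟩
    intro y
    by_cases hy : ∀ ν b, C.branch ν b ≠ y
    · rw [residueDivisor_of_forall_branch_ne r hy]
      exact hreg y.1 y.2 hy
    push Not at hy
    obtain ⟨ν, b, rfl⟩ := hy
    cases b
    · exact (C.residueDivisor_branch_false r ν).symm ▸ hr ν
    · exact (C.residueDivisor_branch_true r ν).symm ▸ hr' ν
  · rintro ⟨r, hr⟩
    refine ⟨fun i p h => residueDivisor_of_forall_branch_ne r h ▸ hr i p, fun ν => ⟨r ν, ?_, ?_⟩⟩
    · exact C.residueDivisor_branch_false r ν ▸ hr _ _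
    · exact C.residueDivisor_branch_true r ν ▸ hr _ _

open Classical in
/-- The incidence matrix of the dual graph of a nodal curve. -/
abbrev dualIncidence : Matrix C.Comp C.Node ℂ :=
  incidence ℂ (fun ν => (C.branch ν false).1) fun ν => (C.branch ν true).1

/-- The part of a divisor on the normalization that is supported on the component `i`. -/
abbrev restrictToComp (i : C.Comp) : (C.Norm →₀ ℂ) →ₗ[ℂ] P1 →₀ ℂ :=
  Finsupp.lcomapDomain (fun p => (⟨i, p⟩ : C.Norm)) fun _ _ h => eq_of_heq (Sigma.mk.inj h).2

open Classical in
lemma degree_restrictToComp_single (i : C.Comp) (y : C.Norm) (c : ℂ) :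
    (C.restrictToComp i (Finsupp.single y c)).degree = if y.1 = i then c else 0 := by
  change (Finsupp.comapDomain (fun p => (⟨i, p⟩ : C.Norm)) (Finsupp.single y c) _).degree = _
  split_ifs with h
  · subst h
    exact (congrArg _ (Finsupp.comapDomain_single _ y.2 c _)).trans (Finsupp.degree_single y.2 c)
  · rw [Finsupp.comapDomain_single_of_not_mem_range, map_zero]
    rintro ⟨q, rfl⟩
    exact h rfl

lemma degree_restrictToComp_residueDivisor (r : C.Node → ℂ) (i : C.Comp) :
    (C.restrictToComp i (C.residueDivisor r)).degree = -C.dualIncidence.mulVec r i := by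
  classical
  simp only [residueDivisor_apply, map_sum, map_sub, degree_restrictToComp_single,
    Matrix.mulVec, dotProduct, ← Finset.sum_neg_distrib]
  refine Finset.sum_congr rfl fun ν _ => ?_
  simp only [incidence, Matrix.of_apply]
  split_ifs <;> ring

/-- The forms on the components whose residues at the finite points are given by
`residueDivisor`. -/
def formsOfResidues : (C.Node → ℂ) →ₗ[ℂ] (C.Comp → RatFunc ℂ) :=
  LinearMap.pi fun i =>
    Finsupp.linearCombination ℂ simplePole ∘ₗ C.restrictToComp i ∘ₗ C.residueDivisor

open Classical in
lemma hasResidue_formsOfResidues (r : C.Node → ℂ) (i : C.Comp) (p : P1) :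
    HasResidue (C.formsOfResidues r i) p (C.residueDivisor r ⟨i, p⟩ +
      if p = P1.inf then C.dualIncidence.mulVec r i else 0) := by
  have h := hasResidue_linearCombination_simplePole (C.restrictToComp i (C.residueDivisor r)) p
  rw [degree_restrictToComp_residueDivisor, sub_eq_add_neg, apply_ite Neg.neg, neg_neg,
    neg_zero] at h
  have hp : C.restrictToComp i (C.residueDivisor r) p = C.residueDivisor r ⟨i, p⟩ := rfl
  rw [hp] at h
  exact h

variable {C}

lemma hasResidue_formsOfResidues_of_mem_ker {r : C.Node → ℂ}
    (hr : r ∈ LinearMap.ker C.dualIncidence.mulVecLin) (i : C.Comp) (p : P1) :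
    HasResidue (C.formsOfResidues r i) p (C.residueDivisor r ⟨i, p⟩) := by
  have h := C.hasResidue_formsOfResidues r i p
  rwa [show C.dualIncidence.mulVec r i = 0 from congrFun hr i, ite_self, add_zero] at h

lemma formsOfResidues_mem_dualizingSections {r : C.Node → ℂ}
    (hr : r ∈ LinearMap.ker C.dualIncidence.mulVecLin) :
    C.formsOfResidues r ∈ C.dualizingSections :=
  C.mem_dualizingSections_iff.mpr ⟨r, hasResidue_formsOfResidues_of_mem_ker hr⟩

lemma eq_of_formsOfResidues_eq {r t : C.Node → ℂ}
    (hr : r ∈ LinearMap.ker C.dualIncidence.mulVecLin)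
    (ht : t ∈ LinearMap.ker C.dualIncidence.mulVecLin)
    (h : C.formsOfResidues r = C.formsOfResidues t) : r = t := by
  funext ν
  have hr' := hasResidue_formsOfResidues_of_mem_ker hr (C.branch ν false).1 (C.branch ν false).2
  have ht' := hasResidue_formsOfResidues_of_mem_ker ht (C.branch ν false).1 (C.branch ν false).2
  rw [Sigma.eta, residueDivisor_branch_false] at hr' ht'
  exact hr'.unique (h ▸ ht')

lemma exists_formsOfResidues_eq {η : C.Comp → RatFunc ℂ} (hη : η ∈ C.dualizingSections) :
    ∃ r ∈ LinearMap.ker C.dualIncidence.mulVecLin, C.formsOfResidues r = η := by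
  obtain ⟨r, hr⟩ := C.mem_dualizingSections_iff.mp hη
  have hfin (i : C.Comp) (a : ℂ) : HasResidue (η i - C.formsOfResidues r i) (P1.fin a) 0 := by
    simpa [P1.fin_ne_inf] using (hr i (P1.fin a)).sub (C.hasResidue_formsOfResidues r i (P1.fin a))
  have hinf (i : C.Comp) : HasResidue (η i - C.formsOfResidues r i) P1.inf
      (-C.dualIncidence.mulVec r i) := by
    simpa using (hr i P1.inf).sub (C.hasResidue_formsOfResidues r i P1.inf)
  have hzero (i : C.Comp) : η i - C.formsOfResidues r i = 0 :=
    eq_zero_of_hasResidue (hfin i) (hinf i)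
  refine ⟨r, LinearMap.mem_ker.mpr (funext fun i => ?_), funext fun i =>
    (sub_eq_zero.mp (hzero i)).symm⟩
  exact neg_eq_zero.mp ((hzero i ▸ hinf i).unique (hasResidue_zero P1.inf))

variable (C)

/-- The sections of the dualizing sheaf correspond to the cycles of the dual graph: the coefficient
of a node is the residue at its first branch. -/
def cyclesEquiv : LinearMap.ker C.dualIncidence.mulVecLin ≃ₗ[ℂ] C.dualizingSections :=
  LinearEquiv.ofBijective ((C.formsOfResidues.domRestrict _).codRestrict _ fun r =>
    formsOfResidues_mem_dualizingSections r.2)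
    ⟨fun r t h => Subtype.ext (eq_of_formsOfResidues_eq r.2 t.2 (congrArg Subtype.val h)),
      fun η => (exists_formsOfResidues_eq η.2).elim fun r hr => ⟨⟨r, hr.1⟩, Subtype.ext hr.2⟩⟩

instance : Module.Finite ℂ C.dualizingSections := Module.Finite.equiv C.cyclesEquiv

lemma finrank_dualizingSections :
    Module.finrank ℂ C.dualizingSections + Fintype.card C.Comp = Fintype.card C.Node + 1 := by
  classical
  rw [← C.cyclesEquiv.finrank_eq, ← C.card_components_dualGraph]
  exact finrank_ker_incidence ℂ _ _

end NodalCurve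

end Dualizing

end TropDeg

end

theorem proposition3p2_general {n : ℕ} (T : TropDeg.TropicalCurve n)
    (hT : ∀ c ∈ LinearMap.ker T.boundary, (∀ e, c e ≠ 0 → T.Contracted e) → c = 0)
    (P : TropDeg.PolyDecomp n) (C : TropDeg.NodalCurve) (φ : TropDeg.Mor C.Point P.Total)
    (comp : T.Cluster ≃ C.Comp) (node : T.EdgeNC ≃ C.Node) :
    Module.rank ℂ (TropDeg.PullbackH1 φ) = ((n * T.genus : ℕ) : Cardinal) ∧
      Module.rank ℂ C.dualizingSections = (T.genus : Cardinal) := by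
  have hgenus : T.genus + Fintype.card C.Comp = Fintype.card C.Node + 1 := by
    rw [← Nat.card_eq_fintype_card, ← Nat.card_eq_fintype_card, ← Nat.card_congr comp,
      ← Nat.card_congr node]
    exact T.genus_add_card_cluster hT
  have hH1 := TropDeg.finrank_pullbackH1 φ
  have hω := C.finrank_dualizingSections
  rw [← Module.finrank_eq_rank, ← Module.finrank_eq_rank]
  constructor <;> congr 1
  · nlinarith
  · omega

theorem proposition3p2 {n : ℕ} (hn : 2 ≤ n)
    (T : TropDeg.TropicalCurve n) (hT : T.Admissible)
    (P : TropDeg.PolyDecomp n) (hP : P.Respects T)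
    (C : TropDeg.NodalCurve) (φ : TropDeg.Mor C.Point P.Total)
    (hφ : TropDeg.IsPreLog φ) (hφT : TropDeg.IsOfType φ T) :
    Module.rank ℂ (TropDeg.PullbackH1 φ) = ((n * T.genus : ℕ) : Cardinal) ∧
      Module.rank ℂ C.dualizingSections = (T.genus : Cardinal) := by
  obtain ⟨comp, node, -⟩ := hφT
  exact proposition3p2_general T hT.noContractedLoop P C φ comp node
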